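/- Let $G=(V,E)$ be a finite graph of maximum degree $\Delta$ whose vertex set is partitioned into nonempty blocks, each of size $b$. A transversal is a set of vertices containing exactly one vertex of each block. A transversal $T$ omits $s$-stars if every vertex of $T$ has fewer than $s$ neighbours in $T$, and omits $K_s$ if no $s$ vertices of $T$ are pairwise adjacent. Let $\gamma_s$ be the infimum of the real numbers $\gamma$ such that, for every such graph and partition, $b\ge\gamma\Delta$ implies that there is a transversal omitting $K_s$. **Theorem.** There is a constant $c>0$ such that the following hold for every integer $s\ge 2$. 1. Whenever $$b\ \ge\ \frac{\Delta}{s}\Bigl(1+c\sqrt{\frac{\log s}{s}}\Bigr),$$ there is a transversal which omits all $s$-stars and all cliques $K_s$. 2. Such a transversal can be found in (expected) polynomial time: there are a single randomized random-access-machine program and a polynomial $p$, both independent of $s$ and of the graph, such that on every input $(G,\text{partition},s)$ with $n=|V|$ satisfying the condition of part 1 the program halts after an expected number of at most $p(n)$ steps (hence with probability one), and whenever it halts its output is a transversal as in part 1. (The machine operates on natural numbers at unit cost with addition, truncated subtraction, comparison, indirect memory access, and draws of a uniformly random element of $\{0,\dots,k\}$, where $k$ is the content of a register; it has no multiplication.)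 3. The real number $\gamma=\frac1s\bigl(1+c\sqrt{\log s/s}\bigr)$ has the property in the definition of $\gamma_s$; in particular $$\gamma_s\ \le\ \frac1s\Bigl(1+c\sqrt{\frac{\log s}{s}}\Bigr)=\frac1s\Bigl(1+O\Bigl(\sqrt{\frac{\log s}{s}}\Bigr)\Bigr).$$ Moreover the value $\gamma_s=\frac{s}{(s-1)^2}$ conjectured by Szabó and Tardos is asymptotically correct: $\gamma_s\sim\frac{s}{(s-1)^2}$ as $s\to\infty$. -/

import Mathlib

noncomputable section

namespace AvoidClique

/-! ## Transversals and the subgraphs they omit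

A partition of `V` into blocks indexed by `ι` is given by the map `blk : V → ι` sending each
vertex to its block. -/

/-- `T` contains exactly one vertex of every block. -/
def IsTransversal {V ι : Type*} (blk : V → ι) (T : Set V) : Prop :=
  ∀ i : ι, ∃! v : V, v ∈ T ∧ blk v = i

/-- Every block has exactly `b` vertices. -/
def BlocksHaveSize {V ι : Type*} (blk : V → ι) (b : ℕ) : Prop :=
  ∀ i : ι, {v : V | blk v = i}.ncard = b

/-- The subgraph induced on `T` omits `s`-stars (a vertex together with `s` neighbours): every
vertex of `T` has fewer than `s` neighbours in `T`. Meant for finite `V`. -/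
def OmitsStars {V : Type*} (G : SimpleGraph V) (T : Set V) (s : ℕ) : Prop :=
  ∀ v ∈ T, (G.neighborSet v ∩ T).ncard < s

/-- `T` is a transversal that omits all `s`-stars and all cliques `K_s`. -/
def IsGoodTransversal {V ι : Type*} (G : SimpleGraph V) (blk : V → ι) (s : ℕ) (T : Set V) : Prop :=
  IsTransversal blk T ∧ OmitsStars G T s ∧ G.CliqueFreeOn T s

/-- The condition `b ≥ g * Δ` guarantees a transversal omitting `K_s`, for all finite graphs (of
maximum degree `Δ`) whose vertices are partitioned into nonempty blocks of size `b`. -/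
def CliqueAdmissible (s : ℕ) (g : ℝ) : Prop :=
  ∀ (n l b : ℕ) (G : SimpleGraph (Fin n)) [DecidableRel G.Adj] (blk : Fin n → Fin l),
    0 < b → BlocksHaveSize blk b → g * (G.maxDegree : ℝ) ≤ (b : ℝ) →
      ∃ T : Set (Fin n), IsTransversal blk T ∧ G.CliqueFreeOn T s

/-- The optimal constant `γ_s` in a bound of the form `b ≥ γ_s * Δ`. -/
def gammaConst (s : ℕ) : ℝ := sInf {g : ℝ | CliqueAdmissible s g}

/-! ## A randomized random-access machine with a step count

Natural numbers are held in registers `R_0, R_1, …` and in memory cells `M[x, y]`. Every elementary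
step costs one unit. The only arithmetic operations are addition and truncated subtraction (there
is no multiplication), so after `t` steps every number has at most `t` bits more than the largest
number of the input or of the program, and unit cost is polynomially related to bit cost. -/

/-- Programs. -/
inductive Cmd : Type where
  /-- `R_r := k` -/
  | const (r k : ℕ) : Cmd
  /-- `R_r := R_x + R_y` -/
  | add (r x y : ℕ) : Cmd
  /-- `R_r := max (R_x - R_y) 0` -/
  | sub (r x y : ℕ) : Cmd
  /-- `R_r := M[R_x, R_y]` -/
  | load (r x y : ℕ) : Cmd
  /-- `M[R_x, R_y] := R_r` -/
  | store (x y r : ℕ) : Cmd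
  /-- `R_r :=` a fresh uniformly random element of `{0, 1, …, R_x}` -/
  | rand (r x : ℕ) : Cmd
  /-- first `p`, then `q` -/
  | seq (p q : Cmd) : Cmd
  /-- if `R_x < R_y` then `p` else `q` -/
  | cond (x y : ℕ) (p q : Cmd) : Cmd
  /-- while `R_x < R_y` do `p` -/
  | loop (x y : ℕ) (p : Cmd) : Cmd

/-- The contents of the registers and of the memory. -/
structure Store : Type where
  reg : ℕ → ℕ
  mem : ℕ → ℕ → ℕ

/-- The store after `R_r := k`. -/
def Store.setReg (σ : Store) (r k : ℕ) : Store :=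
  { σ with reg := Function.update σ.reg r k }

/-- The store after `M[i, j] := k`. -/
def Store.setMem (σ : Store) (i j k : ℕ) : Store :=
  { σ with mem := Function.update σ.mem i (Function.update (σ.mem i) j k) }

/-- A configuration: the commands still to be carried out, in order, and the store. -/
abbrev Config : Type := List Cmd × Store

/-- The machine has halted when no command is left. -/
def Halted (d : Config) : Prop := d.1 = []

/-- One step of the machine: the distribution of the next configuration. -/
def step : Config → PMF Config
  | ([], σ) => PMF.pure ([], σ)
  | (Cmd.const r k :: K, σ) => PMF.pure (K, σ.setReg r k)
  | (Cmd.add r x y :: K, σ) => PMF.pure (K, σ.setReg r (σ.reg x + σ.reg y))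
  | (Cmd.sub r x y :: K, σ) => PMF.pure (K, σ.setReg r (σ.reg x - σ.reg y))
  | (Cmd.load r x y :: K, σ) => PMF.pure (K, σ.setReg r (σ.mem (σ.reg x) (σ.reg y)))
  | (Cmd.store x y r :: K, σ) => PMF.pure (K, σ.setMem (σ.reg x) (σ.reg y) (σ.reg r))
  | (Cmd.rand r x :: K, σ) =>
      (PMF.uniformOfFintype (Fin (σ.reg x + 1))).map fun k => (K, σ.setReg r (k : ℕ))
  | (Cmd.seq p q :: K, σ) => PMF.pure (p :: q :: K, σ)
  | (Cmd.cond x y p q :: K, σ) =>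
      PMF.pure (if σ.reg x < σ.reg y then p :: K else q :: K, σ)
  | (Cmd.loop x y p :: K, σ) =>
      PMF.pure (if σ.reg x < σ.reg y then p :: Cmd.loop x y p :: K else K, σ)

/-- The distribution of the configuration after `t` steps. -/
def run : ℕ → Config → PMF Config
  | 0, d => PMF.pure d
  | t + 1, d => (step d).bind (run t)

/-- The expected number of steps until the program `P`, started on the store `σ`, halts: the sum
over `t ≥ 0` of the probability that it has not halted after `t` steps. If this is finite then the
program halts with probability one. -/
def expectedTime (P : Cmd) (σ : Store) : ENNReal :=
  ∑' t : ℕ, (run t ([P], σ)).toOuterMeasure {d | ¬ Halted d}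

/-- The input: `R_0 = n` is the number of vertices, `R_1 = l` the number of blocks, `R_2 = s`;
`M[0, v]` is the block of the vertex `v`; the rows `M[u + 2, ·]` are the adjacency matrix; all other
registers and cells are zero. -/
def inputStore {n l : ℕ} (G : SimpleGraph (Fin n)) (blk : Fin n → Fin l) (s : ℕ) : Store where
  reg := fun r => if r = 0 then n else if r = 1 then l else if r = 2 then s else 0
  mem := fun i j =>
    open Classical in
    if i = 0 then (if h : j < n then (blk ⟨j, h⟩ : ℕ) else 0)
    else if ∃ u v : Fin n, i = (u : ℕ) + 2 ∧ j = (v : ℕ) ∧ G.Adj u v then 1 else 0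

/-- The output: the set of the vertices listed in the cells `M[1, 0], …, M[1, l - 1]`. -/
def outputSet (n l : ℕ) (σ : Store) : Set (Fin n) :=
  {v : Fin n | ∃ i < l, σ.mem 1 i = (v : ℕ)}

end AvoidClique

end

/-! A transversal is a selection of one vertex per block. Put `t = s - 1`. It suffices that every
selected vertex has fewer than `t` selected neighbours: this excludes `s`-stars, and also `K_s`,
whose vertices have `s - 1` neighbours in it.

Such a selection is found by partial resampling. Start with a uniformly random selection and a stack
of all blocks. Pop a block `i`. If neither its vertex nor any selected neighbour of it has `t`
selected neighbours, go on. Otherwise let `j` be the first such centre; redraw `i`, `j` and,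
independently with probability `q = num / Q`, each other selected neighbour of the centre, and push
the redrawn blocks. Among the blocks off the stack all degrees stay below `t` (`CleanOutside`), so
an empty stack means success.

Why it stops (`expect_survival_le`): as the centre has degree at least `t`, the probability that
exactly the set `Y` is redrawn is at most `(1 - q)^t`, or `(1 - q)^(t-1)` if `j ≠ i`, times a weight
with a factor `ρ = q / (1 - q)` for each optional block of `Y` (`expect_marks_eq_le`). This weight
reads only the selection on `Y`, which is about to be redrawn; hence the new selection is uniform
and independent of the weight (`expect_expect_mul_piecewise`). By induction, surviving `τ` rounds
from a stack `K` has probability at most `y^|K| / z^τ`, provided that `ProcessCondition` holds with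
`μ = Δ / b`. There the `1` is a round that only pops, and the other term sums the weights over all
`j` and `Y` (`expect_sum_markWeight_le`).

For the constants: `(1 - q)^t * exp (ρ μ)` is roughly `exp (-q (s - μ) + q^2 μ)`. With `q` of order
`√(log s / s)` it beats any fixed power of `s` once `s - μ` is a large multiple of `√(s log s)`,
which is the error term of the theorem. For bounded `s`, the constant `c` is so large that `μ` is
tiny.

Time and correctness of the program come from one inequality. `ert` bounds the expected number of
steps plus the expected value of a function of the final store; with the function that is `0` on
good outputs and `∞` on others, a finite bound gives both (`expectedTime_le_ert`,
`of_halted_of_ert_ne_top`). Existence follows, since some run must halt. Finally, `K_s` with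
singleton blocks gives `γ_s ≥ 1 / (s - 1)`, and the two bounds squeeze `γ_s`. -/

open scoped ENNReal BigOperators

namespace AvoidClique

/-! ## Expected running time calculus -/

/-- The expected number of steps of a program plus the expected value of `f` on its final store,
with loops bounded by their invariants. -/
noncomputable def ert : Cmd → (Store → ℝ≥0∞) → Store → ℝ≥0∞
  | Cmd.const r k, f, σ => 1 + f (σ.setReg r k)
  | Cmd.add r x y, f, σ => 1 + f (σ.setReg r (σ.reg x + σ.reg y))
  | Cmd.sub r x y, f, σ => 1 + f (σ.setReg r (σ.reg x - σ.reg y))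
  | Cmd.load r x y, f, σ => 1 + f (σ.setReg r (σ.mem (σ.reg x) (σ.reg y)))
  | Cmd.store x y r, f, σ => 1 + f (σ.setMem (σ.reg x) (σ.reg y) (σ.reg r))
  | Cmd.rand r x, f, σ =>
      1 + (∑ k : Fin (σ.reg x + 1), f (σ.setReg r k)) / ((σ.reg x + 1 : ℕ) : ℝ≥0∞)
  | Cmd.seq p q, f, σ => 1 + ert p (ert q f) σ
  | Cmd.cond x y p q, f, σ => 1 + if σ.reg x < σ.reg y then ert p f σ else ert q f σ
  | Cmd.loop x y p, f, σ =>
      ⨅ J : {J : Store → ℝ≥0∞ //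
        ∀ τ, 1 + (if τ.reg x < τ.reg y then ert p J τ else f τ) ≤ J τ}, J.1 σ

theorem ert_mono (P : Cmd) : ∀ {f g : Store → ℝ≥0∞}, (∀ σ, f σ ≤ g σ) → ∀ σ,
    ert P f σ ≤ ert P g σ := by
  induction P with
  | const | add | sub | load | store =>
    intro f g h σ
    simp only [ert]
    gcongr
    exact h _
  | rand r x =>
    intro f g h σ
    simp only [ert]
    gcongr
    exact h _
  | seq p q hp hq =>
    intro f g h σ
    simp only [ert]
    gcongr
    exact hp (hq h) σ
  | cond x y p q hp hq =>
    intro f g h σ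
    simp only [ert]
    gcongr
    split_ifs
    · exact hp h σ
    · exact hq h σ
  | loop x y p hp =>
    intro f g h σ
    simp only [ert]
    refine le_iInf fun J => iInf_le_of_le ⟨J.1, fun τ => le_trans ?_ (J.2 τ)⟩ le_rfl
    gcongr
    split_ifs
    · exact le_rfl
    · exact h τ

theorem ert_loop_le_of_invariant {x y : ℕ} {p : Cmd} {f J : Store → ℝ≥0∞}
    (h : ∀ τ, 1 + (if τ.reg x < τ.reg y then ert p J τ else f τ) ≤ J τ) (σ : Store) :
    ert (Cmd.loop x y p) f σ ≤ J σ := by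
  simp only [ert]
  exact iInf_le_of_le ⟨J, h⟩ le_rfl

/-- Knaster–Tarski: the infimum of the invariants is a fixed point of the unfolding. Every invariant
dominates its own unfolding, and the unfolding is monotone in what follows the body. -/
theorem ert_loop_unfold_le (x y : ℕ) (p : Cmd) (f : Store → ℝ≥0∞) (σ : Store) :
    1 + (if σ.reg x < σ.reg y then ert p (ert (Cmd.loop x y p) f) σ else f σ) ≤
      ert (Cmd.loop x y p) f σ := by
  conv_rhs => rw [ert]
  refine le_iInf fun J => le_trans ?_ (J.2 σ)
  gcongr
  split_ifs
  · exact ert_mono p (fun τ => ert_loop_le_of_invariant J.2 τ) σ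
  · exact le_rfl

/-- The unfolding of the least invariant is again an invariant, by the reverse inequality and
monotonicity. -/
theorem ert_loop_le_unfold (x y : ℕ) (p : Cmd) (f : Store → ℝ≥0∞) (σ : Store) :
    ert (Cmd.loop x y p) f σ ≤
      1 + (if σ.reg x < σ.reg y then ert p (ert (Cmd.loop x y p) f) σ else f σ) := by
  refine ert_loop_le_of_invariant (J := fun σ =>
    1 + (if σ.reg x < σ.reg y then ert p (ert (Cmd.loop x y p) f) σ else f σ)) (fun τ => ?_) σ
  gcongr
  split_ifs
  · exact ert_mono p (fun υ => ert_loop_unfold_le x y p f υ) τ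
  · exact le_rfl

/-! ### Soundness -/

/-- The expected number of steps among the first `T`, plus the expected value of `φ` on the stores
reached at a halt. -/
noncomputable def truncatedCost (φ : Store → ℝ≥0∞) : ℕ → Config → ℝ≥0∞
  | 0, d => if d.1 = [] then φ d.2 else 0
  | T + 1, d => if d.1 = [] then φ d.2 else 1 + ∑' a, step d a * truncatedCost φ T a

theorem truncatedCost_nil (φ : Store → ℝ≥0∞) (T : ℕ) (σ : Store) :
    truncatedCost φ T ([], σ) = φ σ := by
  cases T <;> simp [truncatedCost]

theorem tsum_pure_mul {α : Type*} (a : α) (g : α → ℝ≥0∞) :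
    ∑' b, (PMF.pure a) b * g b = g a := by
  classical
  rw [tsum_eq_single a]
  · simp
  · intro b hb
    simp [PMF.pure_apply, hb]

theorem tsum_map_uniform_mul {α : Type*} (m : ℕ) (φ : Fin (m + 1) → α) (g : α → ℝ≥0∞) :
    ∑' b, ((PMF.uniformOfFintype (Fin (m + 1))).map φ) b * g b =
      (∑ k, g (φ k)) / ((m + 1 : ℕ) : ℝ≥0∞) := by
  classical
  have h1 : ∀ b, ((PMF.uniformOfFintype (Fin (m + 1))).map φ) b * g b =
      ∑ k : Fin (m + 1), if b = φ k then ((m + 1 : ℕ) : ℝ≥0∞)⁻¹ * g b else 0 := by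
    intro b
    rw [PMF.map_apply, tsum_fintype, Finset.sum_mul]
    refine Finset.sum_congr rfl fun k _ => ?_
    split_ifs <;> simp [PMF.uniformOfFintype_apply]
  simp_rw [h1]
  rw [Summable.tsum_finsetSum (fun _ _ => ENNReal.summable)]
  simp_rw [tsum_ite_eq]
  rw [← Finset.mul_sum, ENNReal.div_eq_inv_mul]

/-- Structural induction, the continuation `K` being summarised by `f`. The horizon `T` is there for
loops: after the body the continuation contains the loop itself, whose bound is known only for fewer
remaining steps. -/
theorem truncatedCost_le_ert (φ : Store → ℝ≥0∞) (P : Cmd) : ∀ (K : List Cmd)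
    (f : Store → ℝ≥0∞) (T : ℕ), (∀ T' ≤ T, ∀ σ, truncatedCost φ T' (K, σ) ≤ f σ) →
      ∀ T' ≤ T, ∀ σ, truncatedCost φ T' (P :: K, σ) ≤ ert P f σ := by
  induction P with
  | const | add | sub | load | store =>
    intro K f T h T' hT σ
    cases T' with
    | zero => simp [truncatedCost]
    | succ T' =>
      simp only [truncatedCost, step, tsum_pure_mul, ert, reduceCtorEq, if_false]
      gcongr
      exact h T' (by omega) _
  | rand r x =>
    intro K f T h T' hT σ
    cases T' with
    | zero => simp [truncatedCost]
    | succ T' =>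
      -- In `step` the draw is first mapped from `Fin` to `ℕ`; the two maps are fused here.
      have h1 : step (Cmd.rand r x :: K, σ) = (PMF.uniformOfFintype (Fin (σ.reg x + 1))).map
          fun k : Fin (σ.reg x + 1) => (K, σ.setReg r (k : ℕ)) :=
        PMF.map_comp (fun k : Fin (σ.reg x + 1) => (k : ℕ)) _ fun k => (K, σ.setReg r k)
      simp only [truncatedCost, h1, ert, reduceCtorEq, if_false, tsum_map_uniform_mul]
      gcongr
      exact h T' (by omega) _
  | seq p q hp hq =>
    intro K f T h T' hT σ
    cases T' with
    | zero => simp [truncatedCost]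
    | succ T' =>
      simp only [truncatedCost, step, tsum_pure_mul, ert, reduceCtorEq, if_false]
      gcongr
      exact hp (q :: K) _ T (hq K f T h) T' (by omega) σ
  | cond x y p q hp hq =>
    intro K f T h T' hT σ
    cases T' with
    | zero => simp [truncatedCost]
    | succ T' =>
      simp only [truncatedCost, step, tsum_pure_mul, ert, reduceCtorEq, if_false]
      gcongr
      split_ifs
      · exact hp K f T h T' (by omega) σ
      · exact hq K f T h T' (by omega) σ
  | loop x y p hp =>
    intro K f T h T' hT
    induction T' using Nat.strong_induction_on with
    | _ T' ih =>
      intro σ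
      cases T' with
      | zero => simp [truncatedCost]
      | succ T' =>
        refine le_trans ?_ (ert_loop_unfold_le x y p f σ)
        simp only [truncatedCost, step, tsum_pure_mul, reduceCtorEq, if_false]
        gcongr
        split_ifs
        · exact hp (Cmd.loop x y p :: K) _ T'
            (fun T'' h'' τ => ih T'' (by omega) (by omega) τ) T' le_rfl σ
        · exact h T' (by omega) σ

/-- Each configuration that has not halted is charged one unit, which is the tail-sum formula for
the expected halting time. -/
theorem sum_not_halted_le (φ : Store → ℝ≥0∞) (T : ℕ) : ∀ d : Config,
    ∑ t ∈ Finset.range T, (run t d).toOuterMeasure {d | ¬ Halted d} ≤ truncatedCost φ T d := by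
  induction T with
  | zero => intro d; simp
  | succ T ih =>
    intro d
    obtain ⟨K, σ⟩ := d
    cases K with
    | nil =>
      have h0 : ∀ t, run t ([], σ) = PMF.pure ([], σ) := by
        intro t
        induction t with
        | zero => rfl
        | succ t ih => simp [run, step, ih]
      simp [h0, Halted, PMF.toOuterMeasure_pure_apply]
    | cons c K =>
      rw [Finset.sum_range_succ']
      simp only [run, PMF.toOuterMeasure_bind_apply, truncatedCost, reduceCtorEq, if_false]
      rw [add_comm]
      gcongr
      · rw [PMF.toOuterMeasure_pure_apply]
        split_ifs <;> simp
      · rw [← Summable.tsum_finsetSum (fun _ _ => ENNReal.summable)]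
        refine ENNReal.tsum_le_tsum fun a => ?_
        rw [← Finset.mul_sum]
        gcongr
        exact ih a

/-- A halt of positive probability in a store where `φ` is infinite would make the whole cost
infinite. -/
theorem ne_top_of_mem_support (φ : Store → ℝ≥0∞) (t : ℕ) : ∀ d d' : Config,
    truncatedCost φ t d ≠ ∞ → d' ∈ (run t d).support → Halted d' → φ d'.2 ≠ ∞ := by
  induction t with
  | zero =>
    intro d d' h hd hh
    simp only [run, PMF.support_pure, Set.mem_singleton_iff] at hd
    subst hd
    simpa [truncatedCost, show d'.1 = [] from hh] using h
  | succ t ih =>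
    intro d d' h hd hh
    simp only [run, PMF.mem_support_bind_iff] at hd
    obtain ⟨a, ha, hd⟩ := hd
    refine ih a d' (fun htop => h ?_) hd hh
    obtain ⟨K, σ⟩ := d
    cases K with
    | nil =>
      simp only [step, PMF.support_pure, Set.mem_singleton_iff] at ha
      subst ha
      rw [truncatedCost_nil] at htop ⊢
      exact htop
    | cons c K =>
      simp only [truncatedCost, reduceCtorEq, if_false]
      refine top_le_iff.1 (le_add_left (le_trans ?_ (ENNReal.le_tsum a)))
      rw [htop, ENNReal.mul_top ((PMF.mem_support_iff _ _).1 ha)]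

theorem expectedTime_le_ert (P : Cmd) (φ : Store → ℝ≥0∞) (σ : Store) :
    expectedTime P σ ≤ ert P φ σ := by
  unfold expectedTime
  refine ENNReal.tsum_le_of_sum_range_le fun T => (sum_not_halted_le φ T _).trans ?_
  exact truncatedCost_le_ert φ P [] φ T (fun T' _ σ => (truncatedCost_nil φ T' σ).le) T le_rfl σ

/-- Bad outputs carry an infinite penalty, so finiteness of the cost certifies every possible
output. -/
theorem of_halted_of_ert_ne_top {P : Cmd} {σ : Store} {Good : Store → Prop} [DecidablePred Good]
    (h : ert P (fun τ => if Good τ then 0 else ∞) σ ≠ ∞) {t : ℕ} {d : Config}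
    (hd : d ∈ (run t ([P], σ)).support) (hh : Halted d) : Good d.2 := by
  by_contra hg
  refine ne_top_of_mem_support (fun τ => if Good τ then 0 else ∞) t _ d (fun htop => h ?_) hd hh
    (by simp [hg])
  have := truncatedCost_le_ert (fun τ => if Good τ then 0 else ∞) P [] _ t
    (fun T' _ σ => (truncatedCost_nil _ T' σ).le) t le_rfl σ
  rw [htop] at this
  exact top_le_iff.1 this

/-! ### Averages -/

/-- The average over a finite type, in the extended nonnegative reals. -/
noncomputable def average {α : Type*} [Fintype α] (f : α → ℝ≥0∞) : ℝ≥0∞ :=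
  (∑ a, f a) / (Fintype.card α : ℝ≥0∞)

theorem average_tsum {α : Type*} [Fintype α] (f : α → ℕ → ℝ≥0∞) :
    average (fun a => ∑' τ, f a τ) = ∑' τ, average fun a => f a τ := by
  simp only [average, ENNReal.div_eq_inv_mul]
  rw [ENNReal.tsum_mul_left, Summable.tsum_finsetSum (fun _ _ => ENNReal.summable)]

theorem average_const_add {α : Type*} [Fintype α] [Nonempty α] (c : ℝ≥0∞) (B : α → ℝ≥0∞) :
    average (fun a => c + B a) = c + average B := by
  unfold average
  rw [Finset.sum_add_distrib, Finset.sum_const, Finset.card_univ, nsmul_eq_mul, ENNReal.add_div,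
    ENNReal.mul_div_right_comm, ENNReal.div_self (by simp) (by simp), one_mul]

theorem average_mul_left {α : Type*} [Fintype α] (c : ℝ≥0∞) (B : α → ℝ≥0∞) :
    average (fun a => c * B a) = c * average B := by
  unfold average
  rw [← Finset.mul_sum, mul_div_assoc]

/-! ### Specifications -/

/-- From `σ` the program `P` halts within `T` steps in a store satisfying `Q`. -/
def Ensures (P : Cmd) (σ : Store) (T : ℕ) (Q : Store → Prop) : Prop :=
  ∀ (f : Store → ℝ≥0∞) (B : ℝ≥0∞), (∀ τ, Q τ → f τ ≤ B) → ert P f σ ≤ T + B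

/-- From `σ` the program `P` halts after at most `T` expected steps in a store satisfying `Q a`,
where `a` is uniformly random. -/
def EnsuresUnif {α : Type*} [Fintype α] (P : Cmd) (σ : Store) (T : ℕ)
    (Q : α → Store → Prop) : Prop :=
  ∀ (f : Store → ℝ≥0∞) (B : α → ℝ≥0∞), (∀ a τ, Q a τ → f τ ≤ B a) →
    ert P f σ ≤ T + average B

namespace Ensures

variable {p q : Cmd} {σ : Store} {T T₁ T₂ : ℕ} {Q Q₁ : Store → Prop}

theorem mono (h : Ensures p σ T₁ Q₁) (hT : T₁ ≤ T) (hQ : ∀ τ, Q₁ τ → Q τ) : Ensures p σ T Q :=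
  fun f B hB => (h f B fun τ hτ => hB τ (hQ τ hτ)).trans (by gcongr)

theorem seq (hp : Ensures p σ T₁ Q₁) (hq : ∀ τ, Q₁ τ → Ensures q τ T₂ Q) :
    Ensures (Cmd.seq p q) σ (T₁ + T₂ + 1) Q := by
  intro f B hB
  simp only [ert]
  have := hp (ert q f) (T₂ + B) fun τ hτ => hq τ hτ f B hB
  calc 1 + ert p (ert q f) σ ≤ 1 + (T₁ + (T₂ + B)) := by gcongr
    _ = ((T₁ + T₂ + 1 : ℕ) : ℝ≥0∞) + B := by push_cast; ring

theorem seq' (hp : Ensures p σ T₁ Q₁) (hq : ∀ τ, Q₁ τ → Ensures q τ T₂ Q)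
    (hT : T₁ + T₂ + 1 ≤ T) : Ensures (Cmd.seq p q) σ T Q :=
  (hp.seq hq).mono hT fun _ h => h

theorem const {r k : ℕ} (h : Q (σ.setReg r k)) : Ensures (Cmd.const r k) σ (T + 1) Q := by
  intro f B hB
  simp only [ert]
  calc 1 + f _ ≤ 1 + B := by gcongr; exact hB _ h
    _ ≤ ((T + 1 : ℕ) : ℝ≥0∞) + B := by gcongr; simp

theorem add {r x y : ℕ} (h : Q (σ.setReg r (σ.reg x + σ.reg y))) :
    Ensures (Cmd.add r x y) σ (T + 1) Q := by
  intro f B hB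
  simp only [ert]
  calc 1 + f _ ≤ 1 + B := by gcongr; exact hB _ h
    _ ≤ ((T + 1 : ℕ) : ℝ≥0∞) + B := by gcongr; simp

theorem sub {r x y : ℕ} (h : Q (σ.setReg r (σ.reg x - σ.reg y))) :
    Ensures (Cmd.sub r x y) σ (T + 1) Q := by
  intro f B hB
  simp only [ert]
  calc 1 + f _ ≤ 1 + B := by gcongr; exact hB _ h
    _ ≤ ((T + 1 : ℕ) : ℝ≥0∞) + B := by gcongr; simp

theorem load {r x y : ℕ} (h : Q (σ.setReg r (σ.mem (σ.reg x) (σ.reg y)))) :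
    Ensures (Cmd.load r x y) σ (T + 1) Q := by
  intro f B hB
  simp only [ert]
  calc 1 + f _ ≤ 1 + B := by gcongr; exact hB _ h
    _ ≤ ((T + 1 : ℕ) : ℝ≥0∞) + B := by gcongr; simp

theorem store {r x y : ℕ} (h : Q (σ.setMem (σ.reg x) (σ.reg y) (σ.reg r))) :
    Ensures (Cmd.store x y r) σ (T + 1) Q := by
  intro f B hB
  simp only [ert]
  calc 1 + f _ ≤ 1 + B := by gcongr; exact hB _ h
    _ ≤ ((T + 1 : ℕ) : ℝ≥0∞) + B := by gcongr; simp

theorem cond {x y : ℕ} (hp : σ.reg x < σ.reg y → Ensures p σ T Q)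
    (hq : ¬ σ.reg x < σ.reg y → Ensures q σ T Q) : Ensures (Cmd.cond x y p q) σ (T + 1) Q := by
  intro f B hB
  simp only [ert]
  calc _ ≤ 1 + ((T : ℝ≥0∞) + B) := by
        gcongr
        split_ifs with h
        · exact hp h f B hB
        · exact hq h f B hB
    _ = ((T + 1 : ℕ) : ℝ≥0∞) + B := by push_cast; ring

theorem const_seq {r k : ℕ} (h : Ensures q (σ.setReg r k) T Q) :
    Ensures (Cmd.seq (Cmd.const r k) q) σ (T + 2) Q :=
  (const (T := 0) (Q := fun τ => τ = σ.setReg r k) rfl).seq'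
    (by rintro _ rfl; exact h) (by omega)

theorem add_seq {r x y : ℕ} (h : Ensures q (σ.setReg r (σ.reg x + σ.reg y)) T Q) :
    Ensures (Cmd.seq (Cmd.add r x y) q) σ (T + 2) Q :=
  (add (T := 0) (Q := fun τ => τ = σ.setReg r (σ.reg x + σ.reg y)) rfl).seq'
    (by rintro _ rfl; exact h) (by omega)

theorem sub_seq {r x y : ℕ} (h : Ensures q (σ.setReg r (σ.reg x - σ.reg y)) T Q) :
    Ensures (Cmd.seq (Cmd.sub r x y) q) σ (T + 2) Q :=
  (sub (T := 0) (Q := fun τ => τ = σ.setReg r (σ.reg x - σ.reg y)) rfl).seq'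
    (by rintro _ rfl; exact h) (by omega)

theorem load_seq {r x y : ℕ} (h : Ensures q (σ.setReg r (σ.mem (σ.reg x) (σ.reg y))) T Q) :
    Ensures (Cmd.seq (Cmd.load r x y) q) σ (T + 2) Q :=
  (load (T := 0) (Q := fun τ => τ = σ.setReg r (σ.mem (σ.reg x) (σ.reg y))) rfl).seq'
    (by rintro _ rfl; exact h) (by omega)

theorem store_seq {r x y : ℕ} (h : Ensures q (σ.setMem (σ.reg x) (σ.reg y) (σ.reg r)) T Q) :
    Ensures (Cmd.seq (Cmd.store x y r) q) σ (T + 2) Q :=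
  (store (T := 0) (Q := fun τ => τ = σ.setMem (σ.reg x) (σ.reg y) (σ.reg r)) rfl).seq'
    (by rintro _ rfl; exact h) (by omega)

/-- `I m` describes the store with `m` iterations to go. Each iteration pays for its test, and the
final `1` is the test that fails. -/
theorem loop_down {x y : ℕ} (I : ℕ → Store → Prop)
    (hstep : ∀ m τ, I (m + 1) τ → τ.reg x < τ.reg y ∧ Ensures p τ T (I m))
    (hend : ∀ τ, I 0 τ → ¬ τ.reg x < τ.reg y) (m : ℕ) (h : I m σ) :
    Ensures (Cmd.loop x y p) σ (m * (T + 1) + 1) (I 0) := by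
  induction m generalizing σ with
  | zero =>
    intro f B hB
    refine (ert_loop_le_unfold x y p f σ).trans ?_
    rw [if_neg (hend σ h)]
    simpa using add_le_add_right (hB σ h) 1
  | succ m ih =>
    intro f B hB
    refine (ert_loop_le_unfold x y p f σ).trans ?_
    obtain ⟨hg, hp⟩ := hstep m σ h
    rw [if_pos hg]
    have := hp (ert (Cmd.loop x y p) f) _ fun τ hτ => ih hτ f B hB
    calc _ ≤ 1 + ((T : ℝ≥0∞) + (((m * (T + 1) + 1 : ℕ) : ℝ≥0∞) + B)) := by gcongr
      _ = (((m + 1) * (T + 1) + 1 : ℕ) : ℝ≥0∞) + B := by push_cast; ring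

theorem loop_up {x y N : ℕ} (I : ℕ → Store → Prop)
    (hstep : ∀ m < N, ∀ τ, I m τ → τ.reg x < τ.reg y ∧ Ensures p τ T (I (m + 1)))
    (hend : ∀ τ, I N τ → ¬ τ.reg x < τ.reg y) (h : I 0 σ) :
    Ensures (Cmd.loop x y p) σ (N * (T + 1) + 1) (I N) := by
  have := loop_down (σ := σ) (p := p) (x := x) (y := y) (T := T)
    (fun m τ => m ≤ N ∧ I (N - m) τ) ?_ ?_ N ⟨le_rfl, by simpa using h⟩
  · exact this.mono le_rfl fun τ hτ => by simpa using hτ.2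
  · rintro m τ ⟨hm, hI⟩
    obtain ⟨h1, h2⟩ := hstep _ (by omega) τ hI
    refine ⟨h1, h2.mono le_rfl fun υ hυ => ⟨by omega, ?_⟩⟩
    rwa [show N - (m + 1) + 1 = N - m by omega] at hυ
  · rintro τ ⟨-, hI⟩
    exact hend τ (by simpa using hI)

theorem ert_seq_le {f : Store → ℝ≥0∞} {B : ℝ≥0∞} (hp : Ensures p σ T Q₁)
    (hq : ∀ τ, Q₁ τ → ert q f τ ≤ B) : ert (Cmd.seq p q) f σ ≤ (T + 1 : ℕ) + B := by
  simp only [ert]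
  calc _ ≤ 1 + ((T : ℝ≥0∞) + B) := by gcongr; exact hp _ B hq
    _ = _ := by push_cast; ring

end Ensures

@[simp] theorem Store.setReg_reg (σ : Store) (r k r' : ℕ) :
    (σ.setReg r k).reg r' = if r' = r then k else σ.reg r' := by
  simp [Store.setReg, Function.update_apply]

@[simp] theorem Store.setReg_mem (σ : Store) (r k : ℕ) : (σ.setReg r k).mem = σ.mem := rfl

@[simp] theorem Store.setMem_reg (σ : Store) (i j k : ℕ) : (σ.setMem i j k).reg = σ.reg := rfl

@[simp] theorem Store.setMem_mem (σ : Store) (i j k i' j' : ℕ) :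
    (σ.setMem i j k).mem i' j' = if i' = i ∧ j' = j then k else σ.mem i' j' := by
  simp only [Store.setMem, Function.update_apply]
  by_cases h1 : i' = i
  · subst h1
    simp [Function.update_apply]
  · simp [h1]

namespace EnsuresUnif

variable {α β : Type*} [Fintype α] [Fintype β] {p q : Cmd} {σ : Store} {T T₁ T₂ : ℕ}

theorem mono {Q Q₁ : α → Store → Prop} (h : EnsuresUnif p σ T₁ Q₁) (hT : T₁ ≤ T)
    (hQ : ∀ a τ, Q₁ a τ → Q a τ) : EnsuresUnif p σ T Q :=
  fun f B hB => (h f B fun a τ hτ => hB a τ (hQ a τ hτ)).trans (by gcongr)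

theorem ert_seq_le {Q : α → Store → Prop} {f : Store → ℝ≥0∞} {B : α → ℝ≥0∞}
    (hp : EnsuresUnif p σ T Q) (hq : ∀ a τ, Q a τ → ert q f τ ≤ B a) :
    ert (Cmd.seq p q) f σ ≤ (T + 1 : ℕ) + average B := by
  simp only [ert]
  calc _ ≤ 1 + ((T : ℝ≥0∞) + average B) := by
        gcongr; exact hp _ B hq
    _ = _ := by push_cast; ring

theorem rand_seq {m r x : ℕ} {Q : Fin m → Store → Prop} (hm : σ.reg x + 1 = m)
    (h : ∀ k : Fin m, Ensures q (σ.setReg r k) T (Q k)) :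
    EnsuresUnif (Cmd.seq (Cmd.rand r x) q) σ (T + 2) Q := by
  subst hm
  intro f B hB
  simp only [ert]
  have h1 : ∀ k : Fin (σ.reg x + 1), ert q f (σ.setReg r k) ≤ T + B k :=
    fun k => h k f (B k) (hB k)
  calc _ ≤ 1 + (1 + average fun k : Fin (σ.reg x + 1) => T + B k) := by
        unfold average
        rw [Fintype.card_fin]
        gcongr
        exact h1 _
    _ = _ := by rw [average_const_add]; push_cast; ring

theorem seq_ensures {Q : α → Store → Prop} {Q' : α → Store → Prop} [Nonempty α]
    (hp : EnsuresUnif p σ T₁ Q) (hq : ∀ a τ, Q a τ → Ensures q τ T₂ (Q' a)) :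
    EnsuresUnif (Cmd.seq p q) σ (T₁ + T₂ + 1) Q' := by
  intro f B hB
  refine (hp.ert_seq_le (B := fun a => T₂ + B a) fun a τ h => hq a τ h f (B a) (hB a)).trans ?_
  rw [average_const_add]
  apply le_of_eq
  push_cast
  ring

theorem after {Q : α → Store → Prop} {Q₁ : Store → Prop}
    (hp : Ensures p σ T₁ Q₁) (hq : ∀ τ, Q₁ τ → EnsuresUnif q τ T₂ Q) :
    EnsuresUnif (Cmd.seq p q) σ (T₁ + T₂ + 1) Q := by
  intro f B hB
  refine (hp.ert_seq_le (B := T₂ + average B) fun τ h => hq τ h f B hB).trans ?_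
  apply le_of_eq
  push_cast
  ring

/-- Overwrite the first `m` values of a sequence. -/
def overwrite (m : ℕ) (x : ℕ → α) (y : Fin m → α) (h : ℕ) : α :=
  if hh : h < m then y ⟨h, hh⟩ else x h

/-- One uniform draw per iteration amounts to a single uniform sequence. Positions are filled from
the top: the iteration with `m + 1` to go draws entry `m`, and `Fin.snoc` joins it to the entries
drawn later. -/
theorem loop_down {x y : ℕ} [Nonempty α] (I : ℕ → (ℕ → α) → Store → Prop)
    (hstep : ∀ m u τ, I (m + 1) u τ → τ.reg x < τ.reg y ∧
      EnsuresUnif p τ T fun a υ => I m (Function.update u m a) υ)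
    (hend : ∀ u τ, I 0 u τ → ¬ τ.reg x < τ.reg y) (m : ℕ) (u : ℕ → α) (h : I m u σ) :
    EnsuresUnif (α := Fin m → α) (Cmd.loop x y p) σ (m * (T + 1) + 1)
      (fun v τ => I 0 (overwrite m u v) τ) := by
  induction m generalizing σ u with
  | zero =>
    intro f B hB
    refine (ert_loop_le_unfold x y p f σ).trans ?_
    rw [if_neg (hend u σ h)]
    have h1 : f σ ≤ B default := hB default σ (by
      have : overwrite 0 u default = u := by ext k; simp [overwrite]
      simpa only [this] using h)
    simpa [average] using h1
  | succ m ih =>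
    intro f B hB
    refine (ert_loop_le_unfold x y p f σ).trans ?_
    obtain ⟨hg, hp⟩ := hstep m u σ h
    rw [if_pos hg]
    have h1 := hp (ert (Cmd.loop x y p) f)
      (fun a => ((m * (T + 1) + 1 : ℕ) : ℝ≥0∞) + average fun v : Fin m → α =>
        B (Fin.snoc (α := fun _ => α) v a)) fun a υ hυ => by
      refine ih _ hυ f _ fun v τ hτ => hB _ τ ?_
      have h0 : overwrite (m + 1) u (Fin.snoc (α := fun _ => α) v a) =
          overwrite m (Function.update u m a) v := ?_
      · simpa only [h0] using hτ
      ext k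
      simp only [overwrite, Fin.snoc, Function.update_apply]
      by_cases h1 : k < m
      · have : k < m + 1 := by omega
        simp [h1, this]
      · by_cases h2 : k = m
        · subst h2; simp
        · have : ¬ k < m + 1 := by omega
          simp [h1, h2, this]
    have h2 : average (fun a => average fun v : Fin m → α =>
        B (Fin.snoc (α := fun _ => α) v a)) = average B := by
      unfold average
      simp_rw [ENNReal.div_eq_inv_mul]
      rw [← Finset.mul_sum, ← mul_assoc,
        ← (Fin.snocEquiv fun _ : Fin (m + 1) => α).sum_comp, Fintype.sum_prod_type]
      congr 1
      rw [← ENNReal.mul_inv (by simp) (by simp)]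
      congr 1
      simp [pow_succ, mul_comm]
    rw [average_const_add, h2] at h1
    calc _ ≤ 1 + ((T : ℝ≥0∞) + (((m * (T + 1) + 1 : ℕ) : ℝ≥0∞) + average B)) := by gcongr
      _ = (((m + 1) * (T + 1) + 1 : ℕ) : ℝ≥0∞) + average B := by push_cast; ring

end EnsuresUnif

/-! ## Analysis of the partial resampling process -/

section Resampling

theorem sum_finset_prod_ite {ι R : Type*} [Fintype ι] [DecidableEq ι] [CommSemiring R] (f g : ι → R) :
    ∑ Y : Finset ι, ∏ h, (if h ∈ Y then f h else g h) = ∏ h, (f h + g h) := by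
  rw [Finset.prod_add, Finset.powerset_univ]
  refine Finset.sum_congr rfl fun Y _ => ?_
  rw [Finset.prod_ite, Finset.filter_mem_eq_inter, Finset.univ_inter]
  congr 2
  ext; simp

theorem expect_pi_prod {ι κ : Type*} [Fintype ι] [DecidableEq ι] [Fintype κ]
    (g : ι → κ → ℝ) : 𝔼 x : ι → κ, ∏ h, g h (x h) = ∏ h, 𝔼 c, g h c := by
  simp only [Fintype.expect_eq_sum_div_card, Finset.prod_div_distrib, Fintype.card_fun,
    Finset.prod_const, Finset.card_univ, Nat.cast_pow]
  rw [Finset.prod_univ_sum]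
  simp

/-- If `F` only depends on the coordinates in `Y`, then it is independent of the selection
obtained by resampling these coordinates. -/
theorem expect_expect_mul_piecewise {ι κ : Type*} [Fintype ι] [DecidableEq ι] [Fintype κ]
    (Y : Finset ι) (F V : (ι → κ) → ℝ)
    (hF : ∀ x x', (∀ h ∈ Y, x h = x' h) → F x = F x') :
    𝔼 x, 𝔼 S, F x * V (Y.piecewise S x) = (𝔼 x, F x) * 𝔼 x, V x := by
  -- Exchanging the `Y`-coordinates of `x` and `S` is an involution on pairs. It makes the resampled
  -- selection the first component, while `F` finds the values it reads in the second.
  have key : ∑ p : (ι → κ) × (ι → κ), F p.1 * V (Y.piecewise p.2 p.1) =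
      ∑ p : (ι → κ) × (ι → κ), F p.2 * V p.1 := by
    refine Finset.sum_nbij' (fun p => (Y.piecewise p.2 p.1, Y.piecewise p.1 p.2))
      (fun p => (Y.piecewise p.2 p.1, Y.piecewise p.1 p.2)) (by simp) (by simp) ?_ ?_ ?_
    · rintro ⟨x, S⟩ -
      ext h <;> by_cases hh : h ∈ Y <;> simp [hh]
    · rintro ⟨x, S⟩ -
      ext h <;> by_cases hh : h ∈ Y <;> simp [hh]
    · rintro ⟨x, S⟩ -
      simp only
      congr 1
      exact hF _ _ fun h hh => by simp [hh]
  simp only [Fintype.expect_eq_sum_div_card]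
  rw [Fintype.sum_prod_type, Fintype.sum_prod_type_right] at key
  simp_rw [← Finset.mul_sum, ← Finset.sum_div] at key ⊢
  simp_rw [mul_comm _ (∑ i, V i)] at key
  rw [← Finset.mul_sum] at key
  simp only [mul_comm] at key ⊢
  rw [key]
  ring

variable {W : Type*} {l b Q : ℕ} (G : SimpleGraph W) (ve : Fin l → Fin b → W)

/-- The vertices selected in the blocks `j` and `h` are adjacent. -/
def SelAdj (x : Fin l → Fin b) (j h : Fin l) : Prop := G.Adj (ve j (x j)) (ve h (x h))

open Classical in
/-- The number of selected neighbours of the vertex selected in block `j`. -/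
noncomputable def selDegree (x : Fin l → Fin b) (j : Fin l) : ℕ :=
  (Finset.univ.filter fun h => SelAdj G ve x j h).card

/-- The vertex selected in block `j` is the centre of a large star containing the vertex selected
in block `i`. -/
def IsBadCentre (t : ℕ) (x : Fin l → Fin b) (i j : Fin l) : Prop :=
  (j = i ∨ SelAdj G ve x j i) ∧ t ≤ selDegree G ve x j

open Classical in
/-- The first centre of a large star containing the vertex selected in block `i`. -/
noncomputable def badCentre (t : ℕ) (x : Fin l → Fin b) (i : Fin l) : Option (Fin l) :=
  if h : (Finset.univ.filter fun j => IsBadCentre G ve t x i j).Nonempty then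
    some (Finset.min' _ h) else none

theorem badCentre_eq_none {t : ℕ} {x : Fin l → Fin b} {i : Fin l}
    (h : ∀ j, ¬ IsBadCentre G ve t x i j) : badCentre G ve t x i = none := by
  unfold badCentre
  rw [dif_neg]
  simp [h]

theorem badCentre_eq_some {t : ℕ} {x : Fin l → Fin b} {i j : Fin l}
    (hj : IsBadCentre G ve t x i j) (hmin : ∀ j' < j, ¬ IsBadCentre G ve t x i j') :
    badCentre G ve t x i = some j := by
  classical
  unfold badCentre
  rw [dif_pos ⟨j, by simpa using hj⟩, Option.some_inj]
  refine (Finset.min'_eq_iff _ _ _).2 ⟨by simpa using hj, fun j' hj' => ?_⟩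
  by_contra! hlt
  exact hmin j' hlt (by simpa using hj')

theorem isBadCentre_of_badCentre {t : ℕ} {x : Fin l → Fin b} {i j : Fin l}
    (h : badCentre G ve t x i = some j) : IsBadCentre G ve t x i j := by
  classical
  unfold badCentre at h
  split_ifs at h with h1
  rw [Option.some_inj] at h
  have := Finset.min'_mem _ h1
  rw [h] at this
  simpa using this

theorem not_isBadCentre_of_badCentre {t : ℕ} {x : Fin l → Fin b} {i : Fin l}
    (h : badCentre G ve t x i = none) (j : Fin l) : ¬ IsBadCentre G ve t x i j := by
  classical
  intro hj
  unfold badCentre at h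
  rw [dif_pos ⟨j, by simpa using hj⟩] at h
  cases h

open Classical in
/-- The blocks resampled for the centre `j`: the blocks `i` and `j`, and those neighbours of the
centre whose coin is less than `num`. -/
noncomputable def marks (num : ℕ) (x : Fin l → Fin b) (i j : Fin l) (κ : Fin l → Fin Q) :
    Finset (Fin l) :=
  Finset.univ.filter fun h => (h = j ∨ h = i) ∨ (SelAdj G ve x j h ∧ (κ h : ℕ) < num)

open Classical in
/-- The list of blocks that have to be inspected, after the blocks of `Y` have been added. -/
noncomputable def pushBlocks (Y : Finset (Fin l)) (K : List (Fin l)) : List (Fin l) :=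
  (List.finRange l).filter (fun h => h ∈ Y) ++ K

theorem length_pushBlocks (Y : Finset (Fin l)) (K : List (Fin l)) :
    (pushBlocks Y K).length = Y.card + K.length := by
  classical
  unfold pushBlocks
  rw [List.length_append, ← List.toFinset_card_of_nodup ((List.nodup_finRange l).filter _)]
  congr 2
  ext; simp

/-- The probability that the process has not stopped after `τ` rounds. -/
noncomputable def survival (Q t num : ℕ) : ℕ → (Fin l → Fin b) → List (Fin l) → ℝ
  | 0, _, K => if K = [] then 0 else 1
  | _ + 1, _, [] => 0
  | τ + 1, x, i :: K =>
    match badCentre G ve t x i with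
    | none => survival Q t num τ x K
    | some j => 𝔼 S : Fin l → Fin b, 𝔼 κ : Fin l → Fin Q,
        survival Q t num τ ((marks G ve num x i j κ).piecewise S x)
          (pushBlocks (marks G ve num x i j κ) K)

variable {t num : ℕ}

theorem survival_nil (τ : ℕ) (x : Fin l → Fin b) : survival G ve Q t num τ x [] = 0 := by
  cases τ <;> simp [survival]

theorem survival_nonneg (τ : ℕ) : ∀ (x : Fin l → Fin b) (K : List (Fin l)),
    0 ≤ survival G ve Q t num τ x K := by
  induction τ with
  | zero => intro x K; simp only [survival]; split_ifs <;> norm_num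
  | succ τ ih =>
    intro x K
    cases K with
    | nil => simp [survival]
    | cons i K =>
      simp only [survival]
      split
      · exact ih _ _
      · exact Finset.expect_nonneg fun S _ => Finset.expect_nonneg fun κ _ => ih _ _

theorem expect_le_one {α : Type*} [Fintype α] {f : α → ℝ} (h : ∀ a, f a ≤ 1) :
    𝔼 a, f a ≤ 1 := by
  rcases isEmpty_or_nonempty α with hα | hα
  · simp
  · exact Finset.expect_le Finset.univ_nonempty fun a _ => h a

theorem survival_le_one (τ : ℕ) : ∀ (x : Fin l → Fin b) (K : List (Fin l)),
    survival G ve Q t num τ x K ≤ 1 := by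
  induction τ with
  | zero => intro x K; simp only [survival]; split_ifs <;> norm_num
  | succ τ ih =>
    intro x K
    cases K with
    | nil => simp [survival]
    | cons i K =>
      simp only [survival]
      split
      · exact ih _ _
      · exact expect_le_one fun S => expect_le_one fun κ => ih _ _

open Classical in
/-- A bound for the probability that the set of resampled blocks is `Y`, up to a factor that only
depends on `t`. It depends only on the selection in the blocks of `Y`. -/
noncomputable def markWeight (ρ : ℝ) (i j : Fin l) (Y : Finset (Fin l)) (x : Fin l → Fin b) : ℝ :=
  (if j = i ∨ SelAdj G ve x j i then 1 else 0) * ∏ h, if h ∈ Y then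
    (if h = j ∨ h = i then 1 else if SelAdj G ve x j h then ρ else 0) else
    (if h = j ∨ h = i then 0 else 1)

variable {G ve}

theorem markWeight_nonneg {ρ : ℝ} (hρ : 0 ≤ ρ) (i j : Fin l) (Y : Finset (Fin l))
    (x : Fin l → Fin b) : 0 ≤ markWeight G ve ρ i j Y x := by
  unfold markWeight
  refine mul_nonneg (by split_ifs <;> norm_num) (Finset.prod_nonneg fun h _ => ?_)
  split_ifs <;> first | exact hρ | norm_num

/-- Unless `i` and `j` both lie in `Y` the weight vanishes; if they do, it only tests adjacencies
between `j` and blocks of `Y`. This locality is why non-neighbours outside `Y` get the factor `1`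
just as neighbours do. -/
theorem markWeight_congr {ρ : ℝ} {i j : Fin l} {Y : Finset (Fin l)} {x x' : Fin l → Fin b}
    (h : ∀ k ∈ Y, x k = x' k) : markWeight G ve ρ i j Y x = markWeight G ve ρ i j Y x' := by
  classical
  unfold markWeight
  by_cases hj : j ∈ Y
  swap
  · rw [Finset.prod_eq_zero (Finset.mem_univ j), Finset.prod_eq_zero (Finset.mem_univ j)] <;>
      simp [hj]
  by_cases hi : i ∈ Y
  swap
  · rw [Finset.prod_eq_zero (Finset.mem_univ i), Finset.prod_eq_zero (Finset.mem_univ i)] <;>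
      simp [hi]
  simp only [SelAdj, h j hj, h i hi]
  congr 1
  refine Finset.prod_congr rfl fun k _ => ?_
  by_cases hk : k ∈ Y
  · simp only [h k hk]
    split_ifs <;> simp_all
  · simp only [hk, if_false]

theorem expect_coin (hn : num ≤ Q) :
    𝔼 c : Fin Q, (if (c : ℕ) < num then (1 : ℝ) else 0) = num / Q := by
  rw [Fintype.expect_eq_sum_div_card, Fintype.card_fin, Finset.sum_boole]
  congr 2
  have := Fin.card_filter_val_lt (n := Q) (m := num)
  rw [this]
  omega

/-- The coins are independent, so the probability is a product: a neighbour of the centre other than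
`i` contributes `q` if it lies in `Y` and `1 - q` if not. Taking `1 - q` out of all these factors
leaves `q / (1 - q)` for the marked ones. There are at least `t` such neighbours, or `t - 1` when `j
≠ i`, since `i` itself is marked without a coin. -/
theorem expect_marks_eq_le (hn : num < Q) {x : Fin l → Fin b} {i j : Fin l}
    (hbad : IsBadCentre G ve t x i j) (Y : Finset (Fin l)) :
    𝔼 κ : Fin l → Fin Q, (if marks G ve num x i j κ = Y then (1 : ℝ) else 0) ≤
      (1 - (num : ℝ) / Q) ^ (if j = i then t else t - 1) *
        markWeight G ve ((num / Q) / (1 - (num : ℝ) / Q)) i j Y x := by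
  classical
  set q : ℝ := (num : ℝ) / Q with hq
  have hQ : (0 : ℝ) < Q := by exact_mod_cast (by omega : 0 < Q)
  have hQne : Nonempty (Fin Q) := ⟨⟨0, by omega⟩⟩
  have hq0 : 0 ≤ q := by positivity
  have hq1 : q < 1 := by rw [hq, div_lt_one hQ]; exact_mod_cast hn
  have h1q : (1 - q) ≠ 0 := by linarith
  -- `U h c` is the indicator that block `h`, with coin `c`, is marked exactly as `Y` demands.
  obtain ⟨U, hU⟩ : ∃ U : Fin l → Fin Q → ℝ, ∀ h c, U h c = if h ∈ Y then
        (if h = j ∨ h = i then 1 else if SelAdj G ve x j h then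
          (if (c : ℕ) < num then (1 : ℝ) else 0) else 0) else
        (if h = j ∨ h = i then 0 else if SelAdj G ve x j h then
          1 - (if (c : ℕ) < num then (1 : ℝ) else 0) else 1) := ⟨_, fun _ _ => rfl⟩
  have hind : ∀ κ : Fin l → Fin Q, (if marks G ve num x i j κ = Y then (1 : ℝ) else 0) =
      ∏ h, U h (κ h) := by
    intro κ
    simp only [hU]
    split_ifs with hY
    · symm
      refine Finset.prod_eq_one fun h _ => ?_
      have : h ∈ Y ↔ (h = j ∨ h = i) ∨ (SelAdj G ve x j h ∧ (κ h : ℕ) < num) := by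
        rw [← hY]; simp [marks]
      by_cases h1 : h = j ∨ h = i <;> by_cases h2 : SelAdj G ve x j h <;>
        by_cases h3 : (κ h : ℕ) < num <;> simp [this, h1, h2, h3]
    · rw [eq_comm]
      have : ∃ h, ¬ (h ∈ Y ↔ (h = j ∨ h = i) ∨ (SelAdj G ve x j h ∧ (κ h : ℕ) < num)) := by
        by_contra! hall
        exact hY (by ext h; rw [hall h]; simp [marks])
      obtain ⟨h, hh⟩ := this
      refine Finset.prod_eq_zero (Finset.mem_univ h) ?_
      by_cases h0 : h ∈ Y <;> by_cases h1 : h = j ∨ h = i <;> by_cases h2 : SelAdj G ve x j h <;>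
        by_cases h3 : (κ h : ℕ) < num <;> simp_all
  simp_rw [hind]
  rw [expect_pi_prod]
  have hcoord : ∀ h : Fin l, 𝔼 c, U h c =
      (if SelAdj G ve x j h ∧ h ≠ i then (1 - q) else 1) * (if h ∈ Y then
        (if h = j ∨ h = i then 1 else if SelAdj G ve x j h then q / (1 - q) else 0) else
        (if h = j ∨ h = i then 0 else 1)) := by
    intro h
    simp only [hU]
    by_cases h1 : h = j ∨ h = i
    · have : ¬ (SelAdj G ve x j h ∧ h ≠ i) := by
        rintro ⟨ha, hb⟩
        rcases h1 with rfl | rfl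
        · exact G.loopless.irrefl _ ha
        · exact hb rfl
      by_cases h0 : h ∈ Y <;> simp [h1, this, h0]
    · have hi : h ≠ i := fun e => h1 (Or.inr e)
      have hj : h ≠ j := fun e => h1 (Or.inl e)
      by_cases h2 : SelAdj G ve x j h
      · by_cases h0 : h ∈ Y
        · simp only [h0, h2, hi, hj, or_self, if_true, if_false, expect_coin hn.le, ne_eq,
            not_false_eq_true, and_self, ← hq]
          field_simp
        · simp only [h0, h2, hi, hj, or_self, if_true, if_false, ne_eq, not_false_eq_true,
            and_self, Finset.expect_sub_distrib, expect_coin hn.le, ← hq]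
          simp
      · by_cases h0 : h ∈ Y <;> simp [h1, h2, h0]
  simp_rw [hcoord]
  rw [Finset.prod_mul_distrib]
  have hw : (∏ h, if h ∈ Y then
        (if h = j ∨ h = i then 1 else if SelAdj G ve x j h then q / (1 - q) else 0) else
        (if h = j ∨ h = i then (0 : ℝ) else 1)) = markWeight G ve (q / (1 - q)) i j Y x := by
    unfold markWeight
    rw [if_pos hbad.1, one_mul]
  rw [hw]
  refine mul_le_mul_of_nonneg_right ?_ (markWeight_nonneg (div_nonneg hq0 (by linarith)) _ _ _ _)
  rw [Finset.prod_ite, Finset.prod_const, Finset.prod_const_one, mul_one]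
  refine pow_le_pow_of_le_one (by linarith) (by linarith) ?_
  have hdeg := hbad.2
  unfold selDegree at hdeg
  split_ifs with hji
  · refine hdeg.trans (Finset.card_le_card fun h => ?_)
    simp only [Finset.mem_filter, Finset.mem_univ, true_and]
    intro ha
    refine ⟨ha, ?_⟩
    rintro rfl
    subst hji
    exact G.loopless.irrefl _ ha
  · have : (Finset.univ.filter fun h => SelAdj G ve x j h) ⊆
        insert i (Finset.univ.filter fun h => SelAdj G ve x j h ∧ h ≠ i) := by
      intro h
      simp only [Finset.mem_filter, Finset.mem_univ, true_and, Finset.mem_insert]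
      tauto
    have h2 := (Finset.card_le_card this).trans (Finset.card_insert_le _ _)
    omega

end Resampling

/-! ### Total weight of one round and the decay of the survival probability -/

section Resampling

variable {W : Type*} {l b Q t num : ℕ} {G : SimpleGraph W} {ve : Fin l → Fin b → W}

open Classical in
theorem sum_markWeight_mul_pow (ρ y : ℝ) (i j : Fin l) (x : Fin l → Fin b) :
    ∑ Y : Finset (Fin l), markWeight G ve ρ i j Y x * y ^ Y.card =
      (if j = i ∨ SelAdj G ve x j i then 1 else 0) *
        ∏ h, (if h = j ∨ h = i then y else 1 + if SelAdj G ve x j h then ρ * y else 0) := by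
  unfold markWeight
  simp_rw [mul_assoc]
  rw [← Finset.mul_sum]
  congr 1
  have h1 : ∀ Y : Finset (Fin l), y ^ Y.card = ∏ h, (if h ∈ Y then y else 1) := by
    intro Y
    rw [Finset.prod_ite_mem, Finset.univ_inter, Finset.prod_const]
  simp_rw [h1, ← Finset.prod_mul_distrib]
  have h2 : ∀ (Y : Finset (Fin l)) (h : Fin l), ((if h ∈ Y then
      (if h = j ∨ h = i then 1 else if SelAdj G ve x j h then ρ else 0) else
      (if h = j ∨ h = i then 0 else 1)) * (if h ∈ Y then y else 1)) = (if h ∈ Y then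
      (if h = j ∨ h = i then y else if SelAdj G ve x j h then ρ * y else 0) else
      (if h = j ∨ h = i then 0 else 1)) := by
    intro Y h
    split_ifs <;> simp
  simp_rw [h2]
  rw [sum_finset_prod_ite]
  refine Finset.prod_congr rfl fun h _ => ?_
  split_ifs <;> ring

open Classical in
-- The sum over `Y` is a product over blocks, which factorises in expectation once the vertex of
-- block `j` is fixed. Optional blocks contribute factors `1 + u ≤ exp u`, and their exponents add
-- up to at most `ρ * y * (Δ / b)` by the degree bound. The forced blocks give `y` if `j = i`;
-- otherwise they give `y ^ 2` times the probability that the vertices of `j` and `i` are adjacent.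
theorem expect_sum_markWeight_le {Δ : ℕ} {ρ y c₀ c₁ : ℝ} (hb : 0 < b) (hρ : 0 ≤ ρ) (hy : 0 ≤ y)
    (hc₀ : 0 ≤ c₀) (hc₁ : 0 ≤ c₁)
    (hdeg : ∀ j a, ∑ h, (Finset.univ.filter fun c => G.Adj (ve j a) (ve h c)).card ≤ Δ)
    (i : Fin l) :
    ∑ j, (if j = i then c₀ else c₁) *
      ∑ Y : Finset (Fin l), (𝔼 x, markWeight G ve ρ i j Y x) * y ^ Y.card ≤
      (c₀ * y + c₁ * y ^ 2 * (Δ / b)) * Real.exp (ρ * y * (Δ / b)) := by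
  have hb' : (0 : ℝ) < b := by exact_mod_cast hb
  have hbne : Nonempty (Fin b) := ⟨⟨0, hb⟩⟩
  set d : Fin l → Fin b → Fin l → ℝ := fun j a h =>
    ((Finset.univ.filter fun c => G.Adj (ve j a) (ve h c)).card : ℝ) with hd
  set E := Real.exp (ρ * y * (Δ / b)) with hE
  have hdegR : ∀ j a, ∑ h, d j a h ≤ Δ := by
    intro j a
    simp only [hd]
    exact_mod_cast hdeg j a
  have hd0 : ∀ j a h, 0 ≤ d j a h := fun j a h => by simp [hd]
  have havg : ∀ j a h, 𝔼 c, (if G.Adj (ve j a) (ve h c) then (1 : ℝ) else 0) = d j a h / b := by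
    intro j a h
    rw [Fintype.expect_eq_sum_div_card, Fintype.card_fin, Finset.sum_boole]
  have hone : ∀ j, ∑ Y : Finset (Fin l), (𝔼 x, markWeight G ve ρ i j Y x) * y ^ Y.card ≤
      ∑ a, (y / b) * (if j = i then 1 else y * d j a i / b) * E := by
    intro j
    -- The factor of block `h` when it selects `c`, on the event that block `j` selects `a`.
    obtain ⟨U, hU⟩ : ∃ U : Fin b → Fin l → Fin b → ℝ, ∀ a h c, U a h c =
        (if h = j then (if c = a then 1 else 0) else 1) *
        (if h = i then (if j = i ∨ G.Adj (ve j a) (ve i c) then 1 else 0) else 1) *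
        (if h = j ∨ h = i then y else 1 + if G.Adj (ve j a) (ve h c) then ρ * y else 0) :=
      ⟨_, fun _ _ _ => rfl⟩
    have h1 : ∀ x : Fin l → Fin b,
        ∑ Y : Finset (Fin l), markWeight G ve ρ i j Y x * y ^ Y.card =
          ∑ a, ∏ h, U a h (x h) := by
      intro x
      rw [sum_markWeight_mul_pow]
      simp_rw [hU, Finset.prod_mul_distrib, Finset.prod_ite_eq', Finset.mem_univ, if_true,
        mul_assoc, ite_mul, one_mul, zero_mul, Finset.sum_ite_eq, Finset.mem_univ, if_true]
      rfl
    have h2 : ∑ Y : Finset (Fin l), (𝔼 x, markWeight G ve ρ i j Y x) * y ^ Y.card =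
        ∑ a, ∏ h, 𝔼 c, U a h c := by
      simp_rw [Finset.expect_mul]
      rw [← Finset.expect_sum_comm]
      simp_rw [h1]
      rw [Finset.expect_sum_comm]
      simp_rw [expect_pi_prod]
    rw [h2]
    refine Finset.sum_le_sum fun a _ => ?_
    have hUnn : ∀ h c, 0 ≤ U a h c := by
      intro h c
      rw [hU]
      have : 0 ≤ ρ * y := by positivity
      refine mul_nonneg (mul_nonneg ?_ ?_) ?_ <;> split_ifs <;> positivity
    have h3 : ∀ h, 𝔼 c, U a h c ≤ ((if h = j then y / b else 1) *
        (if h = i then (if j = i then 1 else y * d j a i / b) else 1)) *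
          Real.exp (ρ * y * d j a h / b) := by
      intro h
      have hexp : 1 ≤ Real.exp (ρ * y * d j a h / b) := by
        refine Real.one_le_exp (by have := hd0 j a h; positivity)
      simp only [hU]
      by_cases hj : h = j
      · subst hj
        have h5 : 𝔼 c : Fin b, (if c = a then y else 0) = y / b := by
          rw [Fintype.expect_eq_sum_div_card]; simp
        have h4 : 𝔼 c, ((if h = h then (if c = a then (1 : ℝ) else 0) else 1) *
            (if h = i then (if h = i ∨ G.Adj (ve h a) (ve i c) then 1 else 0) else 1) *
            (if h = h ∨ h = i then y else 1 + if G.Adj (ve h a) (ve h c) then ρ * y else 0))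
            = y / b := by
          rw [← h5]
          refine Finset.expect_congr rfl fun c _ => ?_
          by_cases hi : h = i <;> simp [hi]
        rw [h4]
        have h6 : ((if h = h then y / b else 1) *
            (if h = i then (if h = i then 1 else y * d h a i / b) else 1)) = y / b := by
          by_cases hi : h = i <;> simp [hi]
        rw [h6]
        exact le_mul_of_one_le_right (by positivity) hexp
      · by_cases hi : h = i
        · subst hi
          have hj' : ¬ j = h := fun e => hj e.symm
          simp only [hj, hj', or_true, false_or, if_true, if_false, one_mul]
          rw [← Finset.expect_mul, havg]
          have : 0 ≤ y * d j a h / b := by have := hd0 j a h; positivity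
          calc d j a h / b * y = y * d j a h / b := by ring
            _ ≤ _ := le_mul_of_one_le_right this hexp
        · simp only [hj, hi, or_self, if_false, one_mul]
          have h7 : ∀ c, (1 + if G.Adj (ve j a) (ve h c) then ρ * y else (0 : ℝ)) =
              1 + (if G.Adj (ve j a) (ve h c) then 1 else 0) * (ρ * y) := by
            intro c; split_ifs <;> ring
          simp_rw [h7, Finset.expect_add_distrib]
          rw [← Finset.expect_mul, havg, Finset.expect_const Finset.univ_nonempty]
          have := Real.add_one_le_exp (ρ * y * d j a h / b)
          calc _ = ρ * y * d j a h / b + 1 := by ring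
            _ ≤ _ := this
    calc ∏ h, 𝔼 c, U a h c ≤ ∏ h, (((if h = j then y / b else 1) *
        (if h = i then (if j = i then 1 else y * d j a i / b) else 1)) *
          Real.exp (ρ * y * d j a h / b)) :=
          Finset.prod_le_prod (fun h _ => Finset.expect_nonneg fun c _ => hUnn h c)
            fun h _ => h3 h
      _ = (y / b) * (if j = i then 1 else y * d j a i / b) *
          Real.exp (∑ h, ρ * y * d j a h / b) := by
          rw [Finset.prod_mul_distrib, Finset.prod_mul_distrib, Finset.prod_ite_eq',
            Finset.prod_ite_eq', if_pos (Finset.mem_univ _), if_pos (Finset.mem_univ _),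
            Real.exp_sum]
      _ ≤ _ := by
          have := hd0 j a i
          refine mul_le_mul_of_nonneg_left ?_ (by split_ifs <;> positivity)
          refine Real.exp_le_exp.2 ?_
          rw [← Finset.sum_div, ← Finset.mul_sum, ← mul_div_assoc]
          have := hdegR j a
          gcongr
  have hEpos : 0 ≤ E := (Real.exp_pos _).le
  -- Double counting: this is the number of edges, seen from the other side, that leave the `b`
  -- vertices of block `i`.
  have htwo : ∑ j, ∑ a, d j a i ≤ b * Δ := by
    have : ∑ j, ∑ a, d j a i = ∑ c, ∑ j, d i c j := by
      have h1 : ∀ j a h, d j a h = ∑ c, if G.Adj (ve j a) (ve h c) then (1 : ℝ) else 0 :=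
        fun j a h => (Finset.sum_boole _ _).symm
      simp_rw [h1]
      calc _ = ∑ j, ∑ c, ∑ a, (if G.Adj (ve j a) (ve i c) then (1 : ℝ) else 0) :=
            Finset.sum_congr rfl fun j _ => Finset.sum_comm
        _ = ∑ c, ∑ j, ∑ a, (if G.Adj (ve j a) (ve i c) then (1 : ℝ) else 0) := Finset.sum_comm
        _ = _ := by simp_rw [G.adj_comm]
    rw [this]
    calc _ ≤ ∑ c : Fin b, (Δ : ℝ) := Finset.sum_le_sum fun c _ => hdegR i c
      _ = _ := by simp
  clear_value d E
  calc ∑ j, (if j = i then c₀ else c₁) *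
      ∑ Y : Finset (Fin l), (𝔼 x, markWeight G ve ρ i j Y x) * y ^ Y.card
      ≤ ∑ j, (if j = i then c₀ else c₁) *
        ∑ a, (y / b) * (if j = i then 1 else y * d j a i / b) * E := by
        refine Finset.sum_le_sum fun j _ => mul_le_mul_of_nonneg_left (hone j) ?_
        split_ifs <;> assumption
    _ ≤ ∑ j, ((if j = i then c₀ * y * E else 0) +
        c₁ * y ^ 2 * E / b ^ 2 * ∑ a, d j a i) := by
        refine Finset.sum_le_sum fun j _ => ?_
        have hnn : 0 ≤ ∑ a, d j a i := Finset.sum_nonneg fun a _ => hd0 j a i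
        split_ifs with hji
        · simp only [Finset.sum_const, Finset.card_univ, Fintype.card_fin, nsmul_eq_mul]
          have : c₀ * (b * (y / b * 1 * E)) = c₀ * y * E := by field_simp
          rw [this]
          have : 0 ≤ c₁ * y ^ 2 * E / b ^ 2 * ∑ a, d j a i := by positivity
          linarith
        · rw [zero_add, Finset.mul_sum, Finset.mul_sum]
          refine (Finset.sum_congr rfl fun a _ => ?_).le
          ring
    _ = c₀ * y * E + c₁ * y ^ 2 * E / b ^ 2 * ∑ j, ∑ a, d j a i := by
        rw [Finset.sum_add_distrib, Finset.sum_ite_eq', if_pos (Finset.mem_univ _),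
          Finset.mul_sum]
    _ ≤ c₀ * y * E + c₁ * y ^ 2 * E / b ^ 2 * (b * Δ) := by gcongr
    _ = _ := by field_simp

/-- The condition under which the process stops quickly. -/
def ProcessCondition (t num Q : ℕ) (μ y z : ℝ) : Prop :=
  1 + ((1 - (num : ℝ) / Q) ^ t * y + (1 - (num : ℝ) / Q) ^ (t - 1) * y ^ 2 * μ) *
    Real.exp ((num / Q) / (1 - (num : ℝ) / Q) * y * μ) ≤ y / z

open Classical in
-- Induction on `τ` for all stacks at once, always averaging over a uniform selection. Each
-- resampled block costs a factor `y` through the longer stack, and each round gains a factor `1 /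
-- z`.
theorem expect_survival_le {Δ : ℕ} {y z : ℝ} (hb : 0 < b) (hn : num < Q)
    (hdeg : ∀ j a, ∑ h, (Finset.univ.filter fun c => G.Adj (ve j a) (ve h c)).card ≤ Δ)
    (hy : 1 ≤ y) (hz : 0 < z) (hcond : ProcessCondition t num Q (Δ / b) y z) (τ : ℕ) :
    ∀ K : List (Fin l), 𝔼 x, survival G ve Q t num τ x K ≤ y ^ K.length / z ^ τ := by
  have hbne : Nonempty (Fin b) := ⟨⟨0, hb⟩⟩
  have hQne : Nonempty (Fin Q) := ⟨⟨0, by omega⟩⟩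
  have hQ : (0 : ℝ) < Q := by exact_mod_cast (by omega : 0 < Q)
  have hy0 : 0 ≤ y := by linarith
  set q : ℝ := (num : ℝ) / Q with hq
  have hq0 : 0 ≤ q := by positivity
  have hq1 : q < 1 := by rw [hq, div_lt_one hQ]; exact_mod_cast hn
  set ρ : ℝ := q / (1 - q) with hρ
  have hρ0 : 0 ≤ ρ := div_nonneg hq0 (by linarith)
  induction τ with
  | zero =>
    intro K
    rw [pow_zero, div_one]
    exact (expect_le_one fun x => survival_le_one G ve 0 x K).trans (one_le_pow₀ hy)
  | succ τ ih =>
    intro K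
    cases K with
    | nil =>
      simp only [survival_nil, Finset.expect_const_zero]
      positivity
    | cons i K =>
      -- Whether `j` is the first bad centre depends on the whole selection. This information is
      -- thrown away by adding up both branches and all `j` and `Y`; what is left are weights that
      -- read only the selection on `Y`.
      have hpt : ∀ x, survival G ve Q t num (τ + 1) x (i :: K) ≤ survival G ve Q t num τ x K +
          ∑ j, ∑ Y : Finset (Fin l), 𝔼 S : Fin l → Fin b,
            ((if j = i then (1 - q) ^ t else (1 - q) ^ (t - 1)) * markWeight G ve ρ i j Y x) *
              survival G ve Q t num τ (Y.piecewise S x) (pushBlocks Y K) := by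
        intro x
        have hnn : ∀ j, ∀ Y : Finset (Fin l), 0 ≤ 𝔼 S : Fin l → Fin b,
            ((if j = i then (1 - q) ^ t else (1 - q) ^ (t - 1)) * markWeight G ve ρ i j Y x) *
              survival G ve Q t num τ (Y.piecewise S x) (pushBlocks Y K) := by
          intro j Y
          refine Finset.expect_nonneg fun S _ => mul_nonneg (mul_nonneg ?_
            (markWeight_nonneg hρ0 _ _ _ _)) (survival_nonneg _ _ _ _ _)
          have : 0 ≤ 1 - q := by linarith
          split_ifs <;> positivity
        simp only [survival]
        split
        · exact le_add_of_nonneg_right (Finset.sum_nonneg fun j _ =>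
            Finset.sum_nonneg fun Y _ => hnn j Y)
        · rename_i j hj
          have hbad := isBadCentre_of_badCentre G ve hj
          refine le_trans ?_ (le_add_of_nonneg_left (survival_nonneg _ _ _ _ _))
          refine le_trans ?_ (Finset.single_le_sum
            (fun j _ => Finset.sum_nonneg fun Y _ => hnn j Y) (Finset.mem_univ j))
          rw [← Finset.expect_sum_comm]
          refine Finset.expect_le_expect fun S _ => ?_
          have h1 : ∀ κ : Fin l → Fin Q, survival G ve Q t num τ
              ((marks G ve num x i j κ).piecewise S x) (pushBlocks (marks G ve num x i j κ) K) =
              ∑ Y : Finset (Fin l), (if marks G ve num x i j κ = Y then (1 : ℝ) else 0) *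
                survival G ve Q t num τ (Y.piecewise S x) (pushBlocks Y K) := by
            intro κ
            simp
          simp_rw [h1]
          rw [Finset.expect_sum_comm]
          refine Finset.sum_le_sum fun Y _ => ?_
          rw [← Finset.expect_mul]
          refine mul_le_mul_of_nonneg_right ?_ (survival_nonneg _ _ _ _ _)
          have := expect_marks_eq_le hn hbad Y
          rw [← hq, ← hρ] at this
          refine this.trans_eq ?_
          congr 1
          split_ifs <;> rfl
      calc 𝔼 x, survival G ve Q t num (τ + 1) x (i :: K)
          ≤ 𝔼 x, (survival G ve Q t num τ x K +
          ∑ j, ∑ Y : Finset (Fin l), 𝔼 S : Fin l → Fin b,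
            ((if j = i then (1 - q) ^ t else (1 - q) ^ (t - 1)) * markWeight G ve ρ i j Y x) *
              survival G ve Q t num τ (Y.piecewise S x) (pushBlocks Y K)) :=
            Finset.expect_le_expect fun x _ => hpt x
        _ = 𝔼 x, survival G ve Q t num τ x K + ∑ j,
            (if j = i then (1 - q) ^ t else (1 - q) ^ (t - 1)) *
            ∑ Y : Finset (Fin l), (𝔼 x, markWeight G ve ρ i j Y x) *
              𝔼 x, survival G ve Q t num τ x (pushBlocks Y K) := by
            rw [Finset.expect_add_distrib, Finset.expect_sum_comm]
            congr 1
            refine Finset.sum_congr rfl fun j _ => ?_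
            rw [Finset.expect_sum_comm, Finset.mul_sum]
            refine Finset.sum_congr rfl fun Y _ => ?_
            rw [← expect_expect_mul_piecewise Y (markWeight G ve ρ i j Y)
              (fun x => survival G ve Q t num τ x (pushBlocks Y K))
              fun x x' h => markWeight_congr h, Finset.mul_expect]
            refine Finset.expect_congr rfl fun x _ => ?_
            rw [Finset.mul_expect]
            refine Finset.expect_congr rfl fun S _ => ?_
            rw [mul_assoc]
        _ ≤ y ^ K.length / z ^ τ + ∑ j,
            (if j = i then (1 - q) ^ t else (1 - q) ^ (t - 1)) *
            ∑ Y : Finset (Fin l), (𝔼 x, markWeight G ve ρ i j Y x) *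
              (y ^ Y.card * (y ^ K.length / z ^ τ)) := by
            have : 0 ≤ 1 - q := by linarith
            refine add_le_add (ih K) (Finset.sum_le_sum fun j _ =>
              mul_le_mul_of_nonneg_left (Finset.sum_le_sum fun Y _ =>
                mul_le_mul_of_nonneg_left ?_ (Finset.expect_nonneg fun x _ =>
                  markWeight_nonneg hρ0 _ _ _ _)) (by split_ifs <;> positivity))
            refine (ih _).trans (le_of_eq ?_)
            rw [length_pushBlocks, pow_add, mul_div_assoc]
        _ = (1 + ∑ j, (if j = i then (1 - q) ^ t else (1 - q) ^ (t - 1)) *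
            ∑ Y : Finset (Fin l), (𝔼 x, markWeight G ve ρ i j Y x) * y ^ Y.card) *
              (y ^ K.length / z ^ τ) := by
            rw [add_mul, one_mul, Finset.sum_mul]
            congr 1
            refine Finset.sum_congr rfl fun j _ => ?_
            rw [mul_assoc, Finset.sum_mul]
            congr 1
            refine Finset.sum_congr rfl fun Y _ => ?_
            ring
        _ ≤ (y / z) * (y ^ K.length / z ^ τ) := by
            refine mul_le_mul_of_nonneg_right ?_ (by positivity)
            refine le_trans ?_ hcond
            have : 0 ≤ 1 - q := by linarith
            gcongr
            exact expect_sum_markWeight_le hb hρ0 hy0 (by positivity) (by positivity) hdeg i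
        _ = y ^ (i :: K).length / z ^ (τ + 1) := by
            rw [List.length_cons, pow_succ, pow_succ]
            field_simp

end Resampling

/-! ### Expected number of rounds -/

section Resampling

variable {W : Type*} {l b Q t num : ℕ} {G : SimpleGraph W} {ve : Fin l → Fin b → W}

theorem ofReal_expect {α : Type*} [Fintype α] [Nonempty α] {f : α → ℝ} (hf : ∀ a, 0 ≤ f a) :
    ENNReal.ofReal (𝔼 a, f a) = average fun a => ENNReal.ofReal (f a) := by
  rw [Fintype.expect_eq_sum_div_card, average,
    ENNReal.ofReal_div_of_pos (by exact_mod_cast Fintype.card_pos),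
    ENNReal.ofReal_sum_of_nonneg fun a _ => hf a, ENNReal.ofReal_natCast]

variable (G ve Q t num) in
/-- The expected number of rounds of the process. -/
noncomputable def expectedRounds (x : Fin l → Fin b) (K : List (Fin l)) : ℝ≥0∞ :=
  ∑' τ, ENNReal.ofReal (survival G ve Q t num τ x K)

theorem expectedRounds_nil (x : Fin l → Fin b) : expectedRounds Q t num G ve x [] = 0 := by
  simp [expectedRounds, survival_nil]

theorem expectedRounds_cons_of_none {x : Fin l → Fin b} {i : Fin l} {K : List (Fin l)}
    (h : badCentre G ve t x i = none) :
    expectedRounds Q t num G ve x (i :: K) = 1 + expectedRounds Q t num G ve x K := by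
  unfold expectedRounds
  rw [tsum_eq_zero_add' ENNReal.summable]
  simp [survival, h]

open Classical in
theorem expectedRounds_cons_of_some [Nonempty (Fin b)] [Nonempty (Fin Q)] {x : Fin l → Fin b}
    {i j : Fin l} {K : List (Fin l)} (h : badCentre G ve t x i = some j) :
    expectedRounds Q t num G ve x (i :: K) = 1 + average fun S : Fin l → Fin b =>
      average fun κ : Fin l → Fin Q =>
        expectedRounds Q t num G ve ((marks G ve num x i j κ).piecewise S x)
          (pushBlocks (marks G ve num x i j κ) K) := by
  unfold expectedRounds
  rw [tsum_eq_zero_add' ENNReal.summable]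
  congr 1
  · simp [survival]
  · simp_rw [average_tsum]
    refine tsum_congr fun τ => ?_
    simp only [survival, h]
    rw [ofReal_expect fun S => Finset.expect_nonneg fun κ _ => survival_nonneg _ _ _ _ _]
    congr 1
    ext S
    rw [ofReal_expect fun κ => survival_nonneg _ _ _ _ _]

open Classical in
-- The first `4 * K.length` rounds are bounded by one each. As `y ≤ z ^ 4`, they absorb the factor
-- `y ^ K.length`, and the rest is a geometric series of ratio `1 / z` with sum `m + 1`.
theorem average_expectedRounds_le {Δ m : ℕ} {y z : ℝ} (hb : 0 < b) (hn : num < Q)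
    (hdeg : ∀ j a, ∑ h, (Finset.univ.filter fun c => G.Adj (ve j a) (ve h c)).card ≤ Δ)
    (hy : 1 ≤ y) (hm : 0 < m) (hz : z = 1 + 1 / m) (hyz : y ≤ z ^ 4)
    (hcond : ProcessCondition t num Q (Δ / b) y z) (K : List (Fin l)) :
    average (fun x => expectedRounds Q t num G ve x K) ≤ (4 * K.length + m + 1 : ℕ) := by
  have hbne : Nonempty (Fin b) := ⟨⟨0, hb⟩⟩
  have hm' : (0 : ℝ) < m := by exact_mod_cast hm
  have hz1 : 1 < z := by rw [hz]; simp [hm]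
  have hz0 : 0 < z := by linarith
  unfold expectedRounds
  rw [average_tsum]
  set k := 4 * K.length with hk
  rw [← ENNReal.summable.sum_add_tsum_nat_add' (k := k)]
  have h1 : ∑ τ ∈ Finset.range k, average (fun x : Fin l → Fin b =>
      ENNReal.ofReal (survival G ve Q t num τ x K)) ≤ (k : ℝ≥0∞) := by
    calc _ ≤ ∑ τ ∈ Finset.range k, (1 : ℝ≥0∞) := by
          refine Finset.sum_le_sum fun τ _ => ?_
          rw [← ofReal_expect fun x => survival_nonneg _ _ _ _ _]
          exact ENNReal.ofReal_le_one.2 (expect_le_one fun x => survival_le_one _ _ _ _ _)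
      _ = _ := by simp
  have h2 : ∀ τ, average (fun x : Fin l → Fin b =>
      ENNReal.ofReal (survival G ve Q t num (τ + k) x K)) ≤ ENNReal.ofReal ((1 / z) ^ τ) := by
    intro τ
    rw [← ofReal_expect fun x => survival_nonneg _ _ _ _ _]
    refine ENNReal.ofReal_le_ofReal
      ((expect_survival_le hb hn hdeg hy hz0 hcond (τ + k) K).trans ?_)
    rw [pow_add, one_div_pow, div_le_div_iff₀ (by positivity) (by positivity), one_mul, mul_comm]
    have : y ^ K.length ≤ z ^ k := by
      rw [hk, pow_mul]
      gcongr
    gcongr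
  have hr0 : 0 ≤ 1 / z := by positivity
  have hr1 : 1 / z < 1 := by rw [div_lt_one hz0]; exact hz1
  have h3 : ∑' τ : ℕ, ENNReal.ofReal ((1 / z) ^ τ) = ((m + 1 : ℕ) : ℝ≥0∞) := by
    rw [← ENNReal.ofReal_tsum_of_nonneg (fun τ => by positivity)
      (summable_geometric_of_lt_one hr0 hr1), tsum_geometric_of_lt_one hr0 hr1,
      ← ENNReal.ofReal_natCast]
    congr 1
    rw [hz]
    push_cast
    field_simp
    ring
  calc _ ≤ (k : ℝ≥0∞) + ∑' τ : ℕ, ENNReal.ofReal ((1 / z) ^ τ) :=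
        add_le_add h1 (ENNReal.tsum_le_tsum h2)
    _ = _ := by rw [h3]; push_cast; ring

end Resampling

/-! ## The program

Registers below `12` are set once: `0 ↦ n`, `1 ↦ l`, `2 ↦ s`, `3 ↦ 0`, `4 ↦ 1`, `5 ↦ n + 2` (row of
the stack), `6 ↦ n + 3` (row of fresh selections), `7 ↦ n + 4` (row of coins), `8 ↦ b - 1`,
`9 ↦ s - 1`, and `10`, `11` hold the success probability of a coin. The main loop uses the registers
from `12`, its parts use registers from `20`, and their parts use registers from `30`. -/

namespace Cmd

/-- Do nothing. -/
def skip : Cmd := const 39 0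

/-- If `R_a = R_b` then `p`. -/
def ifEq (a b : ℕ) (p : Cmd) : Cmd := cond a b skip (cond b a skip p)

/-- `R_34 :=` a random vertex of the block `R_20`. -/
def drawVertex : Cmd :=
  seq (rand 30 8) <| seq (const 31 0) <| seq (const 32 0) <|
    loop 31 0 <| seq (load 33 3 31) <|
      seq (ifEq 33 20 (seq (ifEq 32 30 (add 34 31 3)) (add 32 32 4))) (add 31 31 4)

/-- Fill the row given by the register `row` with a random vertex of every block. -/
def fillVertices (row : ℕ) : Cmd :=
  seq (add 20 1 3) <| loop 3 20 <| seq (sub 20 20 4) <| seq drawVertex (store row 20 34)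

/-- Fill the row of coins. -/
def fillCoins : Cmd :=
  seq (add 20 1 3) <| loop 3 20 <| seq (sub 20 20 4) <| seq (rand 30 11) (store 7 20 30)

/-- `R_33 :=` the number of selected neighbours of the vertex with row `R_22`. -/
def countNeighbours : Cmd :=
  seq (const 33 0) <| seq (add 30 1 3) <| loop 3 30 <|
    seq (sub 30 30 4) <| seq (load 31 4 30) <| seq (load 32 22 31) (add 33 33 32)

/-- Report the vertex in `R_21` as a bad centre. -/
def report : Cmd := seq (const 15 1) (add 16 21 3)

/-- Look for a bad centre for the vertex in `R_14`. -/
def findCentre : Cmd :=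
  seq (const 15 0) <| seq (add 20 1 3) <| loop 3 20 <|
    seq (sub 20 20 4) <| seq (load 21 4 20) <| seq (add 22 21 4) <| seq (add 22 22 4) <|
    seq countNeighbours <| cond 33 9 skip <|
      seq (ifEq 21 14 report) <| seq (load 23 22 14) <| cond 3 23 report skip

/-- Resample the marked blocks and push them. -/
def updateBlocks : Cmd :=
  seq (add 22 16 4) <| seq (add 22 22 4) <| seq (add 20 1 3) <| loop 3 20 <|
    seq (sub 20 20 4) <| seq (load 21 4 20) <| seq (const 23 0) <| seq (load 24 7 20) <|
    seq (cond 24 10 (load 23 22 21) skip) <|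
    seq (ifEq 21 14 (const 23 1)) <| seq (ifEq 21 16 (const 23 1)) <|
    cond 3 23 (seq (load 21 6 20) <| seq (store 4 20 21) <| seq (store 5 12 20) (add 12 12 4)) skip

/-- Process the stack until it is empty. -/
def mainLoop : Cmd :=
  loop 3 12 <| seq (sub 12 12 4) <| seq (load 13 5 12) <| seq (load 14 4 13) <| seq findCentre <|
    cond 3 15 (seq (fillVertices 6) <| seq fillCoins updateBlocks) skip

/-- Initialise the constant registers and compute the size of the blocks. -/
def initConstants : Cmd :=
  seq (const 4 1) <| seq (add 5 0 4) <| seq (add 5 5 4) <| seq (add 6 5 4) <| seq (add 7 6 4) <|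
    seq (sub 9 2 4) <| seq (loop 20 0 (seq (add 20 20 1) (add 8 8 4))) (sub 8 8 4)

/-- For `s ≥ s₀`, choose the coins with success probability `1 / √((s - 1) / log₂ (s - 1))`. -/
def chooseCoin : Cmd :=
  seq (const 10 1) <| seq (const 20 1) <| seq (const 21 0) <|
    seq (loop 20 9 (seq (add 20 20 20) (add 21 21 4))) <|
    seq (const 11 0) <| seq (add 22 21 3) <| seq (add 23 21 21) <| seq (add 23 23 21) <|
    seq (loop 22 2 (seq (add 11 11 4) <| seq (add 22 22 23) <| seq (add 23 23 21) (add 23 23 21)))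
      (sub 11 11 4)

/-- Choose the coins, and the number of blocks that have to be inspected. -/
def chooseParameters (s₀ Q₀ : ℕ) : Cmd :=
  cond 0 2 (const 18 0) <| seq (add 18 1 3) <| seq (const 20 s₀) <|
    cond 2 20 (seq (const 10 Q₀) (const 11 Q₀)) chooseCoin

/-- Push all the blocks that have to be inspected. -/
def pushAll : Cmd := loop 12 18 (seq (store 5 12 12) (add 12 12 4))

/-- The program. -/
def program (s₀ Q₀ : ℕ) : Cmd :=
  seq initConstants <| seq (chooseParameters s₀ Q₀) <| seq (fillVertices 4) <| seq pushAll mainLoop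

end Cmd

open Cmd

theorem Ensures.ifEq {a b : ℕ} {p : Cmd} {σ : Store} {T : ℕ} {Q : Store → Prop}
    (h1 : σ.reg a = σ.reg b → Ensures p σ T Q) (h2 : σ.reg a ≠ σ.reg b → Q (σ.setReg 39 0)) :
    Ensures (Cmd.ifEq a b p) σ (T + 3) Q := by
  refine Ensures.cond (T := T + 2) (fun h => Ensures.const (T := T + 1) (h2 h.ne)) fun h => ?_
  refine Ensures.cond (T := T + 1) (fun h' => Ensures.const (h2 h'.ne')) fun h' => ?_
  exact (h1 (by omega)).mono (by omega) fun _ h => h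

/-- The registers below `m` are unchanged. -/
def SameBelow (m : ℕ) (σ τ : Store) : Prop := ∀ r < m, τ.reg r = σ.reg r

theorem SameBelow.mono {m m' : ℕ} {σ τ : Store} (h : SameBelow m' σ τ) (hm : m ≤ m') :
    SameBelow m σ τ := fun r hr => h r (by omega)

/-! ### Memory layout and the random draws of the program -/

section Specs

variable {n l b t num Q : ℕ}

/-- The vertices of a block, in increasing order. -/
structure BlockEnum (blk : Fin n → Fin l) (ve : Fin l → Fin b → Fin n) : Prop where
  blk_eq : ∀ h a, blk (ve h a) = h
  val_eq : ∀ h a, (ve h a : ℕ) = Nat.nth (fun v => ∃ hv : v < n, blk ⟨v, hv⟩ = h) a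
  inj : ∀ h, Function.Injective (ve h)
  count : ∀ h, Nat.count (fun v => ∃ hv : v < n, blk ⟨v, hv⟩ = h) n = b

open Classical in
/-- The parts of the store that the main loop does not change. -/
structure Env (G : SimpleGraph (Fin n)) (blk : Fin n → Fin l) (b t num Q : ℕ) (σ : Store) :
    Prop where
  r0 : σ.reg 0 = n
  r1 : σ.reg 1 = l
  r3 : σ.reg 3 = 0
  r4 : σ.reg 4 = 1
  r5 : σ.reg 5 = n + 2
  r6 : σ.reg 6 = n + 3
  r7 : σ.reg 7 = n + 4
  r8 : σ.reg 8 + 1 = b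
  r9 : σ.reg 9 = t
  r10 : σ.reg 10 = num
  r11 : σ.reg 11 + 1 = Q
  blk_eq : ∀ v : Fin n, σ.mem 0 v = blk v
  adj : ∀ u v : Fin n, σ.mem (u + 2) v = if G.Adj u v then 1 else 0

variable {G : SimpleGraph (Fin n)} {blk : Fin n → Fin l} {ve : Fin l → Fin b → Fin n}
  {σ τ : Store}

theorem Env.congr (hE : Env G blk b t num Q σ) (hr : SameBelow 12 σ τ)
    (hm : ∀ i j, i ≠ 1 → i < n + 2 → τ.mem i j = σ.mem i j) : Env G blk b t num Q τ where
  r0 := by rw [hr 0 (by norm_num), hE.r0]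
  r1 := by rw [hr 1 (by norm_num), hE.r1]
  r3 := by rw [hr 3 (by norm_num), hE.r3]
  r4 := by rw [hr 4 (by norm_num), hE.r4]
  r5 := by rw [hr 5 (by norm_num), hE.r5]
  r6 := by rw [hr 6 (by norm_num), hE.r6]
  r7 := by rw [hr 7 (by norm_num), hE.r7]
  r8 := by rw [hr 8 (by norm_num), hE.r8]
  r9 := by rw [hr 9 (by norm_num), hE.r9]
  r10 := by rw [hr 10 (by norm_num), hE.r10]
  r11 := by rw [hr 11 (by norm_num), hE.r11]
  blk_eq := fun v => by rw [hm 0 v (by norm_num) (by omega), hE.blk_eq]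
  adj := fun u v => by rw [hm _ v (by omega) (by omega), hE.adj]

/-- All vertices are scanned in order; `R_31` is the current vertex, `R_32` counts the vertices of
the block seen so far, and the one met when this count equals the draw in `R_30` is recorded. It is
met because the block has `b` vertices. -/
theorem ensuresUnif_drawVertex (hE : Env G blk b t num Q σ) (hve : BlockEnum blk ve) (h : Fin l)
    (hh : σ.reg 20 = h) :
    EnsuresUnif drawVertex σ (16 * n + 8) fun (a : Fin b) τ =>
      SameBelow 30 σ τ ∧ τ.mem = σ.mem ∧ τ.reg 34 = ve h a := by
  classical
  refine (EnsuresUnif.rand_seq (T := 16 * n + 6) hE.r8 fun a => ?_).mono (by omega) fun _ _ h => h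
  refine Ensures.const_seq (T := 16 * n + 4) (Ensures.const_seq (T := 16 * n + 2) ?_)
  set p : ℕ → Prop := fun v => ∃ hv : v < n, blk ⟨v, hv⟩ = h with hp
  refine (Ensures.loop_up (N := n) (T := 13) (fun m τ => SameBelow 30 σ τ ∧ τ.mem = σ.mem ∧
    τ.reg 30 = a ∧ τ.reg 31 = m ∧ τ.reg 32 = Nat.count p m ∧
      ((a : ℕ) < Nat.count p m → τ.reg 34 = ve h a)) ?_ ?_ ?_).mono (by omega) ?_
  · rintro m hm τ ⟨h1, h2, h3, h4, h5, h6⟩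
    have hEτ : Env G blk b t num Q τ := hE.congr (h1.mono (by norm_num)) (by simp [h2])
    refine ⟨by rw [h4, hEτ.r0]; exact hm, ?_⟩
    have hblk : τ.mem (τ.reg 3) (τ.reg 31) = blk ⟨m, hm⟩ := by
      rw [hEτ.r3, h4]; exact hEτ.blk_eq ⟨m, hm⟩
    have h20 : τ.reg 20 = h := by rw [h1 20 (by norm_num), hh]
    have hpm : p m ↔ blk ⟨m, hm⟩ = h := by simp [hp, hm]
    have hcount : Nat.count p (m + 1) = Nat.count p m + if p m then 1 else 0 := Nat.count_succ p m
    refine Ensures.load_seq (T := 11) ?_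
    rw [hblk]
    refine Ensures.seq' (T₁ := 9) (T₂ := 1) (Q₁ := fun υ => SameBelow 30 σ υ ∧ υ.mem = σ.mem ∧
      υ.reg 30 = a ∧ υ.reg 31 = m ∧ υ.reg 32 = Nat.count p (m + 1) ∧
      ((a : ℕ) < Nat.count p (m + 1) → υ.reg 34 = ve h a)) ?_ ?_ (by norm_num)
    · refine Ensures.ifEq (T := 6) (fun heq => ?_) fun hne => ?_
      · simp [h20, Fin.val_inj] at heq
        have hpm' := hpm.2 heq
        rw [if_pos hpm'] at hcount
        refine Ensures.seq' (T₁ := 4) (T₂ := 1) (Q₁ := fun υ => SameBelow 30 σ υ ∧ υ.mem = σ.mem ∧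
          υ.reg 30 = a ∧ υ.reg 31 = m ∧ υ.reg 32 = Nat.count p m ∧
          ((a : ℕ) < Nat.count p (m + 1) → υ.reg 34 = ve h a)) ?_ ?_ (by norm_num)
        · refine Ensures.ifEq (T := 1) (fun heq' => ?_) fun hne' => ?_
          · simp [h5, h3] at heq'
            refine Ensures.add (T := 0) ⟨?_, by simpa using h2, by simpa using h3,
              by simpa using h4, by simpa using h5, ?_⟩
            · intro r hr
              have := h1 r hr
              simp only [Store.setReg_reg]
              rw [if_neg (by omega), if_neg (by omega), this]
            · intro _
              simp only [Store.setReg_reg]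
              simp only [Nat.reduceEqDiff, if_false, if_true, h4, hEτ.r3, add_zero]
              rw [hve.val_eq, ← heq', Nat.nth_count hpm']
          · simp [h5, h3] at hne'
            refine ⟨?_, by simpa using h2, by simpa using h3,
              by simpa using h4, by simpa using h5, ?_⟩
            · intro r hr
              have := h1 r hr
              simp only [Store.setReg_reg]
              rw [if_neg (by omega), if_neg (by omega), this]
            · intro hlt
              simpa using h6 (by omega)
        · rintro υ ⟨g1, g2, g3, g4, g5, g6⟩
          have hEυ : Env G blk b t num Q υ := hE.congr (g1.mono (by norm_num)) (by simp [g2])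
          refine Ensures.add (T := 0) ⟨?_, by simpa using g2, by simpa using g3,
            by simpa using g4, by simp [g5, hcount, hEυ.r4], by simpa using g6⟩
          intro r hr
          simp only [Store.setReg_reg]
          rw [if_neg (by omega), g1 r hr]
      · simp [h20, Fin.val_inj] at hne
        have hpm' : ¬ p m := fun h' => hne (hpm.1 h')
        rw [if_neg hpm', add_zero] at hcount
        rw [hcount]
        refine ⟨?_, by simpa using h2, by simpa using h3,
          by simpa using h4, by simpa using h5, by simpa using h6⟩
        intro r hr
        simp only [Store.setReg_reg]
        rw [if_neg (by omega), if_neg (by omega), h1 r hr]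
    · rintro υ ⟨g1, g2, g3, g4, g5, g6⟩
      have hEυ : Env G blk b t num Q υ := hE.congr (g1.mono (by norm_num)) (by simp [g2])
      refine Ensures.add (T := 0) ⟨?_, by simpa using g2, by simpa using g3,
        by simp [g4, hEυ.r4], by simpa using g5, by simpa using g6⟩
      intro r hr
      simp only [Store.setReg_reg]
      rw [if_neg (by omega), g1 r hr]
  · rintro τ ⟨h1, h2, h3, h4, h5, h6⟩
    rw [h4, h1 0 (by norm_num), hE.r0]
    exact lt_irrefl n
  · refine ⟨?_, by simp, by simp, by simp, by simp, by simp⟩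
    intro r hr
    simp only [Store.setReg_reg]
    rw [if_neg (by omega), if_neg (by omega), if_neg (by omega)]
  · rintro τ ⟨h1, h2, h3, h4, h5, h6⟩
    exact ⟨h1, h2, h6 (by rw [hve.count h]; exact a.2)⟩

/-- The condition `hR` keeps the writes away from the rows that hold the blocks and the adjacency
matrix. -/
theorem ensuresUnif_fillVertices {row : ℕ} (hrow : row < 12) (hR : σ.reg row = 1 ∨ n + 2 ≤ σ.reg row)
    (hE : Env G blk b t num Q σ) (hve : BlockEnum blk ve) [Nonempty (Fin b)] :
    EnsuresUnif (fillVertices row) σ (l * (16 * n + 16) + 3) fun (S : Fin l → Fin b) τ =>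
      SameBelow 20 σ τ ∧ (∀ h : Fin l, τ.mem (σ.reg row) h = ve h (S h)) ∧
        ∀ i j, i ≠ σ.reg row → τ.mem i j = σ.mem i j := by
  refine (EnsuresUnif.after (T₁ := 1) (T₂ := l * (16 * n + 16) + 1)
    (Ensures.add (T := 0) (Q := fun τ => τ = σ.setReg 20 (σ.reg 1 + σ.reg 3)) rfl) ?_).mono
      (by omega) fun _ _ h => h
  rintro _ rfl
  obtain ⟨a₀⟩ := ‹Nonempty (Fin b)›
  refine (EnsuresUnif.loop_down (α := Fin b) (T := 16 * n + 15) (fun m u τ => m ≤ l ∧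
    SameBelow 20 σ τ ∧ τ.reg 20 = m ∧
      (∀ h : Fin l, m ≤ h → τ.mem (σ.reg row) h = ve h (u h)) ∧
        ∀ i j, i ≠ σ.reg row → τ.mem i j = σ.mem i j) ?_ ?_ l (fun _ => a₀) ?_).mono (by
          apply le_of_eq; ring) ?_
  · rintro m u τ ⟨hm, h1, h2, h3, h4⟩
    have hEτ : Env G blk b t num Q τ := hE.congr (h1.mono (by norm_num)) (by
      intro i j hi hi'
      exact h4 i j (by omega))
    refine ⟨by rw [h2, hEτ.r3]; omega, ?_⟩
    refine (EnsuresUnif.after (T₁ := 1) (T₂ := 16 * n + 10)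
      (Ensures.sub (T := 0) (Q := fun υ => υ = τ.setReg 20 (τ.reg 20 - τ.reg 4)) rfl) ?_).mono
        (by omega) fun _ _ h => h
    rintro _ rfl
    have h20 : τ.reg 20 - τ.reg 4 = m := by rw [h2, hEτ.r4]; omega
    rw [h20]
    have hEυ : Env G blk b t num Q (τ.setReg 20 m) := hEτ.congr (by
      intro r hr; simp only [Store.setReg_reg]; rw [if_neg (by omega)]) (by simp)
    refine ((ensuresUnif_drawVertex hEυ hve ⟨m, hm⟩ (by simp)).seq_ensures (T₂ := 1)
      fun a υ hυ => ?_).mono (by omega) fun _ _ h => h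
    obtain ⟨g1, g2, g3⟩ := hυ
    have hrow' : υ.reg row = σ.reg row := by
      rw [g1 row (by omega), Store.setReg_reg, if_neg (by omega), h1 row (by omega)]
    have g20 : υ.reg 20 = m := by rw [g1 20 (by norm_num)]; simp
    refine Ensures.store (T := 0) ⟨by omega, ?_, by simpa using g20, ?_, ?_⟩
    · intro r hr
      rw [Store.setMem_reg, g1 r (by omega), Store.setReg_reg, if_neg (by omega), h1 r hr]
    · intro h hh
      rw [Store.setMem_mem, hrow', g20, g3, Function.update_apply]
      by_cases he : (h : ℕ) = m
      · have : h = ⟨m, hm⟩ := Fin.ext he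
        subst this
        simp
      · simp only [he, and_false, if_false]
        rw [g2]
        exact h3 h (by omega)
    · intro i j hi
      rw [Store.setMem_mem, hrow', if_neg (fun h => hi h.1), g2]
      exact h4 i j hi
  · rintro u τ ⟨hm, h1, h2, h3, h4⟩
    rw [h2]
    exact Nat.not_lt_zero _
  · refine ⟨le_rfl, ?_, by simp [hE.r1, hE.r3], fun h hh => absurd h.2 (by omega), by simp⟩
    intro r hr
    simp only [Store.setReg_reg]
    rw [if_neg (by omega)]
  · rintro S τ ⟨-, h1, h2, h3, h4⟩
    refine ⟨h1, fun h => ?_, h4⟩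
    rw [h3 h (Nat.zero_le _)]
    simp [EnsuresUnif.overwrite]

theorem ensuresUnif_fillCoins (hE : Env G blk b t num Q σ) [Nonempty (Fin Q)] :
    EnsuresUnif fillCoins σ (l * 8 + 3) fun (κ : Fin l → Fin Q) τ =>
      SameBelow 20 σ τ ∧ (∀ h : Fin l, τ.mem (n + 4) h = κ h) ∧
        ∀ i j, i ≠ n + 4 → τ.mem i j = σ.mem i j := by
  refine (EnsuresUnif.after (T₁ := 1) (T₂ := l * 8 + 1)
    (Ensures.add (T := 0) (Q := fun τ => τ = σ.setReg 20 (σ.reg 1 + σ.reg 3)) rfl) ?_).mono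
      (by omega) fun _ _ h => h
  rintro _ rfl
  obtain ⟨a₀⟩ := ‹Nonempty (Fin Q)›
  refine (EnsuresUnif.loop_down (α := Fin Q) (T := 7) (fun m u τ => m ≤ l ∧
    SameBelow 20 σ τ ∧ τ.reg 20 = m ∧
      (∀ h : Fin l, m ≤ h → τ.mem (n + 4) h = u h) ∧
        ∀ i j, i ≠ n + 4 → τ.mem i j = σ.mem i j) ?_ ?_ l (fun _ => a₀) ?_).mono (by
          apply le_of_eq; ring) ?_
  · rintro m u τ ⟨hm, h1, h2, h3, h4⟩
    have hEτ : Env G blk b t num Q τ := hE.congr (h1.mono (by norm_num)) (by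
      intro i j hi hi'
      exact h4 i j (by omega))
    refine ⟨by rw [h2, hEτ.r3]; omega, ?_⟩
    refine (EnsuresUnif.after (T₁ := 1) (T₂ := 3)
      (Ensures.sub (T := 0) (Q := fun υ => υ = τ.setReg 20 (τ.reg 20 - τ.reg 4)) rfl) ?_).mono
        (by omega) fun _ _ h => h
    rintro _ rfl
    have h20 : τ.reg 20 - τ.reg 4 = m := by rw [h2, hEτ.r4]; omega
    rw [h20]
    have hEυ : Env G blk b t num Q (τ.setReg 20 m) := hEτ.congr (by
      intro r hr; simp only [Store.setReg_reg]; rw [if_neg (by omega)]) (by simp)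
    refine EnsuresUnif.rand_seq (T := 1) hEυ.r11 fun a => ?_
    have h7 : τ.reg 7 = n + 4 := hEτ.r7
    refine Ensures.store (T := 0) ⟨by omega, ?_, by simp, ?_, ?_⟩
    · intro r hr
      simp only [Store.setMem_reg, Store.setReg_reg]
      rw [if_neg (by omega), if_neg (by omega), h1 r hr]
    · intro h hh
      simp only [Store.setMem_mem, Store.setReg_reg, Function.update_apply, Store.setReg_mem]
      by_cases he : (h : ℕ) = m
      · simp [h7, he]
      · simp [he]
        exact h3 h (by omega)
    · intro i j hi
      simp only [Store.setMem_mem, Store.setReg_reg, Store.setReg_mem]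
      simp [h7, hi]
      exact h4 i j hi
  · rintro u τ ⟨hm, h1, h2, h3, h4⟩
    rw [h2]
    exact Nat.not_lt_zero _
  · refine ⟨le_rfl, ?_, by simp [hE.r1, hE.r3], fun h hh => absurd h.2 (by omega), by simp⟩
    intro r hr
    simp only [Store.setReg_reg]
    rw [if_neg (by omega)]
  · rintro κ τ ⟨-, h1, h2, h3, h4⟩
    refine ⟨h1, fun h => ?_, h4⟩
    rw [h3 h (Nat.zero_le _)]
    simp [EnsuresUnif.overwrite]

end Specs

/-! ### The search for a bad centre -/

section Specs

variable {n l b t num Q : ℕ} {G : SimpleGraph (Fin n)} {blk : Fin n → Fin l}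
  {ve : Fin l → Fin b → Fin n} {σ τ : Store}

theorem SameBelow.setReg {m r k : ℕ} (h : SameBelow m σ τ) (hr : m ≤ r) :
    SameBelow m σ (τ.setReg r k) := by
  intro r' hr'
  rw [Store.setReg_reg, if_neg (by omega), h r' hr']

theorem SameBelow.refl (m : ℕ) (σ : Store) : SameBelow m σ σ := fun _ _ => rfl

theorem BlockEnum.eq_iff (hve : BlockEnum blk ve) {x : Fin l → Fin b} {h i : Fin l} :
    (ve h (x h) : ℕ) = ve i (x i) ↔ h = i := by
  constructor
  · intro he
    have := congrArg blk (Fin.ext he)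
    rwa [hve.blk_eq, hve.blk_eq] at this
  · rintro rfl; rfl

open Classical in
theorem card_filter_le_and (p : Fin l → Prop) {m : ℕ} (hm : m < l) :
    (Finset.univ.filter fun h : Fin l => m ≤ h ∧ p h).card =
      (Finset.univ.filter fun h : Fin l => m + 1 ≤ h ∧ p h).card +
        if p ⟨m, hm⟩ then 1 else 0 := by
  split_ifs with h
  · rw [← Finset.card_insert_of_notMem (a := ⟨m, hm⟩) (by simp)]
    congr 1
    ext k
    simp only [Finset.mem_filter, Finset.mem_univ, true_and, Finset.mem_insert, Fin.ext_iff]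
    constructor
    · rintro ⟨h1, h2⟩
      by_cases hk : (k : ℕ) = m
      · exact Or.inl hk
      · exact Or.inr ⟨by omega, h2⟩
    · rintro (h1 | h1)
      · exact ⟨h1.ge, by rwa [show k = ⟨m, hm⟩ from Fin.ext h1]⟩
      · exact ⟨by omega, h1.2⟩
  · rw [add_zero]
    congr 1
    ext k
    simp only [Finset.mem_filter, Finset.mem_univ, true_and]
    constructor
    · rintro ⟨h1, h2⟩
      refine ⟨lt_of_le_of_ne h1 fun e => h ?_, h2⟩
      rwa [show (⟨m, hm⟩ : Fin l) = k from Fin.ext e]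
    · rintro ⟨h1, h2⟩
      exact ⟨by omega, h2⟩

/-- The first row of the memory holds the selection `x`. -/
def SelStored (ve : Fin l → Fin b → Fin n) (x : Fin l → Fin b) (σ : Store) : Prop :=
  ∀ h : Fin l, σ.mem 1 h = ve h (x h)

open Classical in
theorem ensures_countNeighbours {x : Fin l → Fin b} (hE : Env G blk b t num Q σ)
    (hx : SelStored ve x σ) (v : Fin n) (hv : σ.reg 22 = v + 2) :
    Ensures countNeighbours σ (l * 8 + 5) fun τ => SameBelow 30 σ τ ∧ τ.mem = σ.mem ∧
      τ.reg 33 = (Finset.univ.filter fun h => G.Adj v (ve h (x h))).card := by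
  refine Ensures.const_seq (T := l * 8 + 3) (Ensures.add_seq (T := l * 8 + 1) ?_)
  refine (Ensures.loop_down (T := 7) (fun m τ => m ≤ l ∧ SameBelow 30 σ τ ∧ τ.mem = σ.mem ∧
    τ.reg 30 = m ∧
    τ.reg 33 = (Finset.univ.filter fun h : Fin l => m ≤ h ∧ G.Adj v (ve h (x h))).card) ?_ ?_ l
      ?_).mono le_rfl ?_
  · rintro m τ ⟨hm, h1, h2, h3, h4⟩
    have hEτ : Env G blk b t num Q τ := hE.congr (h1.mono (by norm_num)) (by simp [h2])
    refine ⟨by rw [hEτ.r3, h3]; omega, ?_⟩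
    refine Ensures.sub_seq (T := 5) (Ensures.load_seq (T := 3) (Ensures.load_seq (T := 1)
      (Ensures.add (T := 0) ⟨by omega, ?_, by simpa using h2, by simp [h3, hEτ.r4], ?_⟩)))
    · exact (((h1.setReg le_rfl).setReg (by norm_num)).setReg (by norm_num)).setReg (by norm_num)
    · have hm1 : τ.mem 1 m = ve ⟨m, hm⟩ (x ⟨m, hm⟩) := by
        rw [h2]; exact hx ⟨m, hm⟩
      have h22 : τ.reg 22 = v + 2 := by rw [h1 22 (by norm_num), hv]
      simp only [Store.setReg_reg, Store.setReg_mem, Nat.reduceEqDiff, if_true, if_false, h3,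
        hEτ.r4, Nat.add_sub_cancel, hm1, h22, hEτ.adj, h4]
      rw [card_filter_le_and _ hm]
  · rintro τ ⟨hm, h1, h2, h3, h4⟩
    rw [h3]; exact Nat.not_lt_zero _
  · refine ⟨le_rfl, ((SameBelow.refl _ _).setReg (by norm_num)).setReg (by norm_num), by simp,
      by simp [hE.r1, hE.r3], ?_⟩
    simp only [Store.setReg_reg, Nat.reduceEqDiff, if_true, if_false]
    rw [eq_comm, Finset.card_eq_zero, Finset.filter_eq_empty_iff]
    rintro k - ⟨hk, -⟩
    exact absurd k.2 (by omega)
  · rintro τ ⟨hm, h1, h2, h3, h4⟩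
    exact ⟨h1, h2, by simpa using h4⟩

/-- Blocks are scanned by decreasing index and a later report overwrites an earlier one, so the bad
centre of least index survives, as in `badCentre`. -/
theorem ensures_findCentre {x : Fin l → Fin b} (hE : Env G blk b t num Q σ)
    (hve : BlockEnum blk ve) (hx : SelStored ve x σ) (i : Fin l)
    (hi : σ.reg 14 = ve i (x i)) :
    Ensures findCentre σ (l * (l * 8 + 40) + 5) fun τ =>
      (∀ r < 20, r ≠ 15 → r ≠ 16 → τ.reg r = σ.reg r) ∧ τ.mem = σ.mem ∧
      ((τ.reg 15 = 0 ∧ badCentre G ve t x i = none) ∨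
        (τ.reg 15 = 1 ∧ ∃ j, badCentre G ve t x i = some j ∧ τ.reg 16 = ve j (x j))) := by
  classical
  refine Ensures.const_seq (T := l * (l * 8 + 40) + 3)
    (Ensures.add_seq (T := l * (l * 8 + 40) + 1) ?_)
  refine (Ensures.loop_down (T := l * 8 + 39) (fun m τ => m ≤ l ∧
    (∀ r < 20, r ≠ 15 → r ≠ 16 → τ.reg r = σ.reg r) ∧ τ.mem = σ.mem ∧ τ.reg 20 = m ∧
    ((τ.reg 15 = 0 ∧ ∀ j : Fin l, m ≤ j → ¬ IsBadCentre G ve t x i j) ∨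
      (τ.reg 15 = 1 ∧ ∃ j : Fin l, m ≤ j ∧ IsBadCentre G ve t x i j ∧ τ.reg 16 = ve j (x j) ∧
        ∀ j' < j, m ≤ j' → ¬ IsBadCentre G ve t x i j'))) ?_ ?_ l ?_).mono le_rfl ?_
  · rintro m τ ⟨hm, h1, h2, h3, h4⟩
    have hEτ : Env G blk b t num Q τ := hE.congr
      (fun r hr => h1 r (by omega) (by omega) (by omega)) (by simp [h2])
    refine ⟨by rw [hEτ.r3, h3]; omega, ?_⟩
    set k : Fin l := ⟨m, hm⟩ with hk
    have hm1 : τ.mem 1 m = ve k (x k) := by rw [h2]; exact hx ⟨m, hm⟩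
    refine Ensures.mono (T₁ := l * 8 + 36) ?_ (by omega) fun _ h => h
    refine Ensures.sub_seq (T := l * 8 + 34) (Ensures.load_seq (T := l * 8 + 32)
      (Ensures.add_seq (T := l * 8 + 30) (Ensures.add_seq (T := l * 8 + 28) ?_)))
    set υ := ((((τ.setReg 20 (τ.reg 20 - τ.reg 4)).setReg 21 _).setReg 22 _).setReg 22 _) with hυ
    have hυ1 : ∀ r < 20, υ.reg r = τ.reg r := by
      have : SameBelow 20 τ υ := ((((SameBelow.refl 20 τ).setReg (by norm_num)).setReg
        (by norm_num)).setReg (by norm_num)).setReg (by norm_num)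
      exact this
    have hυ2 : υ.mem = σ.mem := by simp [hυ, h2]
    have hυ20 : υ.reg 20 = m := by simp [hυ, h3, hEτ.r4]
    have hυ21 : υ.reg 21 = ve k (x k) := by simp [hυ, h3, hEτ.r4, hm1]
    have hυ22 : υ.reg 22 = ve k (x k) + 2 := by simp [hυ, h3, hEτ.r4, hm1]
    clear_value υ
    have hEυ : Env G blk b t num Q υ := hEτ.congr
      (fun r hr => hυ1 r (by omega)) (by simp [hυ2, h2])
    have hxυ : SelStored ve x υ := fun h => by rw [hυ2]; exact hx h
    refine (ensures_countNeighbours hEυ hxυ (ve k (x k)) hυ22).seq' (T₂ := 20) ?_ (by omega)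
    rintro ω ⟨g1, g2, g3⟩
    have hω1 : ∀ r < 20, ω.reg r = τ.reg r := fun r hr => (g1 r (by omega)).trans (hυ1 r hr)
    have hω2 : ω.mem = σ.mem := g2.trans hυ2
    have hω20 : ω.reg 20 = m := (g1 20 (by norm_num)).trans hυ20
    have hω21 : ω.reg 21 = ve k (x k) := (g1 21 (by norm_num)).trans hυ21
    have hω22 : ω.reg 22 = ve k (x k) + 2 := (g1 22 (by norm_num)).trans hυ22
    have hω14 : ω.reg 14 = ve i (x i) := by
      rw [hω1 14 (by norm_num), h1 14 (by norm_num) (by norm_num) (by norm_num), hi]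
    have hω33 : ω.reg 33 = selDegree G ve x k := by rw [g3]; rfl
    have hEω : Env G blk b t num Q ω := hEυ.congr (g1.mono (by norm_num)) (by simp [g2])
    -- An iteration restores the invariant in one of two ways: `hkeep` if block `k` is no bad centre
    -- and the report stands, `hrep` if it is one and replaces the report.
    have hkeep : ∀ ψ : Store, SameBelow 20 ω ψ → ψ.mem = σ.mem → ψ.reg 20 = m →
        ¬ IsBadCentre G ve t x i k → (m ≤ l ∧
        (∀ r < 20, r ≠ 15 → r ≠ 16 → ψ.reg r = σ.reg r) ∧ ψ.mem = σ.mem ∧ ψ.reg 20 = m ∧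
        ((ψ.reg 15 = 0 ∧ ∀ j : Fin l, m ≤ j → ¬ IsBadCentre G ve t x i j) ∨
        (ψ.reg 15 = 1 ∧ ∃ j : Fin l, m ≤ j ∧ IsBadCentre G ve t x i j ∧ ψ.reg 16 = ve j (x j) ∧
        ∀ j' < j, m ≤ j' → ¬ IsBadCentre G ve t x i j'))) := by
      intro ψ e1 e2 e3 hnb
      refine ⟨by omega, fun r hr ha hb => by rw [e1 r hr, hω1 r hr, h1 r hr ha hb], e2, e3, ?_⟩
      have hstep : ∀ j : Fin l, (m + 1 ≤ j → ¬ IsBadCentre G ve t x i j) → m ≤ j →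
          ¬ IsBadCentre G ve t x i j := by
        intro j hj hmj
        by_cases he : j = k
        · rwa [he]
        · refine hj (lt_of_le_of_ne hmj fun e => he (Fin.ext e.symm))
      rw [e1 15 (by norm_num), e1 16 (by norm_num), hω1 15 (by norm_num), hω1 16 (by norm_num)]
      rcases h4 with ⟨h5, h6⟩ | ⟨h5, j, h6, h7, h8, h9⟩
      · exact Or.inl ⟨h5, fun j => hstep j (h6 j)⟩
      · exact Or.inr ⟨h5, j, by omega, h7, h8, fun j' hj' => hstep j' (h9 j' hj')⟩
    have hrep : ∀ ψ : Store, (∀ r < 20, r ≠ 15 → r ≠ 16 → ψ.reg r = ω.reg r) → ψ.mem = σ.mem →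
        ψ.reg 20 = m → ψ.reg 15 = 1 → ψ.reg 16 = ve k (x k) →
        IsBadCentre G ve t x i k → (m ≤ l ∧
        (∀ r < 20, r ≠ 15 → r ≠ 16 → ψ.reg r = σ.reg r) ∧ ψ.mem = σ.mem ∧ ψ.reg 20 = m ∧
        ((ψ.reg 15 = 0 ∧ ∀ j : Fin l, m ≤ j → ¬ IsBadCentre G ve t x i j) ∨
        (ψ.reg 15 = 1 ∧ ∃ j : Fin l, m ≤ j ∧ IsBadCentre G ve t x i j ∧ ψ.reg 16 = ve j (x j) ∧
        ∀ j' < j, m ≤ j' → ¬ IsBadCentre G ve t x i j'))) := by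
      intro ψ e1 e2 e3 e4 e5 hb
      refine ⟨by omega, fun r hr ha hb => by rw [e1 r hr ha hb, hω1 r hr, h1 r hr ha hb], e2, e3,
        Or.inr ⟨e4, k, le_rfl, hb, e5, fun j' hj' hmj' => ?_⟩⟩
      exact absurd hj' (by simp [hk, Fin.lt_def]; omega)
    refine Ensures.cond (T := 19) (fun hlt => ?_) fun hge => ?_
    · refine Ensures.const (T := 18) (hkeep _ ((SameBelow.refl _ _).setReg (by norm_num))
        (by simpa using hω2) (by simpa using hω20) fun hb => ?_)
      rw [hω33, hEω.r9] at hlt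
      exact absurd hb.2 (by omega)
    rw [hω33, hEω.r9, not_lt] at hge
    refine Ensures.seq' (T₁ := 8) (T₂ := 7) (Q₁ := fun ψ =>
      (∀ r < 39, r ≠ 15 → r ≠ 16 → ψ.reg r = ω.reg r) ∧ ψ.mem = σ.mem ∧
      (k = i → ψ.reg 15 = 1 ∧ ψ.reg 16 = ve k (x k)) ∧
      (k ≠ i → ψ.reg 15 = ω.reg 15 ∧ ψ.reg 16 = ω.reg 16)) ?_ ?_ (by norm_num)
    · refine Ensures.ifEq (T := 5) (fun heq => ?_) fun hne => ?_
      · rw [hω21, hω14, hve.eq_iff] at heq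
        refine Ensures.const_seq (T := 3) (Ensures.add (T := 2) ⟨?_, by simpa using hω2, fun _ => ?_,
          fun hne => absurd heq hne⟩)
        · intro r hr ha hb
          simp [ha, hb]
        · simp [hω21, hEω.r3]
      · rw [hω21, hω14, ne_eq, hve.eq_iff] at hne
        refine ⟨?_, by simpa using hω2, fun h => absurd h hne, fun _ => by simp⟩
        intro r hr ha hb
        rw [Store.setReg_reg, if_neg (by omega)]
    · rintro ψ ⟨e1, e2, e3, e4⟩
      refine Ensures.load_seq (T := 5) ?_
      have hψ22 : ψ.reg 22 = ve k (x k) + 2 := by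
        rw [e1 22 (by norm_num) (by norm_num) (by norm_num), hω22]
      have hψ14 : ψ.reg 14 = ve i (x i) := by
        rw [e1 14 (by norm_num) (by norm_num) (by norm_num), hω14]
      have hψ3 : ψ.reg 3 = 0 := by
        rw [e1 3 (by norm_num) (by norm_num) (by norm_num), hEω.r3]
      have hψ20 : ψ.reg 20 = m := by
        rw [e1 20 (by norm_num) (by norm_num) (by norm_num), hω20]
      have hψ21 : ψ.reg 21 = ve k (x k) := by
        rw [e1 21 (by norm_num) (by norm_num) (by norm_num), hω21]
      have hadj : ψ.mem (ψ.reg 22) (ψ.reg 14) = if SelAdj G ve x k i then 1 else 0 := by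
        rw [hψ22, hψ14, e2, ← hω2, hEω.adj]; rfl
      rw [hadj]
      refine Ensures.cond (T := 4) (fun hlt => ?_) fun hge' => ?_
      · have hA : SelAdj G ve x k i := by
          by_contra hA
          simp [hψ3, hA] at hlt
        refine Ensures.const_seq (T := 2) (Ensures.add (T := 1) (hrep _ ?_ (by simpa using e2)
          (by simpa using hψ20) (by simp) (by simp [hψ21, hψ3]) ⟨Or.inr hA, hge⟩))
        intro r hr ha hb
        simp only [Store.setReg_reg]
        rw [if_neg hb, if_neg ha, if_neg (by omega), e1 r (by omega) ha hb]
      · simp [hψ3] at hge'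
        refine Ensures.const (T := 3) ?_
        by_cases hki : k = i
        · refine hrep _ ?_ (by simpa using e2) (by simpa using hψ20) (by simpa using (e3 hki).1)
            (by simpa using (e3 hki).2) ⟨Or.inl hki, hge⟩
          intro r hr ha hb
          simp only [Store.setReg_reg]
          rw [if_neg (by omega), if_neg (by omega), e1 r (by omega) ha hb]
        · refine hkeep _ ?_ (by simpa using e2) (by simpa using hψ20)
            (fun hb => hb.1.elim hki hge')
          intro r hr
          simp only [Store.setReg_reg]
          rw [if_neg (by omega), if_neg (by omega)]
          by_cases ha : r = 15
          · subst ha; exact (e4 hki).1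
          by_cases hb : r = 16
          · subst hb; exact (e4 hki).2
          exact e1 r (by omega) ha hb
  · rintro τ ⟨hm, h1, h2, h3, h4⟩
    rw [h3]; exact Nat.not_lt_zero _
  · refine ⟨le_rfl, ?_, by simp, by simp [hE.r1, hE.r3], Or.inl ⟨by simp, fun j hj =>
      absurd j.2 (by omega)⟩⟩
    intro r hr ha hb
    simp only [Store.setReg_reg]
    rw [if_neg (by omega), if_neg ha]
  · rintro τ ⟨hm, h1, h2, h3, h4⟩
    refine ⟨h1, h2, ?_⟩
    rcases h4 with ⟨h5, h6⟩ | ⟨h5, j, h6, h7, h8, h9⟩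
    · exact Or.inl ⟨h5, badCentre_eq_none G ve fun j => h6 j (Nat.zero_le _)⟩
    · exact Or.inr ⟨h5, j, badCentre_eq_some G ve h7 fun j' hj' => h9 j' hj' (Nat.zero_le _), h8⟩

end Specs

/-! ### Resampling the marked blocks and pushing them -/

section Specs

variable {n l b t num Q : ℕ} {G : SimpleGraph (Fin n)} {blk : Fin n → Fin l}
  {ve : Fin l → Fin b → Fin n} {σ τ : Store}

/-- The list `K` is stored as a stack, the head of the list at the top. -/
def OnStack (f : ℕ → ℕ) : List (Fin l) → Prop
  | [] => True
  | h :: K => f K.length = h ∧ OnStack f K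

theorem OnStack.congr {f g : ℕ → ℕ} {K : List (Fin l)} (h : OnStack f K)
    (hfg : ∀ p < K.length, g p = f p) : OnStack g K := by
  induction K with
  | nil => trivial
  | cons a K ih =>
    refine ⟨(hfg _ (by simp)).trans h.1, ih h.2 fun p hp => hfg p ?_⟩
    rw [List.length_cons]
    omega

open Classical in
/-- The list of blocks that have to be inspected, after the blocks `h ≥ m` of `Y` have been
added. -/
noncomputable def pushBlocksFrom (m : ℕ) (Y : Finset (Fin l)) (K : List (Fin l)) : List (Fin l) :=
  ((List.finRange l).drop m).filter (fun h => h ∈ Y) ++ K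

theorem pushBlocksFrom_zero (Y : Finset (Fin l)) (K : List (Fin l)) :
    pushBlocksFrom 0 Y K = pushBlocks Y K := by
  simp [pushBlocksFrom, pushBlocks]

theorem pushBlocksFrom_length (Y : Finset (Fin l)) (K : List (Fin l)) :
    pushBlocksFrom l Y K = K := by
  have : List.drop l (List.finRange l) = [] := List.drop_eq_nil_of_le (by simp)
  simp [pushBlocksFrom, this]

theorem pushBlocksFrom_of_mem {m : ℕ} (hm : m < l) {Y : Finset (Fin l)} {K : List (Fin l)}
    (h : ⟨m, hm⟩ ∈ Y) : pushBlocksFrom m Y K = ⟨m, hm⟩ :: pushBlocksFrom (m + 1) Y K := by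
  unfold pushBlocksFrom
  rw [List.drop_eq_getElem_cons (by simpa using hm)]
  simp [h]

theorem pushBlocksFrom_of_notMem {m : ℕ} (hm : m < l) {Y : Finset (Fin l)} {K : List (Fin l)}
    (h : ⟨m, hm⟩ ∉ Y) : pushBlocksFrom m Y K = pushBlocksFrom (m + 1) Y K := by
  unfold pushBlocksFrom
  rw [List.drop_eq_getElem_cons (by simpa using hm)]
  simp [h]

open Classical in
-- The old vertex of a block is read before it is overwritten, and the centre is kept in `R_16` and
-- `R_22`; so all adjacency tests refer to `x`, even after the block of the centre has been redrawn.
-- Treating the blocks in decreasing order leaves the least one on top, as in `pushBlocks`.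
theorem ensures_updateBlocks {x S : Fin l → Fin b} {κ : Fin l → Fin Q} {K : List (Fin l)}
    (hE : Env G blk b t num Q σ) (hve : BlockEnum blk ve) (hx : SelStored ve x σ) {i j : Fin l}
    (hi : σ.reg 14 = ve i (x i)) (hj : σ.reg 16 = ve j (x j)) (hK : σ.reg 12 = K.length)
    (hstack : OnStack (σ.mem (n + 2)) K) (hS : ∀ h : Fin l, σ.mem (n + 3) h = ve h (S h))
    (hκ : ∀ h : Fin l, σ.mem (n + 4) h = κ h) :
    Ensures updateBlocks σ (l * 48 + 7) fun τ => Env G blk b t num Q τ ∧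
      SelStored ve ((marks G ve num x i j κ).piecewise S x) τ ∧
      τ.reg 12 = (pushBlocks (marks G ve num x i j κ) K).length ∧
      OnStack (τ.mem (n + 2)) (pushBlocks (marks G ve num x i j κ) K) := by
  set Y := marks G ve num x i j κ with hY
  refine Ensures.add_seq (T := l * 48 + 5) (Ensures.add_seq (T := l * 48 + 3)
    (Ensures.add_seq (T := l * 48 + 1) ?_))
  refine (Ensures.loop_down (T := 47) (fun m τ => m ≤ l ∧ SameBelow 12 σ τ ∧
    τ.reg 14 = ve i (x i) ∧ τ.reg 16 = ve j (x j) ∧ τ.reg 22 = ve j (x j) + 2 ∧ τ.reg 20 = m ∧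
    (∀ h : Fin l, τ.mem 1 h = if m ≤ h then (ve h (Y.piecewise S x h) : ℕ) else ve h (x h)) ∧
    τ.reg 12 = (pushBlocksFrom m Y K).length ∧ OnStack (τ.mem (n + 2)) (pushBlocksFrom m Y K) ∧
    ∀ i j, i ≠ 1 → i ≠ n + 2 → τ.mem i j = σ.mem i j) ?_ ?_ l ?_).mono le_rfl ?_
  · rintro m τ ⟨hm, h1, h2, h3, h4, h5, h6, h7, h8, h9⟩
    have hEτ : Env G blk b t num Q τ := hE.congr h1 fun i j hi hi' => h9 i j hi (by omega)
    refine ⟨by rw [hEτ.r3, h5]; omega, ?_⟩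
    set k : Fin l := ⟨m, hm⟩ with hk
    have hkm : (k : ℕ) = m := rfl
    have hmem1 : τ.mem 1 m = ve k (x k) := by
      have := h6 k
      rwa [if_neg (by simp [hk])] at this
    have hmem4 : τ.mem (n + 4) m = κ k := by
      rw [h9 _ _ (by omega) (by omega)]; exact hκ k
    have hmem3 : τ.mem (n + 3) m = ve k (S k) := by
      rw [h9 _ _ (by omega) (by omega)]; exact hS k
    refine Ensures.mono (T₁ := 40) ?_ (by omega) fun _ h => h
    refine Ensures.sub_seq (T := 38) (Ensures.load_seq (T := 36)
      (Ensures.const_seq (T := 34) (Ensures.load_seq (T := 32) ?_)))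
    set υ := ((((τ.setReg 20 (τ.reg 20 - τ.reg 4)).setReg 21 _).setReg 23 0).setReg 24 _) with hυ
    have hυ1 : ∀ r < 20, υ.reg r = τ.reg r := by
      have : SameBelow 20 τ υ := ((((SameBelow.refl 20 τ).setReg (by norm_num)).setReg
        (by norm_num)).setReg (by norm_num)).setReg (by norm_num)
      exact this
    have hυ2 : υ.mem = τ.mem := by simp [hυ]
    have hυ20 : υ.reg 20 = m := by simp [hυ, h5, hEτ.r4]
    have hυ21 : υ.reg 21 = ve k (x k) := by simp [hυ, h5, hEτ.r4, hmem1]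
    have hυ22 : υ.reg 22 = ve j (x j) + 2 := by simp [hυ, h4]
    have hυ23 : υ.reg 23 = 0 := by simp [hυ]
    have hυ24 : υ.reg 24 = κ k := by simp [hυ, h5, hEτ.r4, hEτ.r7, hmem4]
    clear_value υ
    have hEυ : Env G blk b t num Q υ := hEτ.congr (fun r hr => hυ1 r (by omega)) (by simp [hυ2])
    have hυ14 : υ.reg 14 = ve i (x i) := by rw [hυ1 14 (by norm_num), h2]
    have hυ16 : υ.reg 16 = ve j (x j) := by rw [hυ1 16 (by norm_num), h3]
    -- `R_23` is the mark: the adjacency bit if the coin succeeds, then forced to `1` for the blocks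
    -- `i` and `j`.
    refine Ensures.seq' (T₁ := 2) (T₂ := 29) (Q₁ := fun ω => SameBelow 23 υ ω ∧ ω.mem = τ.mem ∧
      (0 < ω.reg 23 ↔ SelAdj G ve x j k ∧ (κ k : ℕ) < num)) ?_ ?_ (by norm_num)
    · refine Ensures.cond (T := 1) (fun hlt => ?_) fun hge => ?_
      · rw [hυ24, hEυ.r10] at hlt
        refine Ensures.load (T := 0) ⟨(SameBelow.refl _ _).setReg le_rfl, by simpa using hυ2, ?_⟩
        simp only [Store.setReg_reg, if_true, hυ21, hυ22, hEυ.adj, hlt, and_true, SelAdj]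
        split_ifs with ha <;> simp [ha]
      · rw [hυ24, hEυ.r10] at hge
        refine Ensures.const (T := 0) ⟨(SameBelow.refl _ _).setReg (by norm_num),
          by simpa using hυ2, ?_⟩
        simp [hυ23, hge]
    rintro ω ⟨g1, g2, g3⟩
    have hmark : ∀ (r : ℕ) (a : Fin l) (P : Prop) (ω' : Store), r < 23 → r ≠ 21 →
        υ.reg r = ve a (x a) → SameBelow 23 υ ω' → ω'.mem = τ.mem → (0 < ω'.reg 23 ↔ P) →
        Ensures (ifEq 21 r (const 23 1)) ω' 4 fun ω => SameBelow 23 υ ω ∧ ω.mem = τ.mem ∧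
          (0 < ω.reg 23 ↔ (k = a ∨ P)) := by
      intro r a P ω' hr hr' hra e1 e2 e3
      refine Ensures.ifEq (T := 1) (fun heq => ?_) fun hne => ?_
      · rw [e1 21 (by norm_num), e1 r hr, hra, hυ21, hve.eq_iff] at heq
        refine Ensures.const (T := 0) ⟨e1.setReg le_rfl, by simpa using e2, ?_⟩
        simp [heq]
      · rw [e1 21 (by norm_num), e1 r hr, hra, hυ21, ne_eq, hve.eq_iff] at hne
        refine ⟨e1.setReg (by norm_num), by simpa using e2, ?_⟩
        simp [hne, e3]
    refine (hmark 14 _ _ _ (by norm_num) (by norm_num) hυ14 g1 g2 g3).seq' (T₂ := 24) ?_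
      (by norm_num)
    rintro ω' ⟨g1, g2, g3⟩
    refine (hmark 16 _ _ _ (by norm_num) (by norm_num) hυ16 g1 g2 g3).seq' (T₂ := 19) ?_
      (by norm_num)
    rintro ψ ⟨e1, e2, e3⟩
    have hkY : 0 < ψ.reg 23 ↔ k ∈ Y := by
      rw [e3, hY, marks, Finset.mem_filter]
      simp only [Finset.mem_univ, true_and]
      rw [or_assoc]
    have hEψ : Env G blk b t num Q ψ := hEυ.congr (e1.mono (by norm_num)) (by simp [e2, hυ2])
    have hψr : ∀ r < 20, ψ.reg r = τ.reg r := fun r hr => (e1 r (by omega)).trans (hυ1 r hr)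
    have hψ20 : ψ.reg 20 = m := (e1 20 (by norm_num)).trans hυ20
    have hψ22 : ψ.reg 22 = ve j (x j) + 2 := (e1 22 (by norm_num)).trans hυ22
    refine Ensures.cond (T := 18) (fun hlt => ?_) fun hge => ?_
    · rw [hEψ.r3, hkY] at hlt
      have hpush := pushBlocksFrom_of_mem hm (K := K) hlt
      refine Ensures.load_seq (T := 16) (Ensures.store_seq (T := 14) (Ensures.store_seq (T := 12)
        (Ensures.add (T := 11) ?_)))
      have hl3 : ψ.mem (ψ.reg 6) (ψ.reg 20) = ve k (S k) := by rw [hEψ.r6, hψ20, e2, hmem3]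
      rw [hl3]
      have h12 : ψ.reg 12 = (pushBlocksFrom (m + 1) Y K).length := by rw [hψr 12 (by norm_num), h7]
      refine ⟨by omega, ?_, by simp [hψr 14, h2], by simp [hψr 16, h3], by simp [hψ22],
        by simp [hψ20], fun h => ?_, ?_, ?_, fun i' j' hi' hj' => ?_⟩
      · intro r hr
        simp only [Store.setReg_reg, Store.setMem_reg]
        rw [if_neg (by omega), if_neg (by omega), hψr r (by omega), h1 r hr]
      · have hn2 : ¬ (1 = n + 2) := by omega
        simp only [Store.setReg_mem, Store.setMem_mem, Store.setReg_reg, Store.setMem_reg, hEψ.r4,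
          hEψ.r5, hψ20, Nat.reduceEqDiff, if_true, if_false, true_and, hn2, false_and, e2, h6 h]
        by_cases he : (h : ℕ) = m
        · have : h = k := Fin.ext he
          subst this
          simp [Finset.piecewise, hlt, hkm]
        · have : m + 1 ≤ h ↔ m ≤ h := by omega
          simp only [he, if_false, this]
      · rw [hpush]
        simp [h12, hEψ.r4]
      · rw [hpush]
        have hn2 : ¬ (n + 2 = 1) := by omega
        refine ⟨?_, h8.congr fun p hp => ?_⟩
        · simp [hEψ.r5, h12, hψ20, hk]
        · have hp' : p ≠ (pushBlocksFrom (m + 1) Y K).length := hp.ne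
          simp [hEψ.r5, hEψ.r4, h12, hn2, hp', e2]
      · simp [hEψ.r4, hEψ.r5, hi', hj', e2]
        exact h9 i' j' hi' hj'
    · rw [hEψ.r3, hkY] at hge
      have hpush := pushBlocksFrom_of_notMem hm (K := K) hge
      refine Ensures.const (T := 17) ⟨by omega, ?_, by simp [hψr 14, h2], by simp [hψr 16, h3],
        by simp [hψ22], by simp [hψ20], fun h => ?_, ?_, ?_, fun i' j' hi' hj' => ?_⟩
      · intro r hr
        simp only [Store.setReg_reg]
        rw [if_neg (by omega), hψr r (by omega), h1 r hr]
      · simp only [Store.setReg_mem, e2, h6 h]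
        by_cases he : (h : ℕ) = m
        · have : h = k := Fin.ext he
          subst this
          simp [Finset.piecewise, hge, hkm]
        · have : m + 1 ≤ h ↔ m ≤ h := by omega
          simp only [this]
      · rw [hpush]; simp [hψr 12, h7]
      · rw [hpush]; simpa [e2] using h8
      · simp [e2]
        exact h9 i' j' hi' hj'
  · rintro τ ⟨hm, h1, h2, h3, h4, h5, -⟩
    rw [h5]; exact Nat.not_lt_zero _
  · refine ⟨le_rfl, ?_, by simp [hi], by simp [hj], by simp [hj, hE.r4], by simp [hE.r1, hE.r3],
      fun h => ?_, ?_, ?_, by simp⟩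
    · exact (((SameBelow.refl _ _).setReg (by norm_num)).setReg (by norm_num)).setReg (by norm_num)
    · rw [if_neg (by omega)]
      simpa using hx h
    · rw [pushBlocksFrom_length]; simpa using hK
    · rw [pushBlocksFrom_length]; simpa using hstack
  · rintro τ ⟨hm, h1, h2, h3, h4, h5, h6, h7, h8, h9⟩
    rw [pushBlocksFrom_zero] at h7 h8
    exact ⟨hE.congr h1 fun i j hi hi' => h9 i j hi (by omega), fun h => by simpa using h6 h, h7, h8⟩

end Specs

/-! ### The invariant of the process and the cost of the main loop -/

section Specs

variable {n l b t num Q : ℕ} {G : SimpleGraph (Fin n)} {blk : Fin n → Fin l}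
  {ve : Fin l → Fin b → Fin n} {σ τ : Store}

open Classical in
/-- Outside the blocks that have to be inspected all degrees are less than `t`. -/
def CleanOutside (G : SimpleGraph (Fin n)) (ve : Fin l → Fin b → Fin n) (t : ℕ)
    (x : Fin l → Fin b) (K : List (Fin l)) : Prop :=
  ∀ j ∉ K, (Finset.univ.filter fun h => h ∉ K ∧ SelAdj G ve x j h).card < t

/-- Removing `i` from the stack affects only `i` and its selected neighbours, and for these the
absence of a bad centre bounds the full degree. -/
theorem CleanOutside.pop {x : Fin l → Fin b} {i : Fin l} {K : List (Fin l)}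
    (h : CleanOutside G ve t x (i :: K)) (hi : badCentre G ve t x i = none) :
    CleanOutside G ve t x K := by
  classical
  intro j hj
  have hnb := not_isBadCentre_of_badCentre G ve hi j
  unfold IsBadCentre at hnb
  by_cases h1 : j = i ∨ SelAdj G ve x j i
  · have h2 : selDegree G ve x j < t := by
      by_contra! h2
      exact hnb ⟨h1, h2⟩
    refine lt_of_le_of_lt (Finset.card_le_card fun h => ?_) h2
    simp only [Finset.mem_filter, Finset.mem_univ, true_and]
    exact fun h => h.2
  · push Not at h1
    refine lt_of_le_of_lt (Finset.card_le_card fun k => ?_) (h j (by simp [h1.1, hj]))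
    simp only [Finset.mem_filter, Finset.mem_univ, true_and, List.mem_cons, not_or]
    rintro ⟨h3, h4⟩
    refine ⟨⟨?_, h3⟩, h4⟩
    rintro rfl
    exact h1.2 h4

theorem mem_pushBlocks {Y : Finset (Fin l)} {K : List (Fin l)} {h : Fin l} :
    h ∈ pushBlocks Y K ↔ h ∈ Y ∨ h ∈ K := by
  simp [pushBlocks]

/-- Because `i ∈ Y`, a block off the new stack was already off the old one, and its vertex has not
changed; so the counts can only drop. -/
theorem CleanOutside.push {x S : Fin l → Fin b} {i : Fin l} {K : List (Fin l)}
    (h : CleanOutside G ve t x (i :: K)) {Y : Finset (Fin l)} (hi : i ∈ Y) :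
    CleanOutside G ve t (Y.piecewise S x) (pushBlocks Y K) := by
  classical
  have hsub : ∀ k, k ∉ pushBlocks Y K → k ∉ i :: K ∧ Y.piecewise S x k = x k := by
    intro k hk
    rw [mem_pushBlocks, not_or] at hk
    refine ⟨?_, Finset.piecewise_eq_of_notMem _ _ _ hk.1⟩
    rw [List.mem_cons, not_or]
    exact ⟨fun e => hk.1 (e ▸ hi), hk.2⟩
  intro j hj
  refine lt_of_le_of_lt (Finset.card_le_card fun k => ?_) (h j (hsub j hj).1)
  rw [Finset.mem_filter, Finset.mem_filter]
  rintro ⟨h0, h1, h2⟩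
  unfold SelAdj at h2 ⊢
  rw [(hsub k h1).2, (hsub j hj).2] at h2
  exact ⟨h0, (hsub k h1).1, h2⟩

/-- The store represents the selection `x` and the stack `K`. -/
structure Represents (G : SimpleGraph (Fin n)) (blk : Fin n → Fin l) (ve : Fin l → Fin b → Fin n)
    (t num Q : ℕ) (x : Fin l → Fin b) (K : List (Fin l)) (σ : Store) : Prop where
  env : Env G blk b t num Q σ
  sel : SelStored ve x σ
  length : σ.reg 12 = K.length
  stack : OnStack (σ.mem (n + 2)) K
  clean : CleanOutside G ve t x K

/-- One iteration simulates one round of the process in at most `C` steps. Fresh vertices and coins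
are drawn for every block, so that the draws are the uniform `S` and `κ` of `survival`; only those
of marked blocks matter. -/
theorem ert_mainLoop_le [Nonempty (Fin b)] [Nonempty (Fin Q)] (hve : BlockEnum blk ve)
    {f : Store → ℝ≥0∞}
    (hf : ∀ x τ, Represents G blk ve t num Q x [] τ → f τ = 0) {x : Fin l → Fin b}
    {K : List (Fin l)} (hσ : Represents G blk ve t num Q x K σ) :
    ert mainLoop f σ ≤
      (l * (8 * l + 16 * n + 112) + 50 : ℕ) * expectedRounds Q t num G ve x K + 1 := by
  classical
  set C : ℕ := l * (8 * l + 16 * n + 112) + 50 with hC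
  -- The infimum over all representations is defined on every store, and is `∞` on stores that
  -- represent nothing; the invariant therefore has to be checked on represented stores only.
  set J : Store → ℝ≥0∞ := fun σ => ⨅ (x) (K) (_ : Represents G blk ve t num Q x K σ),
    ((C : ℝ≥0∞) * expectedRounds Q t num G ve x K + 1) with hJ
  have hJle : ∀ x K σ, Represents G blk ve t num Q x K σ →
      J σ ≤ (C : ℝ≥0∞) * expectedRounds Q t num G ve x K + 1 :=
    fun x K σ h => iInf_le_of_le x (iInf_le_of_le K (iInf_le_of_le h le_rfl))
  refine le_trans (ert_loop_le_of_invariant (J := J) ?_ σ) (hJle x K σ hσ)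
  clear hσ K x
  intro σ
  refine le_iInf fun x => le_iInf fun K => le_iInf fun hσ => ?_
  obtain ⟨hE, hx, hlen, hst, hcl⟩ := hσ
  cases K with
  | nil =>
    rw [if_neg (by rw [hE.r3, hlen]; simp), hf x σ ⟨hE, hx, hlen, hst, hcl⟩, add_zero]
    exact le_add_self
  | cons i K =>
    rw [if_pos (by rw [hE.r3, hlen]; simp)]
    simp only [ert]
    set υ := ((σ.setReg 12 (σ.reg 12 - σ.reg 4)).setReg 13 _).setReg 14 _ with hυ
    have hυr : ∀ r < 12, υ.reg r = σ.reg r :=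
      (((SameBelow.refl 12 σ).setReg (by norm_num)).setReg (by norm_num)).setReg (by norm_num)
    have hυm : υ.mem = σ.mem := by simp [hυ]
    have h12 : υ.reg 12 = K.length := by simp [hυ, hlen, hE.r4]
    have hsti : σ.mem (n + 2) K.length = i := hst.1
    have h14 : υ.reg 14 = ve i (x i) := by
      simp [hυ, hlen, hE.r4, hE.r5, hsti]
      exact hx i
    clear_value υ
    have hEυ : Env G blk b t num Q υ := hE.congr hυr (by simp [hυm])
    have hxυ : SelStored ve x υ := fun h => by rw [hυm]; exact hx h
    have hkey : ert (seq findCentre (cond 3 15 (seq (fillVertices 6) <| seq fillCoins updateBlocks)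
        skip)) J υ ≤ (C - 8 : ℕ) + ((C : ℝ≥0∞) *
          (expectedRounds Q t num G ve x (i :: K) - 1) + 1) := by
      refine ((ensures_findCentre hEυ hve hxυ i h14).ert_seq_le
        (B := (C - 8 - (l * (l * 8 + 40) + 6) : ℕ) + ((C : ℝ≥0∞) *
          (expectedRounds Q t num G ve x (i :: K) - 1) + 1)) ?_).trans ?_
      swap
      · rw [← add_assoc, ← Nat.cast_add]
        gcongr
        rw [hC]
        have : l * (l * 8 + 40) + 6 ≤ l * (8 * l + 16 * n + 112) + 50 - 8 := by
          have : l * (l * 8 + 40) ≤ l * (8 * l + 16 * n + 112) :=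
            Nat.mul_le_mul_left _ (by omega)
          omega
        omega
      rintro τ ⟨g1, g2, g3⟩
      have hEτ : Env G blk b t num Q τ := hEυ.congr
        (fun r hr => g1 r (by omega) (by omega) (by omega)) (by simp [g2])
      have hxτ : SelStored ve x τ := fun h => by rw [g2]; exact hxυ h
      have hτ12 : τ.reg 12 = K.length := by
        rw [g1 12 (by norm_num) (by norm_num) (by norm_num), h12]
      have hstτ : OnStack (τ.mem (n + 2)) K := by rw [g2, hυm]; exact hst.2
      have hτ14 : τ.reg 14 = ve i (x i) := by
        rw [g1 14 (by norm_num) (by norm_num) (by norm_num), h14]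
      have hCle : l * (16 * n + 72) + 20 ≤ C - 8 - (l * (l * 8 + 40) + 6) := by
        have : C = l * (16 * n + 72) + (l * (l * 8 + 40)) + 50 := by rw [hC]; ring
        omega
      rcases g3 with ⟨h15, hnone⟩ | ⟨h15, j, hsome, h16⟩
      · rw [expectedRounds_cons_of_none hnone,
          ENNReal.add_sub_cancel_left ENNReal.one_ne_top]
        simp only [ert, hEτ.r3, h15, lt_irrefl, if_false, skip]
        have hrep : Represents G blk ve t num Q x K (τ.setReg 39 0) :=
          ⟨hEτ.congr ((SameBelow.refl _ _).setReg (by norm_num)) (by simp),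
            fun h => by simpa using hxτ h, by simpa using hτ12, by simpa using hstτ,
            hcl.pop hnone⟩
        calc _ ≤ 1 + (1 + ((C : ℝ≥0∞) * expectedRounds Q t num G ve x K + 1)) := by
              gcongr
              exact hJle _ _ _ hrep
          _ = ((2 : ℕ) : ℝ≥0∞) + ((C : ℝ≥0∞) * expectedRounds Q t num G ve x K + 1) := by
              push_cast; ring
          _ ≤ _ := by gcongr; omega
      · rw [expectedRounds_cons_of_some hsome,
          ENNReal.add_sub_cancel_left ENNReal.one_ne_top]
        rw [ert, if_pos (by rw [hEτ.r3, h15]; norm_num)]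
        have h1 := (ensuresUnif_fillVertices (row := 6) (by norm_num)
          (Or.inr (by rw [hEτ.r6]; omega)) hEτ hve).ert_seq_le
          (q := seq fillCoins updateBlocks) (f := J)
          (B := fun S => ((l * 8 + 3 + 1 : ℕ) : ℝ≥0∞) + (((l * 48 + 7 + 1 : ℕ) : ℝ≥0∞) +
            (C : ℝ≥0∞) * average fun κ : Fin l → Fin Q =>
              expectedRounds Q t num G ve ((marks G ve num x i j κ).piecewise S x)
                (pushBlocks (marks G ve num x i j κ) K))) ?_
        · refine (add_le_add_right h1 1).trans ?_
          rw [average_const_add, average_const_add, average_mul_left]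
          calc _ = ((l * (16 * n + 72) + 17 : ℕ) : ℝ≥0∞) + C * average fun S : Fin l → Fin b =>
                average fun κ : Fin l → Fin Q =>
              expectedRounds Q t num G ve ((marks G ve num x i j κ).piecewise S x)
                (pushBlocks (marks G ve num x i j κ) K) := by push_cast; ring
            _ ≤ _ := by
                refine add_le_add ?_ le_self_add
                exact_mod_cast (by omega : l * (16 * n + 72) + 17 ≤ C - 8 - (l * (l * 8 + 40) + 6))
        · rintro S ω ⟨e1, e2, e3⟩
          have hEω : Env G blk b t num Q ω := hEτ.congr (e1.mono (by norm_num)) (by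
            intro i' j' hi' hj'
            exact e3 i' j' (by rw [hEτ.r6]; omega))
          rw [hEτ.r6] at e2 e3
          refine ((ensuresUnif_fillCoins hEω).ert_seq_le (B := fun κ => ((l * 48 + 7 : ℕ) : ℝ≥0∞) +
            (1 + (C : ℝ≥0∞) *
              expectedRounds Q t num G ve ((marks G ve num x i j κ).piecewise S x)
                (pushBlocks (marks G ve num x i j κ) K))) ?_).trans ?_
          · rintro κ ψ ⟨d1, d2, d3⟩
            have hEψ : Env G blk b t num Q ψ := hEω.congr (d1.mono (by norm_num)) (by
              intro i' j' hi' hj'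
              exact d3 i' j' (by omega))
            have hxψ : SelStored ve x ψ := fun h => by
              rw [d3 _ _ (by omega), e3 _ _ (by omega)]; exact hxτ h
            refine ensures_updateBlocks (S := S) (κ := κ) (K := K) hEψ hve hxψ (i := i) (j := j)
              ?_ ?_ ?_ ?_ ?_ d2 J _ ?_
            · rw [d1 14 (by norm_num), e1 14 (by norm_num), hτ14]
            · rw [d1 16 (by norm_num), e1 16 (by norm_num), h16]
            · rw [d1 12 (by norm_num), e1 12 (by norm_num), hτ12]
            · refine hstτ.congr fun p _ => ?_
              rw [d3 _ _ (by omega), e3 _ _ (by omega)]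
            · intro h
              rw [d3 _ _ (by omega), e2 h]
            · rintro φ ⟨k1, k2, k3, k4⟩
              rw [add_comm (1 : ℝ≥0∞)]
              exact hJle _ _ _ ⟨k1, k2, k3, k4, hcl.push (by simp [marks])⟩
          · rw [average_const_add, average_const_add, average_mul_left]
            apply le_of_eq
            push_cast
            ring
    -- Seven units: the loop test, and the three popping instructions with their three `seq`s.
    calc _ ≤ 1 + (1 + (1 + (1 + (1 + (1 + (1 + ((C - 8 : ℕ) + ((C : ℝ≥0∞) *
          (expectedRounds Q t num G ve x (i :: K) - 1) + 1))))))))  := by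
          have := hkey
          simp only [ert] at this
          gcongr
      _ ≤ (C : ℝ≥0∞) * (1 + (expectedRounds Q t num G ve x (i :: K) - 1)) + 1 := by
          rw [mul_add, mul_one]
          have h7 : ((C - 8 : ℕ) : ℝ≥0∞) + 7 ≤ C := by
            exact_mod_cast (by omega : C - 8 + 7 ≤ C)
          calc _ = ((C - 8 : ℕ) : ℝ≥0∞) + 7 + C *
                (expectedRounds Q t num G ve x (i :: K) - 1) + 1 := by ring
            _ ≤ _ := by gcongr
      _ = _ := by
          -- On a nonempty stack there is at least one round, so the truncated subtraction is exact.
          rw [add_tsub_cancel_of_le]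
          cases hbc : badCentre G ve t x i with
          | none => rw [expectedRounds_cons_of_none hbc]; exact le_self_add
          | some j => rw [expectedRounds_cons_of_some hbc]; exact le_self_add

end Specs

/-! ### Computing the block size and the bias of the coins -/

section Specs

variable {n l b : ℕ} {G : SimpleGraph (Fin n)} {blk : Fin n → Fin l} {σ τ : Store}

/-- The block size is not part of the input: it is the number of times `l` has to be added to reach
`n`. If there are no blocks the counting loop does not start and `R_8 = 0`, which stands for `b =
1`. -/
theorem ensures_initConstants {s : ℕ} (hn : n = l * b) (hl : 0 < l ∨ b = 1) (hb : 0 < b)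
    (h0 : σ.reg 0 = n) (h1 : σ.reg 1 = l) (h2 : σ.reg 2 = s) (hz : ∀ r, 3 ≤ r → σ.reg r = 0) :
    Ensures initConstants σ (n * 4 + 20) fun τ => τ.mem = σ.mem ∧ τ.reg 0 = n ∧ τ.reg 1 = l ∧
      τ.reg 2 = s ∧ τ.reg 3 = 0 ∧ τ.reg 4 = 1 ∧ τ.reg 5 = n + 2 ∧ τ.reg 6 = n + 3 ∧
      τ.reg 7 = n + 4 ∧ τ.reg 8 + 1 = b ∧ τ.reg 9 = s - 1 ∧ τ.reg 12 = 0 := by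
  refine Ensures.const_seq (T := n * 4 + 18) (Ensures.add_seq (T := n * 4 + 16)
    (Ensures.add_seq (T := n * 4 + 14) (Ensures.add_seq (T := n * 4 + 12)
      (Ensures.add_seq (T := n * 4 + 10) (Ensures.sub_seq (T := n * 4 + 8) ?_)))))
  set υ := ((((((σ.setReg 4 1).setReg 5 _).setReg 5 _).setReg 6 _).setReg 7 _).setReg 9 _) with hυ
  have hυm : υ.mem = σ.mem := by simp [hυ]
  have hυ0 : υ.reg 0 = n := by simp [hυ, h0]
  have hυ1 : υ.reg 1 = l := by simp [hυ, h1]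
  have hυ2 : υ.reg 2 = s := by simp [hυ, h2]
  have hυ3 : υ.reg 3 = 0 := by simp [hυ, hz]
  have hυ4 : υ.reg 4 = 1 := by simp [hυ]
  have hυ5 : υ.reg 5 = n + 2 := by simp [hυ, h0]
  have hυ6 : υ.reg 6 = n + 3 := by simp [hυ, h0]
  have hυ7 : υ.reg 7 = n + 4 := by simp [hυ, h0]
  have hυ8 : υ.reg 8 = 0 := by simp [hυ, hz]
  have hυ9 : υ.reg 9 = s - 1 := by simp [hυ, h2]
  have hυ12 : υ.reg 12 = 0 := by simp [hυ, hz]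
  have hυ20 : υ.reg 20 = 0 := by simp [hυ, hz]
  clear_value υ
  have hlb : ∀ m : ℕ, m * l < n ↔ (0 < l ∧ m < b) := by
    intro m
    rw [hn, mul_comm l b]
    constructor
    · intro h
      have : 0 < l := by
        by_contra h0
        simp [show l = 0 by omega] at h
      exact ⟨this, lt_of_mul_lt_mul_right h (Nat.zero_le _)⟩
    · rintro ⟨h3, h4⟩
      exact Nat.mul_lt_mul_of_pos_right h4 h3
  set N := if 0 < l then b else 0 with hN
  have hNn : N ≤ n := by
    rw [hN, hn]
    split_ifs with h
    · exact Nat.le_mul_of_pos_left b h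
    · exact Nat.zero_le _
  have hN8 : N - 1 + 1 = b := by
    rw [hN]
    split_ifs with h
    · omega
    · rcases hl with hl | hl <;> omega
  have hkeep : ∀ ω : Store, ((∀ r < 20, r ≠ 8 → ω.reg r = υ.reg r) ∧ ω.mem = σ.mem) →
      ω.reg 8 = N - 1 → ω.mem = σ.mem ∧ ω.reg 0 = n ∧ ω.reg 1 = l ∧
      ω.reg 2 = s ∧ ω.reg 3 = 0 ∧ ω.reg 4 = 1 ∧ ω.reg 5 = n + 2 ∧ ω.reg 6 = n + 3 ∧
      ω.reg 7 = n + 4 ∧ ω.reg 8 + 1 = b ∧ ω.reg 9 = s - 1 ∧ ω.reg 12 = 0 := by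
    rintro ω ⟨e1, e2⟩ e8
    refine ⟨e2, ?_, ?_, ?_, ?_, ?_, ?_, ?_, ?_, by rw [e8]; exact hN8, ?_, ?_⟩ <;>
      rw [e1 _ (by norm_num) (by norm_num)] <;> assumption
  refine Ensures.seq' (T₁ := N * 4 + 1) (T₂ := 1) (Q₁ := fun ω =>
    ((∀ r < 20, r ≠ 8 → ω.reg r = υ.reg r) ∧ ω.mem = σ.mem) ∧ ω.reg 20 = N * l ∧ ω.reg 8 = N) ?_ ?_
      (by omega)
  · refine Ensures.loop_up (T := 3) (fun m ω =>
      ((∀ r < 20, r ≠ 8 → ω.reg r = υ.reg r) ∧ ω.mem = σ.mem) ∧ ω.reg 20 = m * l ∧ ω.reg 8 = m)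
      ?_ ?_ ?_
    · rintro m hm ω ⟨⟨e1, e2⟩, e3, e4⟩
      have hw0 : ω.reg 0 = n := by rw [e1 0 (by norm_num) (by norm_num), hυ0]
      have hw1 : ω.reg 1 = l := by rw [e1 1 (by norm_num) (by norm_num), hυ1]
      have hw4 : ω.reg 4 = 1 := by rw [e1 4 (by norm_num) (by norm_num), hυ4]
      refine ⟨?_, ?_⟩
      · rw [hw0, e3, hlb]
        rw [hN] at hm
        split_ifs at hm with h
        · exact ⟨h, hm⟩
        · omega
      · refine Ensures.add_seq (T := 1) (Ensures.add (T := 0) ⟨⟨?_, by simpa using e2⟩, ?_, ?_⟩)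
        · intro r hr hr'
          simp only [Store.setReg_reg]
          rw [if_neg hr', if_neg (by omega), e1 r hr hr']
        · simp [e3, hw1]; ring
        · simp [e4, hw4]
    · rintro ω ⟨⟨e1, e2⟩, e3, e4⟩
      rw [e1 0 (by norm_num) (by norm_num), hυ0, e3, hlb, hN]
      split_ifs with h <;> simp [h]
    · exact ⟨⟨fun _ _ _ => rfl, hυm⟩, by simp [hυ20], hυ8⟩
  · rintro ω ⟨⟨e1, e2⟩, e3, e4⟩
    refine Ensures.sub (T := 0) (hkeep _ ⟨?_, by simpa using e2⟩ ?_)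
    · intro r hr hr'
      rw [Store.setReg_reg, if_neg hr', e1 r hr hr']
    · simp [e4, e1 4, hυ4]

/-- Without multiplication, the logarithm `L` is found by doubling, and the multiples `(m + 1) ^ 2 *
L` by adding the odd multiples `(2 * m + 3) * L`. -/
theorem ensures_chooseCoin {s : ℕ} (hs : 3 ≤ s) (h2 : σ.reg 2 = s)
    (h3 : σ.reg 3 = 0) (h4 : σ.reg 4 = 1) (h9 : σ.reg 9 = s - 1) :
    Ensures chooseCoin σ (s * 14 + 30) fun τ => τ.mem = σ.mem ∧
      (∀ r < 20, r ≠ 10 → r ≠ 11 → τ.reg r = σ.reg r) ∧ τ.reg 10 = 1 ∧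
      τ.reg 11 = Nat.sqrt ((s - 1) / Nat.clog 2 (s - 1)) - 1 := by
  set L := Nat.clog 2 (s - 1) with hL
  have hLpos : 0 < L := Nat.clog_pos (by norm_num) (by omega)
  have hLs : L ≤ s := by
    rw [hL]
    refine Nat.clog_le_of_le_pow ?_
    exact (Nat.sub_le s 1).trans (Nat.lt_two_pow_self).le
  set q := Nat.sqrt ((s - 1) / L) with hq
  have hqs : q ≤ s := (Nat.sqrt_le_self _).trans ((Nat.div_le_self _ _).trans (Nat.sub_le _ _))
  -- The strict comparison with `s` in the loop is the comparison `≤ s - 1` that defines the integer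
  -- square root.
  have hqlt : ∀ m : ℕ, (m + 1) * (m + 1) * L < s ↔ m < q := by
    intro m
    rw [hq, Nat.lt_iff_add_one_le, Nat.lt_iff_add_one_le, Nat.le_sqrt,
      Nat.le_div_iff_mul_le hLpos]
    omega
  refine Ensures.const_seq (T := s * 14 + 28) (Ensures.const_seq (T := s * 14 + 26)
    (Ensures.const_seq (T := s * 14 + 24) ?_))
  refine Ensures.seq' (T₁ := L * 4 + 1) (T₂ := s * 10 + 20) (Q₁ := fun ω =>
    (∀ r < 20, r ≠ 10 → r ≠ 11 → ω.reg r = σ.reg r) ∧ ω.mem = σ.mem ∧ ω.reg 10 = 1 ∧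
      ω.reg 20 = 2 ^ L ∧ ω.reg 21 = L) ?_ ?_ (by omega)
  · refine Ensures.loop_up (T := 3) (fun m ω =>
      (∀ r < 20, r ≠ 10 → r ≠ 11 → ω.reg r = σ.reg r) ∧ ω.mem = σ.mem ∧ ω.reg 10 = 1 ∧
      ω.reg 20 = 2 ^ m ∧ ω.reg 21 = m) ?_ ?_ ?_
    · rintro m hm ω ⟨e1, e2, e3, e4, e5⟩
      refine ⟨?_, Ensures.add_seq (T := 1) (Ensures.add (T := 0) ⟨?_, by simpa using e2,
        by simpa using e3, ?_, ?_⟩)⟩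
      · rw [e4, e1 9 (by norm_num) (by norm_num) (by norm_num), h9]
        exact (Nat.lt_clog_iff_pow_lt (by norm_num)).1 hm
      · intro r hr ha hb
        simp only [Store.setReg_reg]
        rw [if_neg (by omega), if_neg (by omega), e1 r hr ha hb]
      · simp [e4]; ring
      · simp [e5, e1 4, h4]
    · rintro ω ⟨e1, e2, e3, e4, e5⟩
      rw [e4, e1 9 (by norm_num) (by norm_num) (by norm_num), h9, not_lt]
      exact Nat.le_pow_clog (by norm_num) _
    · refine ⟨?_, by simp, by simp, by simp, by simp⟩
      intro r hr ha hb
      simp only [Store.setReg_reg]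
      rw [if_neg (by omega), if_neg (by omega), if_neg (by omega)]
  rintro ω ⟨e1, e2, e3, e4, e5⟩
  refine Ensures.const_seq (T := s * 10 + 18) (Ensures.add_seq (T := s * 10 + 16)
    (Ensures.add_seq (T := s * 10 + 14) (Ensures.add_seq (T := s * 10 + 12) ?_)))
  have hw3 : ω.reg 3 = 0 := by rw [e1 3 (by norm_num) (by norm_num) (by norm_num), h3]
  refine Ensures.seq' (T₁ := q * 8 + 1) (T₂ := 1) (Q₁ := fun ψ =>
    (∀ r < 20, r ≠ 10 → r ≠ 11 → ψ.reg r = σ.reg r) ∧ ψ.mem = σ.mem ∧ ψ.reg 10 = 1 ∧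
      ψ.reg 21 = L ∧ ψ.reg 11 = q ∧ ψ.reg 22 = (q + 1) * (q + 1) * L ∧
        ψ.reg 23 = (2 * q + 3) * L) ?_ ?_ (by omega)
  · refine Ensures.loop_up (T := 7) (fun m ψ =>
      (∀ r < 20, r ≠ 10 → r ≠ 11 → ψ.reg r = σ.reg r) ∧ ψ.mem = σ.mem ∧ ψ.reg 10 = 1 ∧
      ψ.reg 21 = L ∧ ψ.reg 11 = m ∧ ψ.reg 22 = (m + 1) * (m + 1) * L ∧
        ψ.reg 23 = (2 * m + 3) * L) ?_ ?_ ?_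
    · rintro m hm ψ ⟨g1, g2, g3, g4, g5, g6, g7⟩
      refine ⟨?_, Ensures.add_seq (T := 5) (Ensures.add_seq (T := 3) (Ensures.add_seq (T := 1)
        (Ensures.add (T := 0) ⟨?_, by simpa using g2, by simpa using g3, by simpa using g4,
          ?_, ?_, ?_⟩)))⟩
      · rw [g6, g1 2 (by norm_num) (by norm_num) (by norm_num), h2, hqlt]
        exact hm
      · intro r hr ha hb
        simp only [Store.setReg_reg]
        rw [if_neg (by omega), if_neg (by omega), if_neg (by omega), if_neg hb, g1 r hr ha hb]
      · simp [g5, g1 4, h4]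
      · simp [g6, g7]; ring
      · simp [g7, g4]; ring
    · rintro ψ ⟨g1, g2, g3, g4, g5, g6, g7⟩
      rw [g6, g1 2 (by norm_num) (by norm_num) (by norm_num), h2, hqlt]
      exact lt_irrefl _
    · refine ⟨?_, by simpa using e2, by simpa using e3, by simpa using e5, by simp,
        by simp [e5, hw3], by simp [e5]; ring⟩
      intro r hr ha hb
      simp only [Store.setReg_reg]
      rw [if_neg (by omega), if_neg (by omega), if_neg (by omega), if_neg hb, e1 r hr ha hb]
  · rintro ψ ⟨g1, g2, g3, g4, g5, g6, g7⟩
    refine Ensures.sub (T := 0) ⟨by simpa using g2, ?_, by simpa using g3, ?_⟩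
    · intro r hr ha hb
      rw [Store.setReg_reg, if_neg hb, g1 r hr ha hb]
    · simp [g5, g1 4, h4]

/-- The success probability `num / Q` of a coin, as the pair `(num, Q)`. -/
def coinParameters (s₀ Q₀ s : ℕ) : ℕ × ℕ :=
  if s < s₀ then (Q₀, Q₀ + 1) else (1, Nat.sqrt ((s - 1) / Nat.clog 2 (s - 1)) - 1 + 1)

/-- The cost of `chooseCoin` is linear in `s`, so it is run only if `s ≤ n`. For `n < s` no block
will be pushed and the coins are irrelevant. -/
theorem ensures_chooseParameters {s₀ Q₀ s : ℕ} (hs₀ : 3 ≤ s₀) (h0 : σ.reg 0 = n)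
    (h1 : σ.reg 1 = l) (h2 : σ.reg 2 = s)
    (h3 : σ.reg 3 = 0) (h4 : σ.reg 4 = 1) (h9 : σ.reg 9 = s - 1) :
    Ensures (chooseParameters s₀ Q₀) σ (n * 14 + 40) fun τ => τ.mem = σ.mem ∧
      (∀ r < 18, r ≠ 10 → r ≠ 11 → τ.reg r = σ.reg r) ∧
      τ.reg 18 = (if n < s then 0 else l) ∧
      (s ≤ n → τ.reg 10 = (coinParameters s₀ Q₀ s).1 ∧
        τ.reg 11 + 1 = (coinParameters s₀ Q₀ s).2) := by
  refine Ensures.cond (T := n * 14 + 39) (fun hlt => ?_) fun hge => ?_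
  · rw [h0, h2] at hlt
    refine Ensures.const (T := n * 14 + 38) ⟨rfl, ?_, by simp [hlt], fun h => by omega⟩
    intro r hr ha hb
    rw [Store.setReg_reg, if_neg (by omega)]
  rw [h0, h2, not_lt] at hge
  refine Ensures.add_seq (T := n * 14 + 37) (Ensures.const_seq (T := n * 14 + 35) ?_)
  refine Ensures.cond (T := n * 14 + 34) (fun hlt => ?_) fun hge' => ?_
  · simp [h2] at hlt
    refine Ensures.const_seq (T := n * 14 + 32) (Ensures.const (T := n * 14 + 31)
      ⟨by simp, ?_, by simp [h1, h3, hge], fun _ => by simp [coinParameters, hlt]⟩)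
    intro r hr ha hb
    simp only [Store.setReg_reg]
    rw [if_neg hb, if_neg ha, if_neg (by omega), if_neg (by omega)]
  · simp [h2] at hge'
    refine (ensures_chooseCoin (s := s) (by omega) (by simpa using h2) (by simpa using h3)
      (by simpa using h4) (by simpa using h9)).mono (by omega) ?_
    rintro τ ⟨e1, e2, e3, e4⟩
    refine ⟨by simpa using e1, ?_, ?_, fun _ => ?_⟩
    · intro r hr ha hb
      rw [e2 r (by omega) ha hb]
      simp only [Store.setReg_reg]
      rw [if_neg (by omega), if_neg (by omega)]
    · rw [e2 18 (by norm_num) (by norm_num) (by norm_num)]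
      simp [h1, h3, hge]
    · rw [e3, e4]
      rw [coinParameters, if_neg (by omega)]
      exact ⟨rfl, rfl⟩

end Specs

/-! ### Correctness of the output and the total cost -/

section Specs

variable {n l b : ℕ} {G : SimpleGraph (Fin n)} {blk : Fin n → Fin l} {σ τ : Store}

theorem count_block (hblk : BlocksHaveSize blk b) (h : Fin l) :
    Nat.count (fun v => ∃ hv : v < n, blk ⟨v, hv⟩ = h) n = b := by
  classical
  rw [← hblk h, Set.ncard_eq_toFinset_card', Nat.count_eq_card_filter_range]
  symm
  refine Finset.card_bij (fun v _ => (v : ℕ)) ?_ ?_ ?_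
  · intro v hv
    simp only [Set.mem_toFinset, Set.mem_ofPred_eq] at hv
    simp only [Finset.mem_filter, Finset.mem_range]
    exact ⟨v.2, v.2, hv⟩
  · intro v _ w _ h
    exact Fin.ext h
  · intro v hv
    simp only [Finset.mem_filter, Finset.mem_range] at hv
    obtain ⟨h1, h2, h3⟩ := hv
    exact ⟨⟨v, h1⟩, by simpa using h3, rfl⟩

theorem exists_blockEnum (hblk : BlocksHaveSize blk b) :
    ∃ ve : Fin l → Fin b → Fin n, BlockEnum blk ve := by
  set p : Fin l → ℕ → Prop := fun h v => ∃ hv : v < n, blk ⟨v, hv⟩ = h with hp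
  have hc : ∀ h, Nat.count (p h) n = b := count_block hblk
  have hlt : ∀ (h : Fin l) (a : Fin b), ∀ hf : (Set.ofPred (p h)).Finite,
      (a : ℕ) < hf.toFinset.card := by
    intro h a hf
    refine lt_of_lt_of_le a.2 ?_
    rw [← hc h, Nat.count_eq_card_filter_range]
    refine Finset.card_le_card fun v hv => ?_
    rw [Set.Finite.mem_toFinset]
    exact (Finset.mem_filter.1 hv).2
  have hmem : ∀ h (a : Fin b), p h (Nat.nth (p h) a) := fun h a => Nat.nth_mem _ (hlt h a)
  refine ⟨fun h a => ⟨Nat.nth (p h) a, (hmem h a).1⟩, fun h a => (hmem h a).2, fun h a => rfl,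
    fun h a a' haa' => ?_, hc⟩
  have h1 := congrArg Fin.val haa'
  simp only at h1
  have h2 := Nat.count_nth (hlt h a)
  rw [h1, Nat.count_nth (hlt h a')] at h2
  exact Fin.ext h2.symm

theorem card_eq_mul (hblk : BlocksHaveSize blk b) : n = l * b := by
  classical
  have h1 := Finset.card_eq_sum_card_fiberwise (f := blk) (s := Finset.univ) (t := Finset.univ)
    (fun _ _ => Finset.mem_univ _)
  rw [Finset.card_univ, Fintype.card_fin] at h1
  rw [h1]
  calc _ = ∑ i : Fin l, b := by
        refine Finset.sum_congr rfl fun i _ => ?_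
        rw [← hblk i, Set.ncard_eq_toFinset_card']
        congr 1
        ext; simp
    _ = _ := by simp

variable {ve : Fin l → Fin b → Fin n}

open Classical in
theorem sum_card_adj_le [DecidableRel G.Adj] (hve : BlockEnum blk ve) (v : Fin n) :
    ∑ h, (Finset.univ.filter fun c => G.Adj v (ve h c)).card ≤ G.maxDegree := by
  refine le_trans ?_ (G.degree_le_maxDegree v)
  rw [← Finset.card_sigma, ← SimpleGraph.card_neighborFinset_eq_degree]
  refine Finset.card_le_card_of_injOn (fun q => ve q.1 q.2) ?_ ?_
  · rintro ⟨h, c⟩ hc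
    simpa using hc
  · rintro ⟨h, c⟩ _ ⟨h', c'⟩ _ he
    simp only at he
    have h1 := congrArg blk he
    rw [hve.blk_eq, hve.blk_eq] at h1
    subst h1
    rw [hve.inj h he]

theorem isGoodTransversal_of_represents {s num Q : ℕ} (hs : 2 ≤ s) (hve : BlockEnum blk ve)
    {x : Fin l → Fin b} (h : Represents G blk ve (s - 1) num Q x [] τ) :
    IsGoodTransversal G blk s (outputSet n l τ) := by
  classical
  have hT : ∀ v, v ∈ outputSet n l τ ↔ ∃ j, v = ve j (x j) := by
    intro v
    simp only [outputSet, Set.mem_ofPred_eq]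
    constructor
    · rintro ⟨i, hi, he⟩
      exact ⟨⟨i, hi⟩, Fin.ext (he.symm.trans (h.sel ⟨i, hi⟩))⟩
    · rintro ⟨j, rfl⟩
      exact ⟨j, j.2, h.sel j⟩
  have hdeg : ∀ j, (Finset.univ.filter fun v => v ∈ outputSet n l τ ∧
      G.Adj (ve j (x j)) v).card < s - 1 := by
    intro j
    refine lt_of_le_of_lt ?_ (h.clean j (by simp))
    refine le_trans (Finset.card_le_card (t := (Finset.univ.filter fun h =>
      h ∉ ([] : List (Fin l)) ∧ SelAdj G ve x j h).image fun h => ve h (x h)) ?_)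
        Finset.card_image_le
    intro v hv
    simp only [Finset.mem_filter, Finset.mem_univ, true_and] at hv
    obtain ⟨k, rfl⟩ := (hT v).1 hv.1
    refine Finset.mem_image_of_mem (fun h => ve h (x h)) ?_
    rw [Finset.mem_filter]
    exact ⟨Finset.mem_univ _, by simp, hv.2⟩
  refine ⟨fun i => ⟨ve i (x i), ⟨(hT _).2 ⟨i, rfl⟩, hve.blk_eq _ _⟩, ?_⟩, fun v hv => ?_, ?_⟩
  · rintro v ⟨hv, hb⟩
    obtain ⟨j, rfl⟩ := (hT v).1 hv
    rw [hve.blk_eq] at hb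
    rw [hb]
  · obtain ⟨j, rfl⟩ := (hT v).1 hv
    have h1 := hdeg j
    have h2 : (G.neighborSet (ve j (x j)) ∩ outputSet n l τ).ncard =
        (Finset.univ.filter fun v => v ∈ outputSet n l τ ∧ G.Adj (ve j (x j)) v).card := by
      rw [← Set.ncard_coe_finset]
      congr 1
      ext w
      simp [and_comm]
    omega
  · intro A hA hcl
    have hne : A.Nonempty := by
      rw [← Finset.card_pos, hcl.card_eq]
      omega
    obtain ⟨v, hv⟩ := hne
    obtain ⟨j, rfl⟩ := (hT v).1 (hA hv)
    have h1 := hdeg j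
    have h2 : A.erase (ve j (x j)) ⊆ Finset.univ.filter fun v => v ∈ outputSet n l τ ∧
        G.Adj (ve j (x j)) v := by
      intro w hw
      rw [Finset.mem_erase] at hw
      simp only [Finset.mem_filter, Finset.mem_univ, true_and]
      exact ⟨hA hw.2, hcl.isClique hv hw.2 (Ne.symm hw.1)⟩
    have h3 := Finset.card_le_card h2
    rw [Finset.card_erase_of_mem hv, hcl.card_eq] at h3
    omega

/-- The list of the blocks `h < N`, in decreasing order. -/
def initialStack (l : ℕ) : ℕ → List (Fin l)
  | 0 => []
  | N + 1 => if h : N < l then ⟨N, h⟩ :: initialStack l N else initialStack l N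

theorem length_initialStack {N : ℕ} (hN : N ≤ l) : (initialStack l N).length = N := by
  induction N with
  | zero => rfl
  | succ N ih =>
    rw [initialStack, dif_pos (by omega), List.length_cons, ih (by omega)]

theorem onStack_initialStack {N : ℕ} (hN : N ≤ l) {f : ℕ → ℕ} (hf : ∀ p < N, f p = p) :
    OnStack f (initialStack l N) := by
  induction N with
  | zero => trivial
  | succ N ih =>
    rw [initialStack, dif_pos (by omega)]
    refine ⟨?_, ih (by omega) fun p hp => hf p (by omega)⟩
    rw [length_initialStack (by omega)]
    exact hf N (by omega)

theorem mem_initialStack {N : ℕ} (hN : N ≤ l) (h : Fin l) (hh : (h : ℕ) < N) :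
    h ∈ initialStack l N := by
  induction N with
  | zero => omega
  | succ N ih =>
    rw [initialStack, dif_pos (by omega), List.mem_cons]
    by_cases he : (h : ℕ) = N
    · exact Or.inl (Fin.ext he)
    · exact Or.inr (ih (by omega) (by omega))

/-- Either every block is on the stack, or there are at most `t` blocks and no selected vertex can
have `t` selected neighbours. -/
theorem cleanOutside_initialStack {t N : ℕ} (hN : N = l ∨ l ≤ t) (x : Fin l → Fin b) :
    CleanOutside G ve t x (initialStack l N) := by
  classical
  intro j hj
  rcases hN with rfl | hlt
  · exact absurd (mem_initialStack le_rfl j j.2) hj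
  · refine lt_of_lt_of_le ?_ hlt
    have hsub : (Finset.univ.filter fun h => h ∉ initialStack l N ∧ SelAdj G ve x j h) ⊆
        Finset.univ.erase j := by
      intro h hh
      rw [Finset.mem_filter] at hh
      rw [Finset.mem_erase]
      refine ⟨?_, Finset.mem_univ _⟩
      rintro rfl
      exact G.loopless.irrefl _ hh.2.2
    refine lt_of_le_of_lt (Finset.card_le_card hsub) ?_
    rw [Finset.card_erase_of_mem (Finset.mem_univ _), Finset.card_univ, Fintype.card_fin]
    have := j.2
    omega

theorem ensures_pushAll {t num Q N : ℕ} (hE : Env G blk b t num Q σ) (h12 : σ.reg 12 = 0)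
    (h18 : σ.reg 18 = N) :
    Ensures pushAll σ (N * 4 + 1) fun τ => SameBelow 12 σ τ ∧ τ.reg 12 = N ∧
      (∀ p < N, τ.mem (n + 2) p = p) ∧ ∀ i j, i ≠ n + 2 → τ.mem i j = σ.mem i j := by
  refine (Ensures.loop_up (T := 3) (N := N) (fun m τ => SameBelow 12 σ τ ∧ τ.reg 12 = m ∧
      (∀ p < m, τ.mem (n + 2) p = p) ∧ (∀ i j, i ≠ n + 2 → τ.mem i j = σ.mem i j) ∧
        τ.reg 18 = N) ?_ ?_ ?_).mono le_rfl ?_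
  · rintro m hm τ ⟨h1, h2, h3, h4, h5⟩
    have hr5 : τ.reg 5 = n + 2 := by rw [h1 5 (by norm_num), hE.r5]
    have hr4 : τ.reg 4 = 1 := by rw [h1 4 (by norm_num), hE.r4]
    refine ⟨by rw [h2, h5]; exact hm, Ensures.store_seq (T := 1) (Ensures.add (T := 0)
      ⟨?_, by simp [h2, hr4], fun p hp => ?_, fun i j hi => ?_, by simpa using h5⟩)⟩
    · intro r hr
      rw [Store.setReg_reg, if_neg (by omega), Store.setMem_reg, h1 r hr]
    · rw [Store.setReg_mem, Store.setMem_mem, hr5, h2]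
      by_cases he : p = m
      · simp [he]
      · simp [he]
        exact h3 p (by omega)
    · rw [Store.setReg_mem, Store.setMem_mem, hr5, if_neg (fun h => hi h.1), h4 i j hi]
  · rintro τ ⟨h1, h2, h3, h4, h5⟩
    rw [h2, h5]
    exact lt_irrefl _
  · exact ⟨SameBelow.refl _ _, h12, fun p hp => absurd hp (by omega), fun _ _ _ => rfl, h18⟩
  · rintro τ ⟨h1, h2, h3, h4, h5⟩
    exact ⟨h1, h2, h3, h4⟩

open Classical in
theorem inputStore_mem_adj (G : SimpleGraph (Fin n)) (blk : Fin n → Fin l) (s : ℕ) (u v : Fin n) :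
    (inputStore G blk s).mem (u + 2) v = if G.Adj u v then 1 else 0 := by
  simp only [inputStore, Nat.add_eq_zero_iff, OfNat.ofNat_ne_zero, and_false, if_false]
  refine if_congr ?_ rfl rfl
  constructor
  · rintro ⟨u', v', h1, h2, h3⟩
    rwa [Fin.ext (by omega : (u : ℕ) = u'), Fin.ext (h2 : (v : ℕ) = v')]
  · intro h
    exact ⟨u, v, rfl, rfl, h⟩

theorem one_add_four_mul_le_pow {d : ℝ} (hd : 0 ≤ d) : 1 + 4 * d ≤ (1 + d) ^ 4 := by
  have := one_add_mul_le_pow (by linarith : (-2 : ℝ) ≤ d) 4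
  push_cast at this
  linarith

set_option maxHeartbeats 800000 in
open Classical in
-- The initial selection is uniform, so the averaged bound on the rounds applies: linearly many
-- rounds of at most quadratic cost dominate everything else.
theorem ert_program_le_of_pos [DecidableRel G.Adj] {s s₀ Q₀ : ℕ} (hs : 2 ≤ s) (hs₀ : 3 ≤ s₀)
    (hb : 0 < b) (hl : 0 < l ∨ b = 1) (hblk : BlocksHaveSize blk b)
    (hnum : (coinParameters s₀ Q₀ s).1 < (coinParameters s₀ Q₀ s).2)
    (hcond : ProcessCondition (s - 1) (coinParameters s₀ Q₀ s).1 (coinParameters s₀ Q₀ s).2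
      (G.maxDegree / b) (1 + 1 / (s - 1 : ℕ)) (1 + 1 / (4 * (s - 1) : ℕ))) :
    ert (program s₀ Q₀) (fun τ => if IsGoodTransversal G blk s (outputSet n l τ) then 0 else ∞)
      (inputStore G blk s) ≤ ((1000 * (n + 1) ^ 3 : ℕ) : ℝ≥0∞) := by
  obtain ⟨ve, hve⟩ := exists_blockEnum hblk
  have hn := card_eq_mul hblk
  have hln : l ≤ n := hn ▸ Nat.le_mul_of_pos_right l hb
  have hbne : Nonempty (Fin b) := ⟨⟨0, hb⟩⟩
  set f : Store → ℝ≥0∞ := fun τ => if IsGoodTransversal G blk s (outputSet n l τ) then 0 else ∞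
    with hf
  set C := l * (8 * l + 16 * n + 112) + 50 with hC
  set N := if n < s then 0 else l with hN
  have hNl : N ≤ l := by rw [hN]; split_ifs <;> omega
  have hinit := ensures_initConstants (σ := inputStore G blk s) (s := s) hn hl hb rfl rfl rfl
    (by
      intro r hr
      show (if r = 0 then n else if r = 1 then l else if r = 2 then s else 0) = 0
      rw [if_neg (by omega), if_neg (by omega), if_neg (by omega)])
  have hbound : (n * 4 + 20 + 1) + ((n * 14 + 40 + 1) + ((l * (16 * n + 16) + 3 + 1) +
      ((N * 4 + 1 + 1) + (C * (8 * n + 1) + 1)))) ≤ 1000 * (n + 1) ^ 3 := by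
    have h1 : C ≤ n * (8 * n + 16 * n + 112) + 50 := by
      rw [hC]
      gcongr
    have h2 : C * (8 * n + 1) ≤ (n * (8 * n + 16 * n + 112) + 50) * (8 * n + 1) := by gcongr
    have h3 : l * (16 * n + 16) ≤ n * (16 * n + 16) := by gcongr
    have h4 : N ≤ n := hNl.trans hln
    nlinarith [Nat.zero_le (n ^ 3), Nat.zero_le (n ^ 2)]
  refine le_trans ?_ (Nat.cast_le.2 hbound)
  rw [Nat.cast_add]
  refine hinit.ert_seq_le ?_
  rintro σ₁ ⟨hm, h0, h1, h2, h3, h4, h5, h6, h7, h8, h9, h12⟩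
  rw [Nat.cast_add]
  refine (ensures_chooseParameters (Q₀ := Q₀) hs₀ h0 h1 h2 h3 h4 h9).ert_seq_le ?_
  rintro σ₂ ⟨g1, g2, g3, g4⟩
  set num := σ₂.reg 10 with hnumdef
  set Q := σ₂.reg 11 + 1 with hQ
  have hQne : Nonempty (Fin Q) := ⟨⟨0, by omega⟩⟩
  have hE : Env G blk b (s - 1) num Q σ₂ := by
    refine ⟨?_, ?_, ?_, ?_, ?_, ?_, ?_, ?_, ?_, rfl, rfl, ?_, ?_⟩
    on_goal 10 => intro v; rw [g1, hm]; simp [inputStore]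
    on_goal 10 => intro u v; rw [g1, hm]; exact inputStore_mem_adj _ _ _ u v
    all_goals rw [g2 _ (by norm_num) (by norm_num) (by norm_num)]; assumption
  have g12 : σ₂.reg 12 = 0 := by rw [g2 _ (by norm_num) (by norm_num) (by norm_num), h12]
  set K := initialStack l N with hK
  have hKlen : K.length = N := length_initialStack hNl
  -- The round bound has a term `m = 4 * (s - 1)`. It is at most `4 * n` unless `n < s`, when the
  -- stack is empty.
  have hrounds : average (fun x : Fin l → Fin b => expectedRounds Q (s - 1) num G ve x K) ≤
      ((8 * n + 1 : ℕ) : ℝ≥0∞) := by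
    by_cases hns : n < s
    · have : K = [] := by rw [hK, hN, if_pos hns]; rfl
      simp [this, expectedRounds_nil, average]
    · obtain ⟨hp1, hp2⟩ := g4 (by omega)
      rw [← hp1, ← hp2] at hnum hcond
      have hs1 : (0 : ℝ) < (s - 1 : ℕ) := by exact_mod_cast (by omega : 0 < s - 1)
      refine (average_expectedRounds_le (Δ := G.maxDegree) (m := 4 * (s - 1)) hb hnum
        (fun j a => by convert sum_card_adj_le hve (ve j a)) (by simp) (by omega) rfl ?_ hcond K).trans ?_
      · push_cast
        set d : ℝ := 1 / (4 * ((s - 1 : ℕ) : ℝ)) with hd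
        have hd0 : 0 < d := by positivity
        have : 1 / ((s - 1 : ℕ) : ℝ) = 4 * d := by rw [hd]; field_simp
        rw [this]
        exact one_add_four_mul_le_pow hd0.le
      · rw [hKlen]
        exact_mod_cast (by omega : 4 * N + 4 * (s - 1) + 1 ≤ 8 * n + 1)
  have hfill := ensuresUnif_fillVertices (row := 4) (by norm_num) (Or.inl hE.r4) hE hve
  rw [hE.r4] at hfill
  rw [Nat.cast_add]
  refine (hfill.ert_seq_le (q := seq pushAll mainLoop) (f := f)
    (B := fun x => ((N * 4 + 1 + 1 : ℕ) : ℝ≥0∞) + (1 + (C : ℝ≥0∞) *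
      expectedRounds Q (s - 1) num G ve x K)) ?_).trans ?_
  · rintro x σ₃ ⟨e1, e2, e3⟩
    have hE3 : Env G blk b (s - 1) num Q σ₃ := hE.congr (e1.mono (by norm_num))
      fun i j hi _ => e3 i j hi
    refine (ensures_pushAll (N := N) hE3 (by rw [e1 12 (by norm_num), g12])
      (by rw [e1 18 (by norm_num), g3])).ert_seq_le ?_
    rintro σ₄ ⟨d1, d2, d3, d4⟩
    rw [add_comm (1 : ℝ≥0∞)]
    refine ert_mainLoop_le hve ?_ ⟨hE3.congr d1 fun i j _ hi => d4 i j (by omega), ?_, ?_, ?_, ?_⟩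
    · intro y υ hυ
      rw [hf]
      exact if_pos (isGoodTransversal_of_represents hs hve hυ)
    · intro h
      rw [d4 _ _ (by omega)]
      exact e2 h
    · rw [d2, hKlen]
    · exact onStack_initialStack hNl d3
    · refine cleanOutside_initialStack ?_ x
      by_cases hns : n < s
      · exact Or.inr (by omega)
      · exact Or.inl (by rw [hN, if_neg hns])
  · rw [average_const_add, average_const_add, average_mul_left]
    calc _ ≤ ((l * (16 * n + 16) + 3 + 1 : ℕ) : ℝ≥0∞) + (((N * 4 + 1 + 1 : ℕ) : ℝ≥0∞) +
          (1 + (C : ℝ≥0∞) * ((8 * n + 1 : ℕ) : ℝ≥0∞))) := by gcongr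
      _ = _ := by push_cast; ring

open Classical in
-- If there are no blocks then `b` is arbitrary, but the graph is empty and its maximum degree `0`;
-- so `b` may be replaced by the value `1` that the program computes.
theorem ert_program_le [DecidableRel G.Adj] {s s₀ Q₀ : ℕ} (hs : 2 ≤ s) (hs₀ : 3 ≤ s₀)
    (hb : 0 < b) (hblk : BlocksHaveSize blk b)
    (hnum : (coinParameters s₀ Q₀ s).1 < (coinParameters s₀ Q₀ s).2)
    (hcond : ProcessCondition (s - 1) (coinParameters s₀ Q₀ s).1 (coinParameters s₀ Q₀ s).2
      (G.maxDegree / b) (1 + 1 / (s - 1 : ℕ)) (1 + 1 / (4 * (s - 1) : ℕ))) :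
    ert (program s₀ Q₀) (fun τ => if IsGoodTransversal G blk s (outputSet n l τ) then 0 else ∞)
      (inputStore G blk s) ≤ ((1000 * (n + 1) ^ 3 : ℕ) : ℝ≥0∞) := by
  rcases Nat.eq_zero_or_pos l with rfl | hl
  · have hn : n = 0 := by rw [card_eq_mul hblk, zero_mul]
    subst hn
    refine ert_program_le_of_pos (b := 1) hs hs₀ one_pos (Or.inr rfl) (fun i => i.elim0) hnum ?_
    have hΔ : G.maxDegree = 0 := G.maxDegree_of_subsingleton
    rw [hΔ] at hcond ⊢
    simpa using hcond
  · exact ert_program_le_of_pos hs hs₀ hb (Or.inl hl) hblk hnum hcond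

end Specs

/-! ### Numerical choice of the parameters -/

section Parameters

/-- The excess `3 / (4 * t + 1)` over `1` is the room left for the resampling term in
`ProcessCondition`. -/
theorem y_div_z {t : ℕ} (ht : 1 ≤ t) :
    (1 + 1 / (t : ℝ)) / (1 + 1 / (4 * t : ℕ)) = 1 + 3 / (4 * t + 1) := by
  have : (0 : ℝ) < t := by exact_mod_cast ht
  push_cast
  field_simp
  ring

/-- Bounded `s`: here `1 - q = a = 1 / (Q₀ + 1)` and `ρ = Q₀`. With `μ ≤ a / 2` the exponential is
at most `3` and the resampling term at most `12 * a`, which the choice `Q₀ = 16 * s₀` makes small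
enough. -/
theorem processCondition_const {s s₀ Q₀ : ℕ} {μ : ℝ} (hs : 2 ≤ s) (hs₀ : s < s₀)
    (hQ₀ : Q₀ = 16 * s₀) (hμ0 : 0 ≤ μ) (hμ : μ * (2 * (Q₀ + 1)) ≤ 1) :
    ProcessCondition (s - 1) Q₀ (Q₀ + 1) μ (1 + 1 / (s - 1 : ℕ))
      (1 + 1 / (4 * (s - 1) : ℕ)) := by
  obtain ⟨t, rfl⟩ : ∃ t, s = t + 1 := ⟨s - 1, by omega⟩
  have ht : 1 ≤ t := by omega
  have htR : (1 : ℝ) ≤ t := by exact_mod_cast ht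
  unfold ProcessCondition
  rw [Nat.add_sub_cancel, y_div_z ht]
  set y : ℝ := 1 + 1 / t with hy
  have hy0 : 0 < y := by positivity
  have hy2 : y ≤ 2 := by
    have : 1 / (t : ℝ) ≤ 1 := by rw [div_le_one (by linarith)]; exact htR
    linarith
  set a : ℝ := 1 / (Q₀ + 1) with ha
  have ha0 : 0 < a := by positivity
  have ha1 : a ≤ 1 := by
    rw [ha, div_le_one (by positivity)]
    linarith [(Nat.cast_nonneg Q₀ : (0 : ℝ) ≤ Q₀)]
  have h1 : 1 - (Q₀ : ℝ) / (Q₀ + 1 : ℕ) = a := by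
    rw [ha]; push_cast; field_simp; ring
  have h2 : (Q₀ : ℝ) / (Q₀ + 1 : ℕ) / a = Q₀ := by
    rw [ha]; push_cast; field_simp
  rw [h1, h2]
  have hμa : 2 * μ ≤ a := by
    rw [ha, le_div_iff₀ (by positivity)]
    linarith
  have he : Real.exp (Q₀ * y * μ) ≤ 3 := by
    have : Q₀ * y * μ ≤ 1 := by
      have : (Q₀ : ℝ) * y * μ ≤ Q₀ * 2 * μ := by gcongr
      nlinarith
    exact (Real.exp_le_exp.2 this).trans (by linarith [Real.exp_one_lt_d9])
  have h3 : a ^ t ≤ a := by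
    simpa using pow_le_pow_of_le_one ha0.le ha1 ht
  have h4 : a ^ (t - 1) ≤ 1 := pow_le_one₀ ha0.le ha1
  have h5 : a ^ t * y + a ^ (t - 1) * y ^ 2 * μ ≤ 4 * a := by
    have e1 : a ^ t * y ≤ a * 2 := by gcongr
    have e2 : a ^ (t - 1) * y ^ 2 * μ ≤ 1 * 2 ^ 2 * μ := by gcongr
    linarith
  have h6 : (a ^ t * y + a ^ (t - 1) * y ^ 2 * μ) * Real.exp (Q₀ * y * μ) ≤ 4 * a * 3 := by
    gcongr
  have h7 : 4 * a * 3 ≤ 3 / (4 * t + 1) := by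
    rw [ha, hQ₀, mul_one_div, div_mul_eq_mul_div, div_le_div_iff₀ (by positivity) (by positivity)]
    have : (t : ℝ) + 2 ≤ s₀ := by exact_mod_cast hs₀
    push_cast
    linarith
  linarith

theorem log_le_clog {t s : ℕ} (hs : s = t + 1) (ht : 2 ≤ t) :
    Real.log s ≤ 2 * Nat.clog 2 t ∧ (Nat.clog 2 t : ℝ) ≤ 2 * Real.log s + 1 := by
  subst hs
  have htR : (2 : ℝ) ≤ t := by exact_mod_cast ht
  have h2 : (0.69 : ℝ) < Real.log 2 ∧ Real.log 2 < 0.7 :=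
    ⟨by linarith [Real.log_two_gt_d9], by linarith [Real.log_two_lt_d9]⟩
  set Λ := Nat.clog 2 t with hΛ
  constructor
  · have h1 : (t : ℝ) ≤ 2 ^ Λ := by exact_mod_cast Nat.le_pow_clog one_lt_two t
    have h3 := Real.log_le_log (by linarith) h1
    rw [Real.log_pow] at h3
    have h4 : Real.log ((t + 1 : ℕ) : ℝ) ≤ Real.log ((t : ℝ) ^ 2) := by
      apply Real.log_le_log (by positivity)
      push_cast
      nlinarith
    rw [Real.log_pow] at h4
    push_cast at h4 ⊢
    nlinarith [(Nat.cast_nonneg Λ : (0 : ℝ) ≤ Λ)]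
  · have hpos : 0 < Λ := Nat.clog_pos one_lt_two (by omega)
    have h1 : ((2 : ℝ)) ^ (Λ - 1) ≤ (t + 1 : ℕ) := by
      have := (Nat.pow_pred_clog_lt_self one_lt_two (by omega : 1 < t)).le
      exact_mod_cast this.trans (Nat.le_succ t)
    have h3 := Real.log_le_log (by positivity) h1
    rw [Real.log_pow, Nat.cast_sub hpos] at h3
    push_cast at h3 ⊢
    have : (1 : ℝ) ≤ Λ := by exact_mod_cast hpos
    nlinarith

/-- The number of sides of the coin is comparable to `√(s / log s)`. -/
theorem sqrt_div_clog {t s : ℕ} {ε : ℝ} (hs : s = t + 1) (ht : 2 ≤ t) (hL : 1 ≤ Real.log s)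
    (hε : 0 < ε) (hε2 : ε ^ 2 * s = Real.log s) (hε1 : ε ≤ 1 / 30) :
    (Nat.sqrt (t / Nat.clog 2 t) : ℝ) * ε ≤ 3 / 2 ∧
      1 ≤ ((Nat.sqrt (t / Nat.clog 2 t) : ℝ) - 1) * (3 * ε) := by
  obtain ⟨h1, h2⟩ := log_le_clog hs ht
  set Λ := Nat.clog 2 t with hΛ
  set Q := Nat.sqrt (t / Λ) with hQ
  have hpos : 0 < Λ := Nat.clog_pos one_lt_two (by omega)
  have hΛ0 : (0 : ℝ) < Λ := by exact_mod_cast hpos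
  have htR : (2 : ℝ) ≤ t := by exact_mod_cast ht
  have hsR : (s : ℝ) = t + 1 := by exact_mod_cast hs
  constructor
  · have e1 : Q * Q * Λ ≤ t :=
      (Nat.mul_le_mul_right _ (Nat.sqrt_le _)).trans (Nat.div_mul_le_self _ _)
    have e2 : (Q : ℝ) * Q * Λ ≤ t := by exact_mod_cast e1
    have e3 : (Q : ℝ) * Q * (ε ^ 2 * s) ≤ 2 * s := by
      rw [hε2]
      calc (Q : ℝ) * Q * Real.log s ≤ Q * Q * (2 * Λ) := by gcongr
        _ ≤ _ := by linarith
    have e4 : (Q * ε) ^ 2 ≤ 2 := by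
      refine le_of_mul_le_mul_right ?_ (by linarith : (0 : ℝ) < s)
      linarith
    nlinarith
  · have e1 : t < (Q + 1) * (Q + 1) * Λ := by
      rw [← Nat.div_lt_iff_lt_mul hpos]
      exact Nat.lt_succ_sqrt _
    have e2 : (t : ℝ) ≤ (Q + 1) * (Q + 1) * Λ := by exact_mod_cast e1.le
    have e3 : (1 : ℝ) * s ≤ (Q + 1) * (Q + 1) * (6 * ε ^ 2) * s := by
      calc (1 : ℝ) * s ≤ 2 * t := by linarith
        _ ≤ 2 * ((Q + 1) * (Q + 1) * (3 * Real.log s)) := by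
          have : (Λ : ℝ) ≤ 3 * Real.log s := by linarith
          have : ((Q : ℝ) + 1) * (Q + 1) * Λ ≤ (Q + 1) * (Q + 1) * (3 * Real.log s) := by gcongr
          linarith
        _ = _ := by rw [← hε2]; ring
    have e4 := le_of_mul_le_mul_right e3 (by linarith : (0 : ℝ) < s)
    -- From `1 ≤ 6 * ((Q + 1) * ε) ^ 2`. The bound `ε ≤ 1 / 30` then passes from `Q + 1` to `Q - 1`,
    -- as `3 * (2 / 5) - 6 / 30 = 1`.
    have e5 : 2 / 5 ≤ ((Q : ℝ) + 1) * ε := by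
      by_contra hlt
      have : (0 : ℝ) ≤ ((Q : ℝ) + 1) * ε := by positivity
      nlinarith
    linarith

set_option maxHeartbeats 1000000 in
-- Now `q = 1 / Q` and `ρ = δ = 1 / (Q - 1)`. The powers of `1 - q` give `exp (-(t - 1) / Q)`, which
-- must beat `exp (δ * y * μ)` by a factor `S ^ 3`; the polynomial prefactor is only linear in `S`,
-- so this leaves less than the room `3 / (4 * t + 1)`.
theorem processCondition_sqrt {s : ℕ} {μ ε : ℝ} (hs : 16 ≤ s) (hL : 1 ≤ Real.log s)
    (hε : 0 < ε) (hε2 : ε ^ 2 * s = Real.log s) (hε1 : ε ≤ 1 / 30) (hμ0 : 0 ≤ μ)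
    (hμ : μ * (1 + 20 * ε) ≤ s) :
    1 < Nat.sqrt ((s - 1) / Nat.clog 2 (s - 1)) - 1 + 1 ∧
    ProcessCondition (s - 1) 1 (Nat.sqrt ((s - 1) / Nat.clog 2 (s - 1)) - 1 + 1) μ
      (1 + 1 / (s - 1 : ℕ)) (1 + 1 / (4 * (s - 1) : ℕ)) := by
  obtain ⟨t, rfl⟩ : ∃ t, s = t + 1 := ⟨s - 1, by omega⟩
  obtain ⟨hQ1, hQ2⟩ := sqrt_div_clog rfl (by omega) hL hε hε2 hε1
  rw [Nat.add_sub_cancel]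
  set R := Nat.sqrt (t / Nat.clog 2 t) with hR
  have hR1 : (1 : ℝ) < R := by
    by_contra hlt
    nlinarith
  have hRn : 1 < R := by exact_mod_cast hR1
  rw [Nat.sub_add_cancel hRn.le]
  refine ⟨hRn, ?_⟩
  set Q : ℝ := (R : ℝ) with hQ
  set S : ℝ := ((t + 1 : ℕ) : ℝ) with hS
  have hSt : S = t + 1 := by rw [hS]; push_cast; rfl
  have hS16 : (16 : ℝ) ≤ S := by rw [hS]; exact_mod_cast hs
  have htR : (15 : ℝ) ≤ t := by linarith
  unfold ProcessCondition
  rw [y_div_z (by omega)]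
  set y : ℝ := 1 + 1 / t with hy
  have hy0 : 0 < y := by positivity
  have hy2 : y ≤ 2 := by
    have : 1 / (t : ℝ) ≤ 1 := by rw [div_le_one (by linarith)]; linarith
    linarith
  have hyS : y * S ≤ S + 2 := by
    have : y * S = S + 1 + 1 / t := by rw [hy, hSt]; field_simp; ring
    linarith
  set a : ℝ := 1 - (1 : ℕ) / Q with ha
  have hQi : 1 / Q < 1 := by rw [div_lt_one (by linarith)]; exact hR1
  have haQ : a = 1 - 1 / Q := by rw [ha]; push_cast; rfl
  have ha0 : 0 < a := by rw [haQ]; linarith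
  have ha1 : a ≤ 1 := by rw [haQ]; linarith [show 0 < 1 / Q by positivity]
  have hρ : ((1 : ℕ) : ℝ) / Q / a = 1 / (Q - 1) := by
    have : Q - 1 ≠ 0 := by linarith
    rw [haQ]
    have h : 1 - 1 / Q = (Q - 1) / Q := by field_simp
    rw [h]
    push_cast
    field_simp
  rw [hρ]
  set δ : ℝ := 1 / (Q - 1) with hδ
  have hδ0 : 0 < δ := by rw [hδ]; exact one_div_pos.2 (by linarith)
  have hδ3 : δ ≤ 3 * ε := by
    rw [hδ, div_le_iff₀ (by linarith)]
    linarith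
  have hμS : μ ≤ S := by nlinarith
  -- the exponent
  have hpow : a ^ (t - 1) ≤ Real.exp (-((t - 1 : ℝ) / Q)) := by
    have h1 : a ≤ Real.exp (-(1 / Q)) := by
      rw [haQ]
      linarith [Real.add_one_le_exp (-(1 / Q))]
    calc a ^ (t - 1) ≤ Real.exp (-(1 / Q)) ^ (t - 1) := by gcongr
      _ = _ := by
        rw [← Real.exp_nat_mul, Nat.cast_sub (by omega)]
        congr 1
        push_cast
        ring
  -- Since `(S * ε) ^ 2 = S * log S ≥ 16`; the value `4` absorbs the lower order terms below.
  have hSε : 4 ≤ S * ε := by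
    have : 0 ≤ S * ε := by positivity
    by_contra hlt
    nlinarith
  have hQL : Q * Real.log S ≤ 3 / 2 * (S * ε) := by
    rw [← hε2]
    calc Q * (ε ^ 2 * S) = (Q * ε) * (S * ε) := by ring
      _ ≤ _ := by gcongr
  -- The hypothesis on `μ` gives `S - 5 * (S * ε)`. Of this gap, `9 / 2 * (S * ε)` pays for `3 * (Q
  -- * log S)` and the remaining half for `t - 1 = S - 2`.
  have hmain : y * μ * (1 + δ) ≤ (t - 1) - 3 * (Q * Real.log S) := by
    have e1 : (y * μ * (1 + δ)) * (1 + 20 * ε) ≤ (S - 5 * (S * ε)) * (1 + 20 * ε) := by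
      calc (y * μ * (1 + δ)) * (1 + 20 * ε) = (μ * (1 + 20 * ε)) * (y * (1 + δ)) := by ring
        _ ≤ S * (y * (1 + 3 * ε)) := by gcongr
        _ = (y * S) * (1 + 3 * ε) := by ring
        _ ≤ (S + 2) * (1 + 3 * ε) := by gcongr
        _ ≤ _ := by nlinarith
    have e2 := le_of_mul_le_mul_right e1 (by positivity)
    linarith
  have hexp : -((t - 1 : ℝ) / Q) + δ * y * μ ≤ -(3 * Real.log S) := by
    have hδQ : δ * Q = 1 + δ := by
      have : Q - 1 ≠ 0 := by linarith
      rw [hδ]; field_simp; ring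
    refine le_of_mul_le_mul_right ?_ (by linarith : (0 : ℝ) < Q)
    calc (-((t - 1 : ℝ) / Q) + δ * y * μ) * Q = -(t - 1) + y * μ * (δ * Q) := by
          field_simp
      _ ≤ _ := by rw [hδQ]; linarith
  have hfac : a ^ t * y + a ^ (t - 1) * y ^ 2 * μ ≤
      (2 + 4 * S) * Real.exp (-((t - 1 : ℝ) / Q)) := by
    have e0 : a ^ t ≤ a ^ (t - 1) := pow_le_pow_of_le_one ha0.le ha1 (by omega)
    have e1 : a ^ t * y ≤ Real.exp (-((t - 1 : ℝ) / Q)) * 2 :=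
      mul_le_mul (e0.trans hpow) hy2 hy0.le (Real.exp_nonneg _)
    have e2 : a ^ (t - 1) * y ^ 2 * μ ≤ Real.exp (-((t - 1 : ℝ) / Q)) * 2 ^ 2 * S := by
      gcongr
    linarith
  have hlast : (2 + 4 * S) * Real.exp (-(3 * Real.log S)) ≤ 3 / (4 * t + 1) := by
    have e1 : Real.exp (-(3 * Real.log S)) = 1 / S ^ 3 := by
      rw [Real.exp_neg, mul_comm, Real.exp_mul, Real.exp_log (by linarith), one_div]
      norm_cast
    rw [e1, mul_one_div, div_le_div_iff₀ (by positivity) (by positivity)]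
    have e2 : (t : ℝ) = S - 1 := by linarith
    rw [e2]
    nlinarith [mul_nonneg (mul_nonneg (by linarith : (0 : ℝ) ≤ S) (by linarith : (0 : ℝ) ≤ S))
      (by linarith : (0 : ℝ) ≤ S - 16)]
  have : (a ^ t * y + a ^ (t - 1) * y ^ 2 * μ) * Real.exp (δ * y * μ) ≤
      (2 + 4 * S) * Real.exp (-(3 * Real.log S)) := by
    calc _ ≤ (2 + 4 * S) * Real.exp (-((t - 1 : ℝ) / Q)) * Real.exp (δ * y * μ) := by gcongr
      _ = (2 + 4 * S) * Real.exp (-((t - 1 : ℝ) / Q) + δ * y * μ) := by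
        rw [Real.exp_add]; ring
      _ ≤ _ := by gcongr
  linarith

theorem tendsto_sqrt_log_div :
    Filter.Tendsto (fun s : ℕ => Real.sqrt (Real.log s / s)) Filter.atTop (nhds 0) := by
  have h1 : Filter.Tendsto (fun x : ℝ => Real.log x / x) Filter.atTop (nhds 0) :=
    Real.isLittleO_log_id_atTop.tendsto_div_nhds_zero
  have h2 := (Real.continuous_sqrt.tendsto 0).comp (h1.comp tendsto_natCast_atTop_atTop)
  rw [Real.sqrt_zero] at h2
  exact h2

theorem exists_parameters : ∃ (c : ℝ) (s₀ Q₀ : ℕ), 0 < c ∧ 3 ≤ s₀ ∧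
    ∀ (s : ℕ) (μ : ℝ), 2 ≤ s → 0 ≤ μ → μ * (1 + c * Real.sqrt (Real.log s / s)) ≤ s →
      (coinParameters s₀ Q₀ s).1 < (coinParameters s₀ Q₀ s).2 ∧
      ProcessCondition (s - 1) (coinParameters s₀ Q₀ s).1 (coinParameters s₀ Q₀ s).2 μ
        (1 + 1 / (s - 1 : ℕ)) (1 + 1 / (4 * (s - 1) : ℕ)) := by
  obtain ⟨s₀, hs₀⟩ := Filter.eventually_atTop.1
    (((tendsto_sqrt_log_div.eventually (ge_mem_nhds (by norm_num : (0 : ℝ) < 1 / 30))).and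
      ((Real.tendsto_log_atTop.comp tendsto_natCast_atTop_atTop).eventually_ge_atTop 1)).and
      (Filter.eventually_ge_atTop 16))
  have hs₀16 : 16 ≤ s₀ := (hs₀ s₀ le_rfl).2
  -- The summand `20` serves `s ≥ s₀`; the first one forces `μ * (2 * (Q₀ + 1)) ≤ 1` for `s < s₀`.
  set c : ℝ := 4 * s₀ ^ 2 * ((16 * s₀ : ℕ) + 1) + 20 with hc
  have hc20 : 20 ≤ c := by
    have : (0 : ℝ) ≤ 4 * s₀ ^ 2 * ((16 * s₀ : ℕ) + 1) := by positivity
    linarith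
  refine ⟨c, s₀, 16 * s₀, by linarith, by omega, fun s μ hs hμ0 hμ => ?_⟩
  unfold coinParameters
  set ε := Real.sqrt (Real.log s / s) with hε
  have hsR : (2 : ℝ) ≤ s := by exact_mod_cast hs
  have hlog : Real.log 2 ≤ Real.log s := Real.log_le_log (by norm_num) hsR
  have hlog2 := Real.log_two_gt_d9
  have hε0 : 0 < ε := Real.sqrt_pos.2 (div_pos (by linarith) (by linarith))
  have hε2 : ε ^ 2 * s = Real.log s := by
    rw [hε, Real.sq_sqrt (div_nonneg (by linarith) (by linarith))]
    field_simp
  by_cases hlt : s < s₀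
  · rw [if_pos hlt]
    refine ⟨Nat.lt_succ_self _, processCondition_const hs hlt rfl hμ0 ?_⟩
    have hsl : (s : ℝ) ≤ s₀ := by exact_mod_cast hlt.le
    have hs16 : (16 : ℝ) ≤ s₀ := by exact_mod_cast hs₀16
    -- `ε` is bounded below for `2 ≤ s < s₀`, because `ε ^ 2 * s = log s ≥ log 2`.
    have h1 : 1 ≤ ε * (2 * s₀) := by
      by_contra hcon
      have h2 : 0 ≤ ε * (2 * s₀) := by positivity
      have h3 : (ε * (2 * s₀)) ^ 2 < 1 := by nlinarith
      have h4 : ε ^ 2 * s ≤ ε ^ 2 * s₀ := by gcongr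
      nlinarith
    set A : ℝ := 2 * (((16 * s₀ : ℕ) : ℝ) + 1) with hA
    have hA0 : 0 ≤ A := by positivity
    have h2 : μ * A * s₀ ≤ 1 * s₀ := by
      calc μ * A * s₀ ≤ μ * A * s₀ * (ε * (2 * s₀)) := le_mul_of_one_le_right (by positivity) h1
        _ = μ * ((2 * s₀ ^ 2 * A) * ε) := by ring
        _ ≤ μ * (1 + c * ε) := by
          have : 2 * s₀ ^ 2 * A ≤ c := by rw [hA, hc]; linarith
          gcongr
          have : 2 * s₀ ^ 2 * A * ε ≤ c * ε := by gcongr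
          linarith
        _ ≤ s := hμ
        _ ≤ 1 * s₀ := by linarith
    exact le_of_mul_le_mul_right h2 (by linarith)
  · rw [if_neg hlt]
    obtain ⟨⟨h1, h2⟩, h3⟩ := hs₀ s (not_lt.1 hlt)
    refine processCondition_sqrt h3 h2 hε0 hε2 h1 hμ0 (le_trans ?_ hμ)
    gcongr

end Parameters

/-! ### Transfer to arbitrary vertex types, the lower bound, and the asymptotics -/

section Assembly

theorem IsGoodTransversal.preimage {V W ι κ : Type*} {G : SimpleGraph V} {H : SimpleGraph W}
    (e : G ≃g H) (f : ι ≃ κ) {blk : V → ι} {blk' : W → κ} (hblk : ∀ v, blk' (e v) = f (blk v))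
    {s : ℕ} {T : Set W} (h : IsGoodTransversal H blk' s T) :
    IsGoodTransversal G blk s (e ⁻¹' T) := by
  classical
  obtain ⟨h1, h2, h3⟩ := h
  refine ⟨fun i => ?_, fun v hv => ?_, fun A hA hcl => ?_⟩
  · obtain ⟨w, ⟨hw, hwi⟩, huniq⟩ := h1 (f i)
    refine ⟨e.symm w, ⟨by simpa using hw, f.injective ?_⟩, ?_⟩
    · rw [← hblk, e.apply_symm_apply, hwi]
    · rintro v ⟨hv, rfl⟩
      rw [← huniq (e v) ⟨hv, hblk v⟩, e.symm_apply_apply]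
  · have := h2 (e v) hv
    rwa [← Set.ncard_preimage_of_injective_subset_range e.injective
      (by rw [Set.range_eq_univ.2 e.surjective]; exact Set.subset_univ _),
      show e ⁻¹' (H.neighborSet (e v) ∩ T) = G.neighborSet v ∩ e ⁻¹' T by
        ext w; simp [e.map_adj_iff]] at this
  · refine h3 (t := A.map e.toEquiv.toEmbedding) ?_ ?_
    · intro w hw
      simp only [Finset.coe_map, Set.mem_image] at hw
      obtain ⟨v, hv, rfl⟩ := hw
      exact hA hv
    · have := hcl.map (f := e.toEquiv.toEmbedding)
      convert this using 1
      ext a b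
      rw [SimpleGraph.map_adj]
      constructor
      · intro hab
        exact ⟨e.symm a, e.symm b, e.symm.map_adj_iff.2 hab, by simp, by simp⟩
      · rintro ⟨u, v, huv, rfl, rfl⟩
        exact e.map_adj_iff.2 huv

/-- If no run halted, every term of the series for the expected time would be `1`. -/
theorem exists_halted_of_expectedTime_ne_top {P : Cmd} {σ : Store} (h : expectedTime P σ ≠ ∞) :
    ∃ t, ∃ d ∈ (run t ([P], σ)).support, Halted d := by
  by_contra hcon
  push Not at hcon
  refine h ?_
  unfold expectedTime
  have : ∀ t, (run t ([P], σ)).toOuterMeasure {d | ¬ Halted d} = 1 := fun t =>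
    (PMF.toOuterMeasure_apply_eq_one_iff _ _).2 fun d hd => hcon t d hd
  simp [this]

theorem div_mul_le_of_condition {s b Δ : ℕ} {x : ℝ} (hs : 2 ≤ s) (hb : 0 < b)
    (h : (b : ℝ) ≥ (Δ : ℝ) / s * x) : (Δ : ℝ) / b * x ≤ s := by
  have hs0 : (0 : ℝ) < s := by exact_mod_cast (by omega : 0 < s)
  have hb0 : (0 : ℝ) < b := by exact_mod_cast hb
  rw [ge_iff_le, div_mul_eq_mul_div, div_le_iff₀ hs0] at h
  rw [div_mul_eq_mul_div, div_le_iff₀ hb0]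
  linarith

/-- Positive block size makes `blk` surjective, so the index type is finite as well and both types
can be relabelled by `Fin`. -/
theorem exists_goodTransversal_of_fin {V ι : Type*} [Fintype V] {G : SimpleGraph V}
    [DecidableRel G.Adj] {blk : V → ι} {s b : ℕ} (hb : 0 < b) (hblk : BlocksHaveSize blk b)
    (h : ∀ (n l : ℕ) (H : SimpleGraph (Fin n)) [DecidableRel H.Adj] (blk' : Fin n → Fin l),
      BlocksHaveSize blk' b → H.maxDegree = G.maxDegree →
        ∃ T : Set (Fin n), IsGoodTransversal H blk' s T) :
    ∃ T : Set V, IsGoodTransversal G blk s T := by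
  classical
  have hsurj : Function.Surjective blk := by
    intro i
    have : 0 < {v : V | blk v = i}.ncard := by rw [hblk i]; exact hb
    obtain ⟨v, hv⟩ := Set.nonempty_of_ncard_ne_zero this.ne'
    exact ⟨v, hv⟩
  have : Finite ι := Finite.of_surjective blk hsurj
  have : Fintype ι := Fintype.ofFinite ι
  let e := Fintype.equivFin V
  let f := Fintype.equivFin ι
  let H : SimpleGraph (Fin (Fintype.card V)) := G.map e.toEmbedding
  let E : G ≃g H := SimpleGraph.Iso.map e G
  have hH : BlocksHaveSize (fun w => f (blk (e.symm w))) b := by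
    intro i
    rw [← hblk (f.symm i), ← Set.ncard_preimage_of_injective_subset_range e.injective
      (by rw [Set.range_eq_univ.2 e.surjective]; exact Set.subset_univ _)]
    congr 1
    ext v
    simp [Equiv.eq_symm_apply]
  obtain ⟨T, hT⟩ := h _ _ H _ hH E.maxDegree_eq.symm
  exact ⟨_, hT.preimage E f fun v => congrArg (fun w => f (blk w)) (e.symm_apply_apply v)⟩

/-- Take the complete graph on `s` vertices with singleton blocks: `b = 1`, the maximum degree is `s
- 1`, and the only transversal is `K_s` itself. -/
theorem CliqueAdmissible.one_div_le {s : ℕ} (hs : 2 ≤ s) {g : ℝ} (h : CliqueAdmissible s g) :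
    1 / ((s : ℝ) - 1) ≤ g := by
  have hsR : (2 : ℝ) ≤ s := by exact_mod_cast hs
  by_contra hlt
  rw [not_le, lt_div_iff₀ (by linarith)] at hlt
  have : NeZero s := ⟨by omega⟩
  obtain ⟨T, hT, hfree⟩ := h s s 1 ⊤ id one_pos (fun i => by simp) (by
    have : (⊤ : SimpleGraph (Fin s)).maxDegree = s - 1 := by
      have hreg : (⊤ : SimpleGraph (Fin s)).IsRegularOfDegree (s - 1) := by
        intro v; simp
      exact hreg.maxDegree_eq
    rw [this, Nat.cast_sub (by omega)]
    push_cast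
    linarith)
  refine hfree (t := Finset.univ) ?_ ⟨fun a _ b _ hab => hab, by simp⟩
  intro v _
  obtain ⟨w, ⟨hw, hwv⟩, -⟩ := hT v
  rwa [← show w = v from hwv]

theorem one_div_le_gammaConst {s : ℕ} (hs : 2 ≤ s) {g : ℝ} (h : CliqueAdmissible s g) :
    1 / ((s : ℝ) - 1) ≤ gammaConst s :=
  le_csInf ⟨g, h⟩ fun _ h' => h'.one_div_le hs

/-- The real infimum is meaningful only for a set bounded below, which the complete graph provides.
-/
theorem gammaConst_le {s : ℕ} (hs : 2 ≤ s) {g : ℝ} (h : CliqueAdmissible s g) :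
    gammaConst s ≤ g :=
  csInf_le ⟨1 / ((s : ℝ) - 1), fun _ h' => h'.one_div_le hs⟩ h

/-- Divided by `s / (s - 1) ^ 2`, the two bounds become `1 - 1 / s` and `(1 - 1 / s) ^ 2 * (1 + c *
√(log s / s))`, and both tend to `1`. -/
theorem isEquivalent_of_bounds {γ : ℕ → ℝ} {c : ℝ}
    (h1 : ∀ s : ℕ, 2 ≤ s → 1 / ((s : ℝ) - 1) ≤ γ s)
    (h2 : ∀ s : ℕ, 2 ≤ s → γ s ≤ 1 / s * (1 + c * Real.sqrt (Real.log s / s))) :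
    Asymptotics.IsEquivalent Filter.atTop γ (fun s : ℕ => (s : ℝ) / ((s : ℝ) - 1) ^ 2) := by
  refine Asymptotics.isEquivalent_of_tendsto_one ?_
  have hd : Filter.Tendsto (fun s : ℕ => 1 - 1 / (s : ℝ)) Filter.atTop (nhds 1) := by
    simpa using tendsto_one_div_atTop_nhds_zero_nat.const_sub (1 : ℝ)
  have hu : Filter.Tendsto
      (fun s : ℕ => (1 - 1 / (s : ℝ)) ^ 2 * (1 + c * Real.sqrt (Real.log s / s)))
      Filter.atTop (nhds 1) := by
    simpa using (hd.pow 2).mul ((tendsto_sqrt_log_div.const_mul c).const_add 1)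
  refine tendsto_of_tendsto_of_tendsto_of_le_of_le' hd hu ?_ ?_
  · filter_upwards [Filter.eventually_ge_atTop 2] with s hs
    have hsR : (2 : ℝ) ≤ s := by exact_mod_cast hs
    have hs1 : (0 : ℝ) < s - 1 := by linarith
    rw [Pi.div_apply, le_div_iff₀ (by positivity)]
    refine le_of_eq_of_le ?_ (h1 s hs)
    field_simp
  · filter_upwards [Filter.eventually_ge_atTop 2] with s hs
    have hsR : (2 : ℝ) ≤ s := by exact_mod_cast hs
    have hs1 : (0 : ℝ) < s - 1 := by linarith
    rw [Pi.div_apply, div_le_iff₀ (by positivity)]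
    refine (h2 s hs).trans_eq ?_
    field_simp

/-- The bound on the expected number of steps. -/
noncomputable def timeBound : Polynomial ℕ := 1000 * (Polynomial.X + 1) ^ 3

theorem exists_program : ∃ (c : ℝ) (P : Cmd), 0 < c ∧
    ∀ (n l : ℕ) (G : SimpleGraph (Fin n)) [DecidableRel G.Adj] (blk : Fin n → Fin l)
      (s b : ℕ), 2 ≤ s → 0 < b → BlocksHaveSize blk b →
      (b : ℝ) ≥ (G.maxDegree : ℝ) / s * (1 + c * Real.sqrt (Real.log s / s)) →
        expectedTime P (inputStore G blk s) ≤ ((timeBound.eval n : ℕ) : ℝ≥0∞) ∧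
        ∀ t, ∀ d ∈ (run t ([P], inputStore G blk s)).support, Halted d →
          IsGoodTransversal G blk s (outputSet n l d.2) := by
  classical
  obtain ⟨c, s₀, Q₀, hc, hs₀, hpar⟩ := exists_parameters
  refine ⟨c, Cmd.program s₀ Q₀, hc, fun n l G _ blk s b hs hb hblk hcond => ?_⟩
  obtain ⟨hnum, hproc⟩ := hpar s (G.maxDegree / b) hs (by positivity)
    (div_mul_le_of_condition hs hb hcond)
  have hle := ert_program_le hs hs₀ hb hblk hnum hproc
  have hp : timeBound.eval n = 1000 * (n + 1) ^ 3 := by simp [timeBound]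
  rw [hp]
  refine ⟨(expectedTime_le_ert _ _ _).trans hle, fun t d hd hh => ?_⟩
  exact of_halted_of_ert_ne_top
    (Good := fun τ => IsGoodTransversal G blk s (outputSet n l τ))
    (ne_top_of_le_ne_top (ENNReal.natCast_ne_top _) hle) hd hh

end Assembly

end AvoidClique

theorem theorem4p2 :
    ∃ c : ℝ, 0 < c ∧
      -- existence of the transversal
      (∀ (V ι : Type*) [Fintype V] (G : SimpleGraph V) [DecidableRel G.Adj] (blk : V → ι)
          (s b : ℕ), 2 ≤ s → 0 < b → AvoidClique.BlocksHaveSize blk b →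
          (b : ℝ) ≥ (G.maxDegree : ℝ) / s * (1 + c * Real.sqrt (Real.log s / s)) →
            ∃ T : Set V, AvoidClique.IsGoodTransversal G blk s T) ∧
      -- one randomized program, of expected polynomial running time, always finds one
      (∃ (P : AvoidClique.Cmd) (p : Polynomial ℕ),
        ∀ (n l : ℕ) (G : SimpleGraph (Fin n)) [DecidableRel G.Adj] (blk : Fin n → Fin l)
          (s b : ℕ), 2 ≤ s → 0 < b → AvoidClique.BlocksHaveSize blk b →
          (b : ℝ) ≥ (G.maxDegree : ℝ) / s * (1 + c * Real.sqrt (Real.log s / s)) →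
            AvoidClique.expectedTime P (AvoidClique.inputStore G blk s) ≤ ((p.eval n : ℕ) : ENNReal) ∧
            ∀ (t : ℕ),
              ∀ d ∈ (AvoidClique.run t ([P], AvoidClique.inputStore G blk s)).support,
                AvoidClique.Halted d →
                  AvoidClique.IsGoodTransversal G blk s (AvoidClique.outputSet n l d.2)) ∧
      -- the bound on the optimal constant for omitting cliques
      (∀ s : ℕ, 2 ≤ s →
        AvoidClique.CliqueAdmissible s (1 / s * (1 + c * Real.sqrt (Real.log s / s))) ∧
        AvoidClique.gammaConst s ≤ 1 / s * (1 + c * Real.sqrt (Real.log s / s))) ∧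
      -- the value conjectured for this constant is asymptotically correct
      Asymptotics.IsEquivalent Filter.atTop (fun s : ℕ => AvoidClique.gammaConst s)
        (fun s : ℕ => (s : ℝ) / ((s : ℝ) - 1) ^ 2) := by
  obtain ⟨c, P, hc, key⟩ := AvoidClique.exists_program
  have exist : ∀ (n l : ℕ) (G : SimpleGraph (Fin n)) [DecidableRel G.Adj] (blk : Fin n → Fin l)
      (s b : ℕ), 2 ≤ s → 0 < b → AvoidClique.BlocksHaveSize blk b →
      (b : ℝ) ≥ (G.maxDegree : ℝ) / s * (1 + c * Real.sqrt (Real.log s / s)) →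
      ∃ T, AvoidClique.IsGoodTransversal G blk s T := by
    intro n l G _ blk s b hs hb hblk hcond
    obtain ⟨h1, h2⟩ := key n l G blk s b hs hb hblk hcond
    obtain ⟨t, d, hd, hh⟩ := AvoidClique.exists_halted_of_expectedTime_ne_top
      (ne_top_of_le_ne_top (ENNReal.natCast_ne_top _) h1)
    exact ⟨_, h2 t d hd hh⟩
  have adm : ∀ s : ℕ, 2 ≤ s →
      AvoidClique.CliqueAdmissible s (1 / s * (1 + c * Real.sqrt (Real.log s / s))) := by
    intro s hs n l b G _ blk hb hblk hcond
    obtain ⟨T, h1, -, h3⟩ := exist n l G blk s b hs hb hblk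
      (le_of_eq_of_le (by ring) hcond)
    exact ⟨T, h1, h3⟩
  refine ⟨c, hc, ?_, ⟨P, AvoidClique.timeBound, key⟩,
    fun s hs => ⟨adm s hs, AvoidClique.gammaConst_le hs (adm s hs)⟩,
    AvoidClique.isEquivalent_of_bounds
      (fun s hs => AvoidClique.one_div_le_gammaConst hs (adm s hs))
      fun s hs => AvoidClique.gammaConst_le hs (adm s hs)⟩
  intro V ι _ G _ blk s b hs hb hblk hcond
  refine AvoidClique.exists_goodTransversal_of_fin hb hblk fun n l H _ blk' hblk' hΔ => ?_
  exact exist n l H blk' s b hs hb hblk' (by rwa [hΔ])
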